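/- **Theorem (Subspace SVE).** *Conventions.* For $p<q$ in $[N]$ let $G(p,q,\theta)\in\mathbb R^{N\times N}$ be the Givens rotation with $G_{pp}=G_{qq}=\cos\theta$, $G_{qp}=-G_{pq}=\sin\theta$ (identity elsewhere), and let $FBS_{pq}(\theta)$ be the gate on $N$ qubits that is the identity on the strings whose bits $p,q$ are equal, acts on the bits $(p,q)$ in the basis $|01\rangle,|10\rangle$ as $\begin{pmatrix}\cos\theta&(-1)^f\sin\theta\\-(-1)^f\sin\theta&\cos\theta\end{pmatrix}$, where $f$ is the number of ones strictly between $p$ and $q$, and fixes the other bits. A Givens circuit $\mathcal G=\prod_\ell FBS_{p_\ell q_\ell}(\theta_\ell)$ has the orthogonal matrix $U(\mathcal G)=\prod_\ell G(p_\ell,q_\ell,\theta_\ell)$ and cost $T(\mathcal G)$ equal to its number of gates. For $X\in\mathbb R^{N\times k}$ with orthonormal columns, $|Col(X)\rangle=\sum_{|T|=k}\det(X_T)|T\rangle$, with $X_T$ the rows of $X$ in $T$; $V_S$ denotes the columns of $V$ in $S$. Elementary gates are arbitrary unitaries on at most three qubits. A *program* is a finite list of elementary gates and of calls of a given Givens circuit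 $\mathcal G$ or of its inverse on the $N$ system qubits; its cost is its total number of gates when each call is written out as its $T(\mathcal G)$ gates. *Statement.* For all $c,\delta>0$ there is a constant $C$ such that for all $N,m,n$, all $I,J\subseteq[N]$ with $|I|=m$, $|J|=n$, and all $0<\epsilon\le1$ there is a finite non-empty family of programs $(P_r)_{r\in\mathcal R}$ on $N$ system qubits, an output register of some number $t$ of qubits and some work qubits, such that for every Givens circuit $\mathcal G$ on $N$ qubits with $N\le c\,T(\mathcal G)$ the following holds with $U=U(\mathcal G)$ and $T(U)=T(\mathcal G)$. 1. Every $P_r$, run with $\mathcal G$, has cost at most $C\,T(U)/\epsilon$. 2. Let $A=U_{IJ}\in\mathbb R^{m\times n}$ be the block of $U$ with rows $I$ and columns $J$, and let $A=W\Sigma V^T$ be any full singular value decomposition, with singular values $\sigma_1,\dots,\sigma_n\ge0$ ($\sigma_i=0$ for $i>m$). Then there are $t$-bit strings $\overline{\theta_{S}}^{(r)}$ ($r\in\mathcal R$, $S\subseteq[n]$), read as the angles $\pi\cdot 0.b_{t-1}\dots b_0\in[0,\pi)$, with $$\Big|\cos\overline{\theta_S}^{(r)}-\prod_{i\in S}\sigma_i\Big|\le\epsilon\qquad\text{for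 all } r \text{ and } S,$$ such that for every $k$ and all $\alpha_S\in\mathbb C$ ($S\subseteq[n]$, $|S|=k$) with $\sum_S|\alpha_S|^2=1$, with probability at least $1-\delta$ over a uniformly random $r\in\mathcal R$, the circuit $P_r$ run with $\mathcal G$ implements the map $$\sum_{|S|=k}\alpha_S|Col(V_S)\rangle|0\rangle|0\rangle\ \mapsto\ \sum_{|S|=k}\alpha_S|Col(V_S)\rangle|\overline{\theta_S}^{(r)}\rangle|0\rangle$$ up to an error of norm at most $\delta$. Here $|Col(V_S)\rangle$ is held by the system qubits $J$, the others being $0$, and the last register holds the work qubits. -/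

import Mathlib

open scoped BigOperators Matrix

noncomputable section

namespace SubspaceSVE

/-! ### Givens rotations, fermionic beam splitters, Givens circuits -/

/-- The data `(i, j, θ)`, with `lo < hi`, of a Givens rotation and of the corresponding `FBS` gate. -/
structure GivensGate (N : ℕ) where
  lo : Fin N
  hi : Fin N
  lo_lt_hi : lo < hi
  angle : ℝ

/-- The Givens rotation matrix: `G hi hi = G lo lo = cos θ`, `G hi lo = - G lo hi = sin θ`,
and the identity on the other coordinates. -/
def GivensGate.rotation {N : ℕ} (g : GivensGate N) : Matrix (Fin N) (Fin N) ℝ :=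
  Matrix.of fun i j =>
    if i = j then (if i = g.lo ∨ i = g.hi then Real.cos g.angle else 1)
    else if i = g.hi ∧ j = g.lo then Real.sin g.angle
    else if i = g.lo ∧ j = g.hi then -Real.sin g.angle
    else 0

/-- The number of ones of the bit string `y` strictly between positions `p` and `q`. -/
def onesBetween {N : ℕ} (p q : Fin N) (y : Fin N → Bool) : ℕ :=
  (Finset.univ.filter fun k => p < k ∧ k < q ∧ y k = true).card

/-- The fermionic beam splitter gate on `N` qubits; the entry at `(x, y)` is `⟨x| FBS |y⟩`.
In the basis `00, 01, 10, 11` of the qubits `(lo, hi)` it is the identity on `00` and `11`, and on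
`01, 10` it is the matrix with rows `(cos θ, (-1)^f sin θ)` and `(-(-1)^f sin θ, cos θ)`, where `f`
is the number of ones strictly between the two qubits. The other qubits do not change. -/
def GivensGate.fbs {N : ℕ} (g : GivensGate N) : Matrix (Fin N → Bool) (Fin N → Bool) ℂ :=
  Matrix.of fun x y =>
    if x = y then (if y g.lo = y g.hi then 1 else (Real.cos g.angle : ℂ))
    else if x = y ∘ Equiv.swap g.lo g.hi then
      (if y g.lo = true then 1 else -1) * (-1) ^ onesBetween g.lo g.hi y * (Real.sin g.angle : ℂ)
    else 0

/-- A Givens circuit: a list of gates, in the order of the operator product (the last gate of the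
list is the first one that acts on a state). Its cost is the number of its gates. -/
abbrev GivensCircuit (N : ℕ) := List (GivensGate N)

/-- The orthogonal matrix `U(𝒢)` of a Givens circuit: the product of its Givens rotations. -/
def GivensCircuit.orthogonal {N : ℕ} (G : GivensCircuit N) : Matrix (Fin N) (Fin N) ℝ :=
  (G.map GivensGate.rotation).prod

/-- The inverse Givens circuit: reversed order and opposite angles. -/
def GivensCircuit.inverse {N : ℕ} (G : GivensCircuit N) : GivensCircuit N :=
  (G.map fun g => { g with angle := -g.angle }).reverse

/-! ### Subspace states -/

/-- The subspace state `∑_{|T| = k} det(X_T) |T⟩` of `X ∈ ℝ^{N × k}`. The bit string `x` stands for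
the set `T` of the positions of its ones, and `X_T` has the rows of `X` in `T`, in increasing order.
(If the columns of `X` are orthonormal this is the state `|Col(X)⟩`.) -/
def subspaceState {N k : ℕ} (X : Matrix (Fin N) (Fin k) ℝ) : (Fin N → Bool) → ℂ := fun x =>
  if h : (Finset.univ.filter fun i => x i = true).card = k then
    (((X.submatrix ((Finset.univ.filter fun i => x i = true).orderEmbOfFin h) id).det : ℝ) : ℂ)
  else 0

/-- `V_S`: the columns of `V` in `S`, in increasing order. -/
def columns {n : ℕ} (V : Matrix (Fin n) (Fin n) ℝ) (S : Finset (Fin n)) :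
    Matrix (Fin n) (Fin S.card) ℝ :=
  V.submatrix id (S.orderEmbOfFin rfl)

/-- The coordinate embedding `ℝⁿ → ℝᴺ` that puts the coordinate `j` at position `J j`, applied to
each column of `X`; the other rows are zero. -/
def padRows {N n k : ℕ} (J : Fin n ↪o Fin N) (X : Matrix (Fin n) (Fin k) ℝ) :
    Matrix (Fin N) (Fin k) ℝ :=
  (1 : Matrix (Fin N) (Fin N) ℝ).submatrix id J * X

/-- The `N`-qubit state `|Col(V_S)⟩`, held by the `n` qubits in the range of `J`
(the other qubits are `0`). -/
def colState {N n : ℕ} (J : Fin n ↪o Fin N) (V : Matrix (Fin n) (Fin n) ℝ) (S : Finset (Fin n)) :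
    (Fin N → Bool) → ℂ :=
  subspaceState (padRows J (columns V S))

/-! ### Singular value decomposition -/

/-- `A = W Σ Vᵀ` is a (full) singular value decomposition of the `m × n` matrix `A`: `W` and `V` are
orthogonal and `Σ` is the `m × n` diagonal matrix of the singular values `σ_j ≥ 0`
(with `σ_j = 0` for the columns `j` beyond the last row). -/
structure IsSVD {m n : ℕ} (A : Matrix (Fin m) (Fin n) ℝ) (W : Matrix (Fin m) (Fin m) ℝ)
    (σ : Fin n → ℝ) (V : Matrix (Fin n) (Fin n) ℝ) : Prop where
  left_mem : W ∈ Matrix.orthogonalGroup (Fin m) ℝ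
  right_mem : V ∈ Matrix.orthogonalGroup (Fin n) ℝ
  nonneg : ∀ j, 0 ≤ σ j
  eq_zero : ∀ j : Fin n, m ≤ (j : ℕ) → σ j = 0
  eq_mul : A = W * (Matrix.of fun (i : Fin m) (j : Fin n) =>
    if (i : ℕ) = (j : ℕ) then σ j else 0) * Vᵀ

/-! ### Quantum circuits and programs that call a Givens circuit -/

/-- The wires: `N` system qubits, `t` qubits of the output register, `a` work qubits. -/
abbrev Wire (N t a : ℕ) := Fin N ⊕ (Fin t ⊕ Fin a)

/-- An elementary gate: a unitary on at most three of the wires `ω`. -/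
structure ElementaryGate (ω : Type) [DecidableEq ω] where
  wires : Finset ω
  card_le : wires.card ≤ 3
  mat : Matrix (wires → Bool) (wires → Bool) ℂ
  mat_mem : mat * matᴴ = 1 ∧ matᴴ * mat = 1

/-- The operator of an elementary gate on all wires. -/
def ElementaryGate.op {ω : Type} [Fintype ω] [DecidableEq ω] (g : ElementaryGate ω) :
    Matrix (ω → Bool) (ω → Bool) ℂ :=
  Matrix.of fun x y =>
    if ∀ w, w ∉ g.wires → x w = y w then g.mat (fun w => x w) (fun w => y w) else 0

/-- A gate of a circuit: an elementary gate on any of the wires, or an `FBS` gate on the system. -/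
inductive Gate (N t a : ℕ) where
  | elementary (g : ElementaryGate (Wire N t a))
  | fbs (g : GivensGate N)

/-- The operator of a gate on all wires. -/
def Gate.op {N t a : ℕ} : Gate N t a → Matrix (Wire N t a → Bool) (Wire N t a → Bool) ℂ
  | .elementary g => g.op
  | .fbs g => Matrix.of fun x y =>
      if x ∘ Sum.inr = y ∘ Sum.inr then g.fbs (x ∘ Sum.inl) (y ∘ Sum.inl) else 0

/-- An instruction of a program: an elementary gate, or a call of the given Givens circuit or of
its inverse on the system qubits. -/
inductive Instruction (N t a : ℕ) where
  | elementary (g : ElementaryGate (Wire N t a))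
  | givens
  | givensInverse

/-- A program: a list of instructions, in the order of the operator product. -/
abbrev Program (N t a : ℕ) := List (Instruction N t a)

/-- The gates that carry out an instruction when the Givens circuit is `G`. -/
def Instruction.gates {N t a : ℕ} (G : GivensCircuit N) : Instruction N t a → List (Gate N t a)
  | .elementary g => [.elementary g]
  | .givens => G.map .fbs
  | .givensInverse => (GivensCircuit.inverse G).map .fbs

/-- The circuit that a program becomes when the Givens circuit is `G`. -/
def Program.circuit {N t a : ℕ} (P : Program N t a) (G : GivensCircuit N) : List (Gate N t a) :=
  P.flatMap (Instruction.gates G)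

/-- The cost of running a program with the Givens circuit `G`: the total number of gates. -/
def Program.cost {N t a : ℕ} (P : Program N t a) (G : GivensCircuit N) : ℕ :=
  (P.circuit G).length

/-- The unitary that a program implements with the Givens circuit `G`. -/
def Program.op {N t a : ℕ} (P : Program N t a) (G : GivensCircuit N) :
    Matrix (Wire N t a → Bool) (Wire N t a → Bool) ℂ :=
  ((P.circuit G).map Gate.op).prod

/-- The state `|ψ⟩|b⟩|0…0⟩`: system in `ψ`, output register in the basis state `b`, work qubits
in `0`. -/
def withRegister {N t a : ℕ} (ψ : (Fin N → Bool) → ℂ) (b : Fin t → Bool) :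
    (Wire N t a → Bool) → ℂ := fun x =>
  if (∀ i, x (Sum.inr (Sum.inl i)) = b i) ∧ (∀ i, x (Sum.inr (Sum.inr i)) = false) then
    ψ (fun i => x (Sum.inl i))
  else 0

/-- The angle `π · 0.b_{t-1} … b_0 ∈ [0, π)` that a `t`-bit register holds in binary. -/
def registerAngle {t : ℕ} (b : Fin t → Bool) : ℝ :=
  Real.pi * (∑ i : Fin t, if b i = true then (2 : ℝ) ^ (i : ℕ) else 0) / 2 ^ t

/-- The input `∑_{|S| = k} α_S |Col(V_S)⟩ |0…0⟩ |0…0⟩`. -/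
def inputState {N n t a : ℕ} (J : Fin n ↪o Fin N) (V : Matrix (Fin n) (Fin n) ℝ) (k : ℕ)
    (α : Finset (Fin n) → ℂ) : (Wire N t a → Bool) → ℂ :=
  ∑ S ∈ Finset.powersetCard k Finset.univ, α S • withRegister (colState J V S) fun _ => false

/-- The output `∑_{|S| = k} α_S |Col(V_S)⟩ |b_S⟩ |0…0⟩`. -/
def outputState {N n t a : ℕ} (J : Fin n ↪o Fin N) (V : Matrix (Fin n) (Fin n) ℝ) (k : ℕ)
    (α : Finset (Fin n) → ℂ) (b : Finset (Fin n) → Fin t → Bool) : (Wire N t a → Bool) → ℂ :=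
  ∑ S ∈ Finset.powersetCard k Finset.univ, α S • withRegister (colState J V S) (b S)

end SubspaceSVE

end

/-! A fermionic beam splitter is the second-quantized Givens rotation. A minor with both rotated
rows or with neither is unchanged, and a minor with exactly one of them is linear in that row; the
Laplace expansion produces just the sign `(-1)^f` of the gate. So a Givens circuit sends `|Col(X)⟩`
to `|Col(UX)⟩` (`fbs_mulVec_subspaceState`). Projecting on the strings that vanish outside `J`
deletes the other rows of `X`. With `Π_J` and `B = 𝒰ᴴ Π_I 𝒰`, the operator `Π_J B Π_J` therefore
acts on `|Col(V_S)⟩` through `AᵀA V = V Σ²` and multiplies it by `p²`, where `p = ∏_{i ∈ S} σ_i`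
(`proj_conj_proj_colState`). By Cauchy–Binet these states are orthonormal for fixed `|S|`.

Jordan's lemma for two projections now applies. The span of `v = |Col(V_S)⟩` and `B v` is invariant
under the walk `(2B - 1)(2Π_J - 1)`, and `v` is a sum of eigenvectors with eigenvalues `exp(± 2i
arccos p)` (`exists_walk_eigenvectors`). Phase estimation of the walk finds `± arccos p / π` modulo
1; complementing all bits when the top bit is set removes the sign. The outcome is rounded into the
output register and phase estimation is undone.

Undoing it works only if nearly all outcomes `y` give the same rounded value. A fixed rounding grid
fails for phases close to a grid boundary. Hence a random shift `r < 2^s` is added before the `s`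
low bits are dropped: two numbers at distance `d` are then separated with probability at most `d /
2^s` (`card_shift_ne_le`). The amplitude of an outcome at distance `d` is `O(1/d)`, so the expected
weight of wrongly rounded outcomes tends to `0` as `s` grows, uniformly in the precision
(`exists_weighted_outcomes_le`). Thus `s` depends on `δ` only. The invariant planes of different `S`
are orthogonal, so the bound passes to superpositions, and Markov's inequality over `r` finishes the
error analysis.

For the cost, about `2^s / ε` walk steps are made. Each calls the circuit and its inverse once and
uses `O(N)` gates for two reflections, which is where `N ≤ c T(𝒢)` enters. -/

noncomputable section

namespace SubspaceSVE

/-! ### Fermionic beam splitters act on subspace states as Givens rotations -/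

/-- The set of positions of the ones of a bit string. -/
def ones {N : ℕ} (x : Fin N → Bool) : Finset (Fin N) := Finset.univ.filter fun i => x i = true

@[simp] theorem mem_ones {N : ℕ} (x : Fin N → Bool) (i : Fin N) : i ∈ ones x ↔ x i = true := by
  simp [ones]

/-- The minor of `X` with rows in `T`, or `0` if `T` does not have as many elements as `X` has
columns. -/
def rowsDet {N k : ℕ} (X : Matrix (Fin N) (Fin k) ℝ) (T : Finset (Fin N)) : ℝ :=
  if h : T.card = k then (X.submatrix (T.orderEmbOfFin h) id).det else 0

theorem subspaceState_eq_rowsDet {N k : ℕ} (X : Matrix (Fin N) (Fin k) ℝ) (x : Fin N → Bool) :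
    subspaceState X x = (rowsDet X (ones x) : ℂ) := by
  unfold subspaceState rowsDet ones
  split_ifs <;> simp

theorem rowsDet_congr {N k : ℕ} {X Y : Matrix (Fin N) (Fin k) ℝ} {T : Finset (Fin N)}
    (h : ∀ i ∈ T, X i = Y i) : rowsDet X T = rowsDet Y T := by
  unfold rowsDet
  split_ifs with hT
  · congr 1
    ext i j
    simp only [Matrix.submatrix_apply, id]
    rw [h _ (Finset.orderEmbOfFin_mem T hT i)]
  · rfl

/-- Turns the row index in a Laplace expansion into a count of set elements, the form in which signs
can later be compared with the number of ones between two qubits. -/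
theorem orderEmbOfFin_val_eq_card {N k : ℕ} (T : Finset (Fin N)) (h : T.card = k) (a : Fin k) :
    (a : ℕ) = (T.filter (· < T.orderEmbOfFin h a)).card := by
  have : T.filter (· < T.orderEmbOfFin h a)
      = (Finset.univ.filter (· < a)).map (T.orderEmbOfFin h).toEmbedding := by
    ext i
    simp only [Finset.mem_filter, Finset.mem_map, Finset.mem_univ, true_and,
      RelEmbedding.coe_toEmbedding]
    constructor
    · rintro ⟨hi, hlt⟩
      have : i ∈ Set.range (T.orderEmbOfFin h) := by
        rw [Finset.range_orderEmbOfFin]; exact hi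
      obtain ⟨b, rfl⟩ := this
      exact ⟨b, by simpa using hlt, rfl⟩
    · rintro ⟨b, hb, rfl⟩
      exact ⟨Finset.orderEmbOfFin_mem T h b, by simpa using hb⟩
  rw [this, Finset.card_map, ← Fin.card_Iio a]
  congr 1
  ext i
  simp

/-- Laplace expansion along the row `q`. -/
theorem rowsDet_eq_sum {N k : ℕ} (X : Matrix (Fin N) (Fin (k + 1)) ℝ) {T : Finset (Fin N)}
    {q : Fin N} (hq : q ∈ T) :
    rowsDet X T = (-1) ^ (T.filter (· < q)).card *
      ∑ j : Fin (k + 1), (-1) ^ (j : ℕ) * X q j *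
        rowsDet (X.submatrix id j.succAbove) (T.erase q) := by
  have hc := Finset.card_erase_add_one hq
  by_cases h : T.card = k + 1
  · have h' : (T.erase q).card = k := by omega
    have : q ∈ Set.range (T.orderEmbOfFin h) := by rw [Finset.range_orderEmbOfFin]; exact hq
    obtain ⟨a, ha⟩ := this
    have hcomp : (fun i => T.orderEmbOfFin h (a.succAbove i)) = (T.erase q).orderEmbOfFin h' := by
      apply Finset.orderEmbOfFin_unique h'
      · intro i
        rw [Finset.mem_erase, ← ha]
        exact ⟨fun hh => Fin.succAbove_ne a i ((T.orderEmbOfFin h).injective hh),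
          Finset.orderEmbOfFin_mem T h _⟩
      · exact (T.orderEmbOfFin h).strictMono.comp (Fin.strictMono_succAbove a)
    have hcard := orderEmbOfFin_val_eq_card T h a
    rw [ha] at hcard
    simp only [rowsDet, h, h', dif_pos]
    rw [Matrix.det_succ_row _ a, ← hcard, Finset.mul_sum]
    refine Finset.sum_congr rfl fun j _ => ?_
    rw [pow_add, Matrix.submatrix_submatrix, Matrix.submatrix_submatrix]
    have e1 : (T.orderEmbOfFin h : Fin (k + 1) → Fin N) ∘ a.succAbove
        = id ∘ (T.erase q).orderEmbOfFin h' := hcomp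
    rw [e1]
    simp only [Matrix.submatrix_apply, id, ha, Function.id_comp, Function.comp_id]
    ring
  · have h' : (T.erase q).card ≠ k := by omega
    simp [rowsDet, h, h']

theorem rotation_mul_lo {N k : ℕ} (g : GivensGate N) (X : Matrix (Fin N) (Fin k) ℝ) :
    (g.rotation * X) g.lo = Real.cos g.angle • X g.lo - Real.sin g.angle • X g.hi := by
  have hne := g.lo_lt_hi.ne
  ext j
  rw [Matrix.mul_apply, ← Finset.sum_subset (Finset.subset_univ {g.lo, g.hi})]
  · rw [Finset.sum_pair hne]
    simp [GivensGate.rotation, hne, sub_eq_add_neg]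
  · intro i _ hi
    simp only [Finset.mem_insert, Finset.mem_singleton, not_or] at hi
    simp [GivensGate.rotation, hi.1, hi.2, Ne.symm hi.1]

theorem rotation_mul_hi {N k : ℕ} (g : GivensGate N) (X : Matrix (Fin N) (Fin k) ℝ) :
    (g.rotation * X) g.hi = Real.sin g.angle • X g.lo + Real.cos g.angle • X g.hi := by
  have hne := g.lo_lt_hi.ne
  ext j
  rw [Matrix.mul_apply, ← Finset.sum_subset (Finset.subset_univ {g.lo, g.hi})]
  · rw [Finset.sum_pair hne]
    simp [GivensGate.rotation, hne.symm]
  · intro i _ hi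
    simp only [Finset.mem_insert, Finset.mem_singleton, not_or] at hi
    simp [GivensGate.rotation, hi.1, hi.2, Ne.symm hi.2]

theorem rotation_mul_of_ne {N k : ℕ} (g : GivensGate N) (X : Matrix (Fin N) (Fin k) ℝ) {i : Fin N}
    (hl : i ≠ g.lo) (hh : i ≠ g.hi) : (g.rotation * X) i = X i := by
  ext j
  rw [Matrix.mul_apply, Finset.sum_eq_single i]
  · simp [GivensGate.rotation, hl, hh]
  · intro b _ hb
    simp [GivensGate.rotation, hl, hh, hb.symm]
  · simp

theorem fbs_mulVec {N : ℕ} (g : GivensGate N) (ψ : (Fin N → Bool) → ℂ) (x : Fin N → Bool) :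
    (g.fbs *ᵥ ψ) x = if x g.lo = x g.hi then ψ x else
      (Real.cos g.angle : ℂ) * ψ x + (if x g.lo = true then -1 else 1) *
        (-1) ^ onesBetween g.lo g.hi x * (Real.sin g.angle : ℂ) * ψ (x ∘ Equiv.swap g.lo g.hi) := by
  have hswap : ∀ y : Fin N → Bool, x = y ∘ Equiv.swap g.lo g.hi ↔ y = x ∘ Equiv.swap g.lo g.hi := by
    intro y
    constructor <;> (rintro rfl; ext i; simp)
  rw [Matrix.mulVec, dotProduct]
  by_cases h : x g.lo = x g.hi
  · rw [if_pos h, Finset.sum_eq_single x]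
    · simp [GivensGate.fbs, h]
    · intro y _ hy
      have : ¬ x = y ∘ Equiv.swap g.lo g.hi := by
        rw [hswap]
        rintro rfl
        apply hy
        ext i
        simp only [Function.comp]
        by_cases h1 : i = g.lo
        · simp [h1, h]
        by_cases h2 : i = g.hi
        · simp [h2, h]
        rw [Equiv.swap_apply_of_ne_of_ne h1 h2]
      simp [GivensGate.fbs, hy.symm, this]
    · simp
  · have hne : x ≠ x ∘ Equiv.swap g.lo g.hi := fun e => h (by
      have := congrFun e g.lo
      simpa using this)
    rw [if_neg h, ← Finset.sum_subset (Finset.subset_univ {x, x ∘ Equiv.swap g.lo g.hi})]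
    · rw [Finset.sum_pair hne]
      have hb : onesBetween g.lo g.hi (x ∘ Equiv.swap g.lo g.hi) = onesBetween g.lo g.hi x := by
        unfold onesBetween
        congr 1
        apply Finset.filter_congr
        intro i _
        constructor
        · rintro ⟨a, b, c⟩
          refine ⟨a, b, ?_⟩
          rwa [Function.comp, Equiv.swap_apply_of_ne_of_ne a.ne' b.ne] at c
        · rintro ⟨a, b, c⟩
          refine ⟨a, b, ?_⟩
          rwa [Function.comp, Equiv.swap_apply_of_ne_of_ne a.ne' b.ne]
      have e1 : g.fbs x x = (Real.cos g.angle : ℂ) := by simp [GivensGate.fbs, h]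
      have e2 : g.fbs x (x ∘ Equiv.swap g.lo g.hi) = (if x g.lo = true then -1 else 1) *
          (-1) ^ onesBetween g.lo g.hi x * (Real.sin g.angle : ℂ) := by
        simp only [GivensGate.fbs, Matrix.of_apply, if_neg hne]
        rw [if_pos ((hswap _).2 rfl), hb]
        congr 2
        simp only [Function.comp, Equiv.swap_apply_left]
        revert h
        cases x g.lo <;> cases x g.hi <;> simp
      rw [e1, e2]
    · intro y _ hy
      simp only [Finset.mem_insert, Finset.mem_singleton, not_or] at hy
      have : ¬ x = y ∘ Equiv.swap g.lo g.hi := by rw [hswap]; exact hy.2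
      simp [GivensGate.fbs, Ne.symm hy.1, this]

/-- The determinant is bilinear and alternating in the rows `a` and `b`. Of the four terms, those
with a repeated row vanish, and the other two give `cos² + sin²`, since exchanging the rows changes
the sign. -/
theorem det_rotate_rows {k : ℕ} (M M' : Matrix (Fin k) (Fin k) ℝ) {a b : Fin k} (hab : a ≠ b)
    (θ : ℝ) (ha : M' a = Real.cos θ • M a - Real.sin θ • M b)
    (hb : M' b = Real.sin θ • M a + Real.cos θ • M b)
    (hc : ∀ i, i ≠ a → i ≠ b → M' i = M i) : M'.det = M.det := by
  have hM : M' = (M.updateRow a (Real.cos θ • M a + (-Real.sin θ) • M b)).updateRow b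
      (Real.sin θ • M a + Real.cos θ • M b) := by
    ext i j
    by_cases h1 : i = b
    · subst h1; simp [hb]
    by_cases h2 : i = a
    · subst h2; simp [Matrix.updateRow_apply, hab, ha, sub_eq_add_neg]
    · simp [Matrix.updateRow_apply, h1, h2, hc i h2 h1]
  have comm : ∀ u v : Fin k → ℝ, (M.updateRow a u).updateRow b v
      = (M.updateRow b v).updateRow a u := fun u v => by
    ext i j
    simp only [Matrix.updateRow_apply]
    split_ifs with h1 h2 <;> first | rfl | exact absurd (h2.symm.trans h1) hab
  have e : ∀ u : Fin k → ℝ, ((M.updateRow a u).updateRow b u).det = 0 := fun u =>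
    Matrix.det_zero_of_row_eq hab (by ext j; simp [Matrix.updateRow_apply, hab])
  have e1 : ((M.updateRow a (M a)).updateRow b (M b)).det = M.det := by
    simp [Matrix.updateRow_eq_self]
  -- Antisymmetry from polarization: the determinant with `M a + M b` in both rows is zero.
  have e2 : ((M.updateRow a (M b)).updateRow b (M a)).det = -M.det := by
    have := e (M a + M b)
    rw [Matrix.det_updateRow_add, comm, comm, Matrix.det_updateRow_add,
      Matrix.det_updateRow_add, ← comm, ← comm, ← comm, ← comm, e, e, e1] at this
    linarith
  rw [hM, Matrix.det_updateRow_add, Matrix.det_updateRow_smul, Matrix.det_updateRow_smul,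
    comm, comm, Matrix.det_updateRow_add, Matrix.det_updateRow_add, Matrix.det_updateRow_smul,
    Matrix.det_updateRow_smul, Matrix.det_updateRow_smul, Matrix.det_updateRow_smul,
    ← comm, ← comm, ← comm, ← comm, e, e, e1, e2]
  linear_combination M.det * Real.sin_sq_add_cos_sq θ

theorem rowsDet_rotation_both {N k : ℕ} (g : GivensGate N) (X : Matrix (Fin N) (Fin k) ℝ)
    {T : Finset (Fin N)} (hl : g.lo ∈ T) (hh : g.hi ∈ T) :
    rowsDet (g.rotation * X) T = rowsDet X T := by
  unfold rowsDet
  split_ifs with h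
  · have h1 : g.lo ∈ Set.range (T.orderEmbOfFin h) := by rw [Finset.range_orderEmbOfFin]; exact hl
    have h2 : g.hi ∈ Set.range (T.orderEmbOfFin h) := by rw [Finset.range_orderEmbOfFin]; exact hh
    obtain ⟨a, ha⟩ := h1
    obtain ⟨b, hb⟩ := h2
    have hne := g.lo_lt_hi.ne
    apply det_rotate_rows _ _ (a := a) (b := b) (fun e => hne (by rw [← ha, ← hb, e])) g.angle
    · have := rotation_mul_lo g X
      ext j
      simpa [ha, hb] using congrFun this j
    · have := rotation_mul_hi g X
      ext j
      simpa [ha, hb] using congrFun this j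
    · intro i hia hib
      ext j
      simp only [Matrix.submatrix_apply, id]
      rw [rotation_mul_of_ne]
      · rw [← ha]; exact fun e => hia ((T.orderEmbOfFin h).injective e)
      · rw [← hb]; exact fun e => hib ((T.orderEmbOfFin h).injective e)
  · rfl

/-- The minor with rows in `T`, when exactly one of two indices `p`, `q` is in `T`, as a linear
function of that row. -/
theorem rowsDet_rotation_one {N k : ℕ} (X Y : Matrix (Fin N) (Fin (k + 1)) ℝ)
    {T : Finset (Fin N)} {p q : Fin N} (hp : p ∈ T) (hq : q ∉ T) (c s : ℝ)
    (h1 : Y p = c • X p + s • X q) (h2 : ∀ i ∈ T, i ≠ p → Y i = X i) :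
    rowsDet Y T = c * rowsDet X T +
      s * (-1) ^ ((T.filter (· < p)).card + ((T.erase p).filter (· < q)).card) *
        rowsDet X (insert q (T.erase p)) := by
  have hq' : q ∉ T.erase p := fun h => hq (Finset.mem_of_mem_erase h)
  have e : (insert q (T.erase p)).filter (· < q) = (T.erase p).filter (· < q) := by
    rw [Finset.filter_insert]; simp
  rw [rowsDet_eq_sum Y hp, rowsDet_eq_sum X hp,
    rowsDet_eq_sum X (Finset.mem_insert_self q (T.erase p)), Finset.erase_insert hq', e]
  have hh : ∀ j : Fin (k + 1), rowsDet (Y.submatrix id j.succAbove) (T.erase p)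
      = rowsDet (X.submatrix id j.succAbove) (T.erase p) := by
    intro j
    apply rowsDet_congr
    intro i hi
    ext l
    simp [h2 i (Finset.mem_of_mem_erase hi) (Finset.ne_of_mem_erase hi)]
  have sq : ∀ n : ℕ, ((-1 : ℝ) ^ n) * (-1) ^ n = 1 := fun n => by
    rw [← mul_pow]; simp
  simp only [hh, h1, Pi.add_apply, Pi.smul_apply, smul_eq_mul]
  rw [pow_add]
  simp only [Finset.mul_sum]
  rw [← Finset.sum_add_distrib]
  refine Finset.sum_congr rfl fun j _ => ?_
  linear_combination (-(s * (-1) ^ (T.filter (· < p)).card * (-1) ^ (j : ℕ) * X q j *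
    rowsDet (X.submatrix id j.succAbove) (T.erase p))) * sq ((T.erase p).filter (· < q)).card

theorem ones_comp_swap {N : ℕ} (x : Fin N → Bool) {p q : Fin N}
    (hp : x p = true) (hq : x q = false) :
    ones (x ∘ Equiv.swap p q) = insert q ((ones x).erase p) := by
  have hpq : p ≠ q := fun e => by simp [e, hq] at hp
  ext i
  simp only [mem_ones, Function.comp, Finset.mem_insert, Finset.mem_erase]
  by_cases h1 : i = p
  · subst h1; simp [hq, hpq]
  by_cases h2 : i = q
  · subst h2; simp [hp]
  · rw [Equiv.swap_apply_of_ne_of_ne h1 h2]; simp [h1, h2]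

/-- `rowsDet_rotation_one` carries two Laplace signs, one for removing a row and one for inserting
the other. The two counts differ by the number of ones strictly between, so the signs multiply to
`(-1)^f`. -/
theorem card_filter_lt_lo {N : ℕ} (x : Fin N → Bool) {p q : Fin N} (hpq : p < q) :
    (((ones x).erase p).filter (· < q)).card
      = ((ones x).filter (· < p)).card + onesBetween p q x := by
  rw [onesBetween, ← Finset.card_union_of_disjoint]
  · congr 1
    ext i
    simp only [Finset.mem_filter, Finset.mem_erase, mem_ones, Finset.mem_union, Finset.mem_univ,
      true_and]
    rcases lt_trichotomy i p with h | h | h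
    · simp [h, h.ne, h.not_gt, h.trans hpq]
    · simp [h]
    · simp [h, h.ne', h.not_gt]; tauto
  · rw [Finset.disjoint_left]
    intro i hi hi'
    simp only [Finset.mem_filter, Finset.mem_univ, true_and] at hi hi'
    exact absurd hi.2 hi'.1.not_gt

theorem card_filter_lt_hi {N : ℕ} (x : Fin N → Bool) {p q : Fin N} (hpq : p < q)
    (hp : x p = false) :
    ((ones x).filter (· < q)).card
      = (((ones x).erase q).filter (· < p)).card + onesBetween p q x := by
  have := card_filter_lt_lo x hpq
  have e1 : (ones x).erase p = ones x := Finset.erase_eq_of_notMem (by simp [hp])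
  have e2 : ((ones x).erase q).filter (· < p) = (ones x).filter (· < p) := by
    ext i
    simp only [Finset.mem_filter, Finset.mem_erase]
    constructor
    · tauto
    · rintro ⟨a, b⟩; exact ⟨⟨(b.trans hpq).ne, a⟩, b⟩
  rw [e1] at this
  rw [e2, this]

/-- If the bits at the two positions agree, the minor contains both rotated rows (determinant-one
row operation) or neither. If they differ, it contains one rotated row, and linearity in that row
gives the minors at `x` and at the swapped string. -/
theorem fbs_mulVec_subspaceState {N k : ℕ} (g : GivensGate N) (X : Matrix (Fin N) (Fin k) ℝ) :
    g.fbs *ᵥ subspaceState X = subspaceState (g.rotation * X) := by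
  have hlt := g.lo_lt_hi
  have par : ∀ a f : ℕ, (-1 : ℝ) ^ (a + (a + f)) = (-1) ^ f := fun a f => by
    rw [← add_assoc, ← two_mul, pow_add, pow_mul]; simp
  have par' : ∀ a f : ℕ, (-1 : ℝ) ^ (a + f + a) = (-1) ^ f := fun a f => by
    rw [add_comm, par]
  ext x
  rw [fbs_mulVec]
  simp only [subspaceState_eq_rowsDet]
  by_cases h : x g.lo = x g.hi
  · rw [if_pos h]
    congr 1
    by_cases hl : x g.lo = true
    · exact (rowsDet_rotation_both g X (by simpa using hl) (by simpa [h] using hl)).symm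
    · apply rowsDet_congr
      intro i hi
      rw [mem_ones] at hi
      rw [rotation_mul_of_ne]
      · rintro rfl; exact hl hi
      · rintro rfl; exact hl (h ▸ hi)
  · rw [if_neg h]
    cases k with
    -- The Laplace expansion needs at least one column. Without columns only the zero string has an
    -- amplitude, and both strings here contain a one.
    | zero =>
      have : ∀ (Y : Matrix (Fin N) (Fin 0) ℝ) (z : Fin N → Bool),
          (z g.lo = true ∨ z g.hi = true) → rowsDet Y (ones z) = 0 := by
        intro Y z hz
        rw [rowsDet, dif_neg]
        intro hc
        rw [Finset.card_eq_zero] at hc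
        rcases hz with hz | hz <;> · rw [← mem_ones, hc] at hz; simp at hz
      have hx : x g.lo = true ∨ x g.hi = true := by
        revert h; cases x g.lo <;> cases x g.hi <;> simp
      rw [this _ _ hx, this _ _ hx, this]
      · simp
      · simpa [or_comm] using hx
    | succ k =>
      cases hl : x g.lo with
      | true =>
        have hh : x g.hi = false := by
          revert h; rw [hl]; cases x g.hi <;> simp
        rw [ones_comp_swap x hl hh, rowsDet_rotation_one X (g.rotation * X) (p := g.lo) (q := g.hi)
          (by simpa using hl) (by simpa using hh) (Real.cos g.angle) (-Real.sin g.angle),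
          card_filter_lt_lo x hlt, par]
        · rw [if_pos rfl]; push_cast; ring
        · rw [rotation_mul_lo, neg_smul, sub_eq_add_neg]
        · intro i hi hne
          rw [rotation_mul_of_ne g X hne]
          rintro rfl; simp [hh] at hi
      | false =>
        have hh : x g.hi = true := by
          revert h; rw [hl]; cases x g.hi <;> simp
        rw [Equiv.swap_comm, ones_comp_swap x hh hl,
          rowsDet_rotation_one X (g.rotation * X) (p := g.hi) (q := g.lo)
          (by simpa using hh) (by simpa using hl) (Real.cos g.angle) (Real.sin g.angle),
          card_filter_lt_hi x hlt hl, par']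
        · rw [if_neg (by simp)]; push_cast; ring
        · exact (rotation_mul_hi g X).trans (add_comm _ _)
        · intro i hi hne
          rw [rotation_mul_of_ne g X _ hne]
          rintro rfl; simp [hl] at hi

/-! ### Further operations on subspace states -/

theorem subspaceState_mul_diagonal {N k : ℕ} (X : Matrix (Fin N) (Fin k) ℝ) (d : Fin k → ℝ) :
    subspaceState (X * Matrix.diagonal d) = ((∏ i, d i : ℝ) : ℂ) • subspaceState X := by
  ext x
  simp only [subspaceState_eq_rowsDet, Pi.smul_apply, smul_eq_mul, ← Complex.ofReal_mul]
  congr 1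
  unfold rowsDet
  split_ifs with h
  · have : (X * Matrix.diagonal d).submatrix ((ones x).orderEmbOfFin h) id
        = X.submatrix ((ones x).orderEmbOfFin h) id * Matrix.diagonal d := by
      ext i j; simp [Matrix.mul_diagonal]
    rw [this, Matrix.det_mul, Matrix.det_diagonal, mul_comm]
  · simp

/-- The projection on the strings that vanish outside the range of `J` acts on subspace states by
deleting the other rows. -/
theorem subspaceState_project {N n k : ℕ} (J : Fin n ↪o Fin N) (X : Matrix (Fin N) (Fin k) ℝ)
    (Y : Matrix (Fin N) (Fin k) ℝ) (hY : ∀ i, (∃ j, J j = i) → Y i = X i)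
    (hY' : ∀ i, (¬ ∃ j, J j = i) → Y i = 0) (x : Fin N → Bool) :
    subspaceState Y x = if ∀ i, (¬ ∃ j, J j = i) → x i = false then subspaceState X x else 0 := by
  simp only [subspaceState_eq_rowsDet]
  split_ifs with h
  · congr 1
    apply rowsDet_congr
    intro i hi
    apply hY
    by_contra hc
    simp [h i hc] at hi
  · push Not at h
    obtain ⟨i, hi, hx⟩ := h
    unfold rowsDet
    split_ifs with hc
    · have : i ∈ Set.range ((ones x).orderEmbOfFin hc) := by
        rw [Finset.range_orderEmbOfFin]; simpa using hx
      obtain ⟨a, ha⟩ := this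
      rw [Matrix.det_eq_zero_of_row_eq_zero a]
      · simp
      · intro j
        simp [ha, hY' i (not_exists.2 hi)]
    · simp

end SubspaceSVE

end

noncomputable section

namespace SubspaceSVE

/-! ### The Cauchy–Binet formula and the inner product of subspace states -/

/-- Row `i` of `Xᵀ * Y` is a combination of the rows of `Y` with coefficients `X l i`; expand the
determinant multilinearly in its rows. -/
theorem det_transpose_mul_eq_sum {ι : Type*} [Fintype ι] [DecidableEq ι] {k : ℕ}
    (X Y : Matrix ι (Fin k) ℝ) :
    (Xᵀ * Y).det = ∑ f : Fin k → ι, (∏ i, X (f i) i) * (Y.submatrix f id).det := by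
  have h : (Xᵀ * Y) = fun i => ∑ l, X l i • Y l := by
    ext i j
    simp [Matrix.mul_apply, Finset.sum_apply]
  have e : (Xᵀ * Y).det = (Matrix.detRowAlternating (R := ℝ) (n := Fin k)).toMultilinearMap
      (fun i => ∑ l, X l i • Y l) := by rw [h]; rfl
  rw [e, MultilinearMap.map_sum]
  refine Finset.sum_congr rfl fun f _ => ?_
  rw [MultilinearMap.map_smul_univ]
  rfl

theorem det_submatrix_eq_zero {ι : Type*} {k : ℕ} (Y : Matrix ι (Fin k) ℝ) {f : Fin k → ι}
    (hf : ¬ Function.Injective f) : (Y.submatrix f id).det = 0 := by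
  rw [Function.not_injective_iff] at hf
  obtain ⟨a, b, hab, hne⟩ := hf
  exact Matrix.det_zero_of_row_eq hne (by ext j; simp [hab])

/-- Cauchy–Binet: the maps `f` of the expansion are grouped by their image, coded as a bit string.
-/
theorem sum_rowsDet_mul {N k : ℕ} (X Y : Matrix (Fin N) (Fin k) ℝ) :
    ∑ x : Fin N → Bool, rowsDet X (ones x) * rowsDet Y (ones x) = (Xᵀ * Y).det := by
  classical
  rw [det_transpose_mul_eq_sum, ← Finset.sum_fiberwise Finset.univ
    (fun (f : Fin k → Fin N) (i : Fin N) => decide (i ∈ Finset.univ.image f))]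
  refine Finset.sum_congr rfl fun x _ => ?_
  have hfib : ∀ f : Fin k → Fin N, ((fun i => decide (i ∈ Finset.univ.image f)) = x)
      ↔ Finset.univ.image f = ones x := by
    intro f
    constructor
    · rintro rfl; ext i; simp
    · intro h; ext i
      rw [h]; simp
  simp only [hfib]
  unfold rowsDet
  by_cases h : (ones x).card = k
  · rw [dif_pos h, dif_pos h]
    -- The fiber over `T = ones x` is enlarged to all maps with values in `T`. The added maps are
    -- not injective, as `T` has `k` elements, and contribute zero; the enlarged sum is the
    -- expansion of `det (X_Tᵀ Y_T)`.
    have hsub : (Finset.univ.filter fun f : Fin k → Fin N => Finset.univ.image f = ones x) ⊆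
        Finset.univ.filter fun f : Fin k → Fin N => ∀ i, f i ∈ ones x := by
      intro f hf
      simp only [Finset.mem_filter, Finset.mem_univ, true_and] at hf ⊢
      intro i
      rw [← hf]
      exact Finset.mem_image_of_mem _ (Finset.mem_univ i)
    rw [Finset.sum_subset hsub]
    · rw [← Matrix.det_transpose, ← Matrix.det_mul, det_transpose_mul_eq_sum]
      refine Finset.sum_of_injOn (fun f i => (ones x).orderEmbOfFin h (f i)) ?_ ?_ ?_ ?_
      · intro f _ f' _ hff
        funext i
        have := congrFun hff i
        simpa using this
      · intro f _
        simp only [Finset.coe_filter, Finset.mem_univ, true_and, Set.mem_ofPred_eq]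
        exact fun i => Finset.orderEmbOfFin_mem _ h _
      · intro f hf hf'
        exfalso
        apply hf'
        simp only [Finset.mem_filter, Finset.mem_univ, true_and] at hf
        have : ∀ i, ∃ a, (ones x).orderEmbOfFin h a = f i := by
          intro i
          have : f i ∈ Set.range ((ones x).orderEmbOfFin h) := by
            rw [Finset.range_orderEmbOfFin]; exact hf i
          exact this
        choose a ha using this
        exact ⟨a, by simp, funext ha⟩
      · intro f _
        rw [Matrix.submatrix_submatrix]
        rfl
    · intro f hf hf'
      simp only [Finset.mem_filter, Finset.mem_univ, true_and] at hf hf'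
      rw [det_submatrix_eq_zero, mul_zero]
      intro hinj
      apply hf'
      apply Finset.eq_of_subset_of_card_le
      · intro i hi
        obtain ⟨j, _, rfl⟩ := Finset.mem_image.1 hi
        exact hf j
      · rw [Finset.card_image_of_injective _ hinj, h]; simp
  · rw [dif_neg h, zero_mul]
    symm
    apply Finset.sum_eq_zero
    intro f hf
    simp only [Finset.mem_filter, Finset.mem_univ, true_and] at hf
    rw [det_submatrix_eq_zero, mul_zero]
    intro hinj
    apply h
    rw [← hf, Finset.card_image_of_injective _ hinj]
    simp

theorem star_subspaceState {N k : ℕ} (X : Matrix (Fin N) (Fin k) ℝ) :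
    star (subspaceState X) = subspaceState X := by
  ext x
  simp [subspaceState_eq_rowsDet]

theorem star_subspaceState_dotProduct {N k : ℕ} (X Y : Matrix (Fin N) (Fin k) ℝ) :
    star (subspaceState X) ⬝ᵥ subspaceState Y = ((Xᵀ * Y).det : ℂ) := by
  rw [star_subspaceState, ← sum_rowsDet_mul, dotProduct]
  push_cast
  simp [subspaceState_eq_rowsDet]

/-! ### The states `|Col(V_S)⟩` -/

theorem transpose_embedding_mul_embedding {N n : ℕ} (J : Fin n ↪o Fin N) :
    ((1 : Matrix (Fin N) (Fin N) ℝ).submatrix id J)ᵀ * (1 : Matrix (Fin N) (Fin N) ℝ).submatrix id J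
      = 1 := by
  ext i j
  simp [Matrix.mul_apply, Matrix.one_apply]

theorem padRows_transpose_mul {N n k l : ℕ} (J : Fin n ↪o Fin N) (X : Matrix (Fin n) (Fin k) ℝ)
    (Y : Matrix (Fin n) (Fin l) ℝ) : (padRows J X)ᵀ * padRows J Y = Xᵀ * Y := by
  rw [padRows, padRows, Matrix.transpose_mul, Matrix.mul_assoc, ← Matrix.mul_assoc _ᵀ _ Y,
    transpose_embedding_mul_embedding, Matrix.one_mul]

/-- The number of columns is decoupled from `S.card`, so that the matrices of two sets of equal size
have the same type. -/
theorem colState_def {N n k : ℕ} (J : Fin n ↪o Fin N) (V : Matrix (Fin n) (Fin n) ℝ)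
    {S : Finset (Fin n)} (h : S.card = k) :
    colState J V S = subspaceState (padRows J (V.submatrix id (S.orderEmbOfFin h))) := by
  subst h; rfl

/-- The overlap is the minor of `VᵀV = 1` with rows `S` and columns `S'`. If the sets differ and
have equal size, an element of `S` outside `S'` gives a zero row. -/
theorem colState_orthonormal {N n : ℕ} (J : Fin n ↪o Fin N) {V : Matrix (Fin n) (Fin n) ℝ}
    (hV : V ∈ Matrix.orthogonalGroup (Fin n) ℝ) {S S' : Finset (Fin n)} (h : S.card = S'.card) :
    star (colState J V S) ⬝ᵥ colState J V S' = if S = S' then 1 else 0 := by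
  rw [colState_def J V h, colState_def J V rfl, star_subspaceState_dotProduct,
    padRows_transpose_mul]
  have hVV : Vᵀ * V = 1 := (Matrix.mem_orthogonalGroup_iff' (Fin n) ℝ).1 hV
  have e : (V.submatrix id (S.orderEmbOfFin h))ᵀ * V.submatrix id (S'.orderEmbOfFin rfl)
      = (1 : Matrix (Fin n) (Fin n) ℝ).submatrix (S.orderEmbOfFin h) (S'.orderEmbOfFin rfl) := by
    rw [← hVV]
    rfl
  rw [e]
  split_ifs with hS
  · subst hS
    rw [Matrix.submatrix_one _ (S.orderEmbOfFin h).injective, Matrix.det_one, Complex.ofReal_one]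
  · have : ∃ a, S.orderEmbOfFin h a ∉ S' := by
      by_contra hc
      push Not at hc
      apply hS
      apply Finset.eq_of_subset_of_card_le
      · intro i hi
        have : i ∈ Set.range (S.orderEmbOfFin h) := by rw [Finset.range_orderEmbOfFin]; exact hi
        obtain ⟨a, rfl⟩ := this
        exact hc a
      · exact h.ge
    obtain ⟨a, ha⟩ := this
    rw [Matrix.det_eq_zero_of_row_eq_zero a, Complex.ofReal_zero]
    intro b
    rw [Matrix.submatrix_apply, Matrix.one_apply_ne]
    intro e
    exact ha (e ▸ Finset.orderEmbOfFin_mem S' rfl b)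

/-! ### Givens circuits -/

/-- The operator on the system qubits of a Givens circuit. -/
def GivensCircuit.fbsOp {N : ℕ} (G : GivensCircuit N) :
    Matrix (Fin N → Bool) (Fin N → Bool) ℂ :=
  (G.map GivensGate.fbs).prod

theorem fbsOp_mulVec_subspaceState {N k : ℕ} (G : GivensCircuit N)
    (X : Matrix (Fin N) (Fin k) ℝ) :
    GivensCircuit.fbsOp G *ᵥ subspaceState X
      = subspaceState (GivensCircuit.orthogonal G * X) := by
  induction G with
  | nil => simp [GivensCircuit.fbsOp, GivensCircuit.orthogonal]
  | cons g G ih =>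
    have e1 : GivensCircuit.fbsOp (g :: G) = g.fbs * GivensCircuit.fbsOp G := by
      simp [GivensCircuit.fbsOp]
    have e2 : GivensCircuit.orthogonal (g :: G)
        = g.rotation * GivensCircuit.orthogonal G := by simp [GivensCircuit.orthogonal]
    rw [e1, e2, ← Matrix.mulVec_mulVec, ih, fbs_mulVec_subspaceState, Matrix.mul_assoc]

/-- The gate with the opposite angle. -/
def GivensGate.neg {N : ℕ} (g : GivensGate N) : GivensGate N := { g with angle := -g.angle }

theorem rotation_neg {N : ℕ} (g : GivensGate N) : g.neg.rotation = g.rotationᵀ := by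
  have hne := g.lo_lt_hi.ne
  ext i j
  simp only [GivensGate.rotation, GivensGate.neg, Matrix.of_apply, Matrix.transpose_apply,
    Real.cos_neg, Real.sin_neg, neg_neg]
  by_cases hij : i = j
  · subst hij; simp
  · rw [if_neg hij, if_neg (Ne.symm hij)]
    by_cases h1 : i = g.hi ∧ j = g.lo
    · simp [h1.1, h1.2, hne, hne.symm]
    by_cases h2 : i = g.lo ∧ j = g.hi
    · simp [h2.1, h2.2, hne]
    · rw [if_neg h1, if_neg h2, if_neg (by tauto), if_neg (by tauto)]

theorem fbs_neg_mul {N : ℕ} (g : GivensGate N) : g.neg.fbs * g.fbs = 1 := by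
  refine Matrix.mulVec_injective (funext fun ψ => ?_)
  ext x
  rw [← Matrix.mulVec_mulVec, Matrix.one_mulVec, fbs_mulVec]
  change (if x g.lo = x g.hi then _ else (Real.cos (-g.angle) : ℂ) * _ +
    (if x g.lo = true then -1 else 1) * (-1) ^ onesBetween g.lo g.hi x *
      (Real.sin (-g.angle) : ℂ) * (g.fbs *ᵥ ψ) (x ∘ Equiv.swap g.lo g.hi)) = _
  by_cases h : x g.lo = x g.hi
  · rw [if_pos h, fbs_mulVec, if_pos h]
  · have hb : onesBetween g.lo g.hi (x ∘ Equiv.swap g.lo g.hi) = onesBetween g.lo g.hi x := by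
      unfold onesBetween
      congr 1
      apply Finset.filter_congr
      intro i _
      refine and_congr_right fun a => and_congr_right fun b => ?_
      rw [Function.comp, Equiv.swap_apply_of_ne_of_ne a.ne' b.ne]
    have hs : (x ∘ Equiv.swap g.lo g.hi) ∘ Equiv.swap g.lo g.hi = x := by ext i; simp
    have h' : ¬ (x ∘ Equiv.swap g.lo g.hi) g.lo = (x ∘ Equiv.swap g.lo g.hi) g.hi := by
      simpa [eq_comm] using h
    have hh : (x ∘ Equiv.swap g.lo g.hi) g.lo = !(x g.lo) := by
      revert h; simp only [Function.comp, Equiv.swap_apply_left]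
      cases x g.lo <;> cases x g.hi <;> simp
    have sq : ∀ n : ℕ, ((-1 : ℂ) ^ n) * (-1) ^ n = 1 := fun n => by
      rw [← mul_pow]; simp
    have cs : (Real.sin g.angle : ℂ) ^ 2 + (Real.cos g.angle : ℂ) ^ 2 = 1 := by
      exact_mod_cast Real.sin_sq_add_cos_sq g.angle
    rw [if_neg h, fbs_mulVec, fbs_mulVec, if_neg h, if_neg h', hb, hs, hh, Real.cos_neg,
      Real.sin_neg]
    push_cast at cs ⊢
    cases x g.lo <;> simp only [Bool.not_true, Bool.not_false, if_true, Bool.false_eq_true,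
      if_false] <;> linear_combination ψ x * cs +
        Complex.sin g.angle ^ 2 * ψ x * sq (onesBetween g.lo g.hi x)

theorem fbs_conjTranspose {N : ℕ} (g : GivensGate N) : g.fbsᴴ = g.neg.fbs := by
  ext x y
  simp only [Matrix.conjTranspose_apply, GivensGate.fbs, GivensGate.neg, Matrix.of_apply,
    Real.cos_neg, Real.sin_neg]
  by_cases hxy : x = y
  · subst hxy
    rw [if_pos rfl, if_pos rfl]
    split_ifs
    · simp
    · rw [Complex.star_def, Complex.conj_ofReal]
  · rw [if_neg (Ne.symm hxy), if_neg hxy]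
    have hsw : (y = x ∘ Equiv.swap g.lo g.hi) ↔ (x = y ∘ Equiv.swap g.lo g.hi) := by
      constructor <;> (rintro rfl; ext i; simp)
    by_cases h : x = y ∘ Equiv.swap g.lo g.hi
    · rw [if_pos (hsw.2 h), if_pos h]
      have hb : onesBetween g.lo g.hi x = onesBetween g.lo g.hi y := by
        unfold onesBetween
        congr 1
        apply Finset.filter_congr
        intro i _
        refine and_congr_right fun a => and_congr_right fun b => ?_
        rw [h, Function.comp, Equiv.swap_apply_of_ne_of_ne a.ne' b.ne]
      have hh : x g.lo = !(y g.lo) := by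
        have hne : y g.lo ≠ y g.hi := by
          intro e
          apply hxy
          rw [h]
          ext i
          simp only [Function.comp]
          by_cases h1 : i = g.lo
          · simp [h1, e]
          by_cases h2 : i = g.hi
          · simp [h2, e]
          rw [Equiv.swap_apply_of_ne_of_ne h1 h2]
        have : x g.lo = y g.hi := by rw [h]; simp
        rw [this]
        revert hne
        cases y g.lo <;> cases y g.hi <;> simp
      rw [hb, hh]
      rcases Bool.eq_false_or_eq_true (y g.lo) with e | e <;>
        simp [e, -Complex.ofReal_sin, Complex.conj_ofReal]
    · rw [if_neg (fun e => h (hsw.1 e)), if_neg h]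
      simp

theorem orthogonal_inverse {N : ℕ} (G : GivensCircuit N) :
    GivensCircuit.orthogonal (GivensCircuit.inverse G) = (GivensCircuit.orthogonal G)ᵀ := by
  rw [GivensCircuit.orthogonal, GivensCircuit.orthogonal, Matrix.transpose_list_prod,
    GivensCircuit.inverse, List.map_reverse, List.map_map, List.map_map]
  congr 2
  exact List.map_congr_left fun g _ => rotation_neg g

theorem fbsOp_inverse {N : ℕ} (G : GivensCircuit N) :
    GivensCircuit.fbsOp (GivensCircuit.inverse G) = (GivensCircuit.fbsOp G)ᴴ := by
  rw [GivensCircuit.fbsOp, GivensCircuit.fbsOp, Matrix.conjTranspose_list_prod,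
    GivensCircuit.inverse, List.map_reverse, List.map_map, List.map_map]
  congr 2
  exact List.map_congr_left fun g _ => (fbs_conjTranspose g).symm

theorem conjTranspose_fbsOp_mul {N : ℕ} (G : GivensCircuit N) :
    (GivensCircuit.fbsOp G)ᴴ * GivensCircuit.fbsOp G = 1 := by
  induction G with
  | nil => simp [GivensCircuit.fbsOp]
  | cons g G ih =>
    have e1 : GivensCircuit.fbsOp (g :: G) = g.fbs * GivensCircuit.fbsOp G := by
      simp [GivensCircuit.fbsOp]
    rw [e1, Matrix.conjTranspose_mul, Matrix.mul_assoc, ← Matrix.mul_assoc _ g.fbs,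
      fbs_conjTranspose, fbs_neg_mul, Matrix.one_mul, ih]

/-! ### Projections on the strings that vanish outside a set of qubits -/

/-- The projection on the strings that vanish outside the range of `J`. -/
def proj {N n : ℕ} (J : Fin n ↪o Fin N) (ψ : (Fin N → Bool) → ℂ) : (Fin N → Bool) → ℂ :=
  fun x => if ∀ i, (¬ ∃ j, J j = i) → x i = false then ψ x else 0

theorem proj_subspaceState {N n k : ℕ} (J : Fin n ↪o Fin N) (X : Matrix (Fin N) (Fin k) ℝ) :
    proj J (subspaceState X)
      = subspaceState (padRows J (((1 : Matrix (Fin N) (Fin N) ℝ).submatrix id J)ᵀ * X)) := by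
  ext x
  rw [subspaceState_project J X, proj]
  · rintro i ⟨j, rfl⟩
    ext l
    simp [padRows, Matrix.mul_apply, Matrix.one_apply]
  · intro i hi
    ext l
    rw [padRows, Matrix.mul_apply]
    apply Finset.sum_eq_zero
    intro j _
    rw [Matrix.submatrix_apply, id, Matrix.one_apply_ne, zero_mul]
    exact fun e => hi ⟨j, e.symm⟩

theorem proj_colState {N n : ℕ} (J : Fin n ↪o Fin N) (V : Matrix (Fin n) (Fin n) ℝ)
    (S : Finset (Fin n)) : proj J (colState J V S) = colState J V S := by
  rw [colState, proj_subspaceState]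
  congr 1
  rw [padRows, padRows, ← Matrix.mul_assoc _ᵀ, transpose_embedding_mul_embedding, Matrix.one_mul]

theorem IsSVD.transpose_mul_mul {m n : ℕ} {A : Matrix (Fin m) (Fin n) ℝ}
    {W : Matrix (Fin m) (Fin m) ℝ} {σ : Fin n → ℝ} {V : Matrix (Fin n) (Fin n) ℝ}
    (h : IsSVD A W σ V) : Aᵀ * A * V = V * Matrix.diagonal fun j => σ j ^ 2 := by
  have hW : Wᵀ * W = 1 := (Matrix.mem_orthogonalGroup_iff' (Fin m) ℝ).1 h.left_mem
  have hV : Vᵀ * V = 1 := (Matrix.mem_orthogonalGroup_iff' (Fin n) ℝ).1 h.right_mem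
  set D : Matrix (Fin m) (Fin n) ℝ := Matrix.of fun (i : Fin m) (j : Fin n) =>
    if (i : ℕ) = (j : ℕ) then σ j else 0 with hD
  have hDD : Dᵀ * D = Matrix.diagonal fun j => σ j ^ 2 := by
    ext i j
    simp only [Matrix.mul_apply, Matrix.transpose_apply, hD, Matrix.of_apply]
    by_cases hi : (i : ℕ) < m
    · rw [Finset.sum_eq_single ⟨i, hi⟩]
      · by_cases hij : i = j
        · subst hij; simp [sq]
        · have : (i : ℕ) ≠ j := fun e => hij (Fin.ext e)
          simp [hij, this]
      · intro b _ hb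
        have : (b : ℕ) ≠ i := fun e => hb (Fin.ext e)
        simp [this]
      · simp
    -- A column beyond the last row of `D` is zero, and there `σ i = 0` as well.
    · rw [Finset.sum_eq_zero]
      · by_cases hij : i = j
        · subst hij; simp [h.eq_zero i (by omega)]
        · simp [hij]
      · intro b _
        have : (b : ℕ) ≠ i := by omega
        simp [this]
  have hA : A = W * D * Vᵀ := h.eq_mul
  rw [hA, ← hDD]
  simp only [Matrix.transpose_mul, Matrix.transpose_transpose, Matrix.mul_assoc, hV]
  rw [← Matrix.mul_assoc Wᵀ W, hW, Matrix.one_mul, Matrix.mul_one]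

/-- The states `|Col(V_S)⟩` are eigenvectors of the compressed projection. -/
theorem proj_conj_proj_colState {N m n : ℕ} (I : Fin m ↪o Fin N) (J : Fin n ↪o Fin N)
    (G : GivensCircuit N) {W : Matrix (Fin m) (Fin m) ℝ} {σ : Fin n → ℝ}
    {V : Matrix (Fin n) (Fin n) ℝ}
    (h : IsSVD ((GivensCircuit.orthogonal G).submatrix I J) W σ V) (S : Finset (Fin n)) :
    proj J ((GivensCircuit.fbsOp G)ᴴ *ᵥ proj I (GivensCircuit.fbsOp G *ᵥ colState J V S))
      = (((∏ i ∈ S, σ i) ^ 2 : ℝ) : ℂ) • colState J V S := by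
  rw [colState, fbsOp_mulVec_subspaceState, proj_subspaceState, ← fbsOp_inverse,
    fbsOp_mulVec_subspaceState, orthogonal_inverse, proj_subspaceState]
  set U := GivensCircuit.orthogonal G
  set EI := (1 : Matrix (Fin N) (Fin N) ℝ).submatrix id I
  set EJ := (1 : Matrix (Fin N) (Fin N) ℝ).submatrix id J
  have hA : U.submatrix I J = EIᵀ * U * EJ := by
    ext i j
    simp [EI, EJ, Matrix.mul_apply, Matrix.one_apply]
  have hcol : columns V S = V * (1 : Matrix (Fin n) (Fin n) ℝ).submatrix id (S.orderEmbOfFin rfl) := by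
    ext i j
    simp [columns, Matrix.mul_apply, Matrix.one_apply]
  have hdiag : (Matrix.diagonal fun j => σ j ^ 2) *
      (1 : Matrix (Fin n) (Fin n) ℝ).submatrix id (S.orderEmbOfFin rfl)
      = (1 : Matrix (Fin n) (Fin n) ℝ).submatrix id (S.orderEmbOfFin rfl) *
        Matrix.diagonal fun a => σ (S.orderEmbOfFin rfl a) ^ 2 := by
    ext i j
    rw [Matrix.diagonal_mul, Matrix.mul_diagonal]
    simp only [Matrix.submatrix_apply, id, Matrix.one_apply]
    split_ifs with e
    · rw [e, mul_comm]
    · simp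
  -- The rows and columns selected along the way compose to `AᵀA`, which scales each column of `V_S`
  -- by its squared singular value. The scalings leave the determinants as the product over `S`.
  have key : EJᵀ * (Uᵀ * padRows I (EIᵀ * (U * padRows J (columns V S))))
      = columns V S * Matrix.diagonal fun a => σ (S.orderEmbOfFin rfl a) ^ 2 := by
    have e1 : EJᵀ * (Uᵀ * padRows I (EIᵀ * (U * padRows J (columns V S))))
        = (U.submatrix I J)ᵀ * U.submatrix I J * columns V S := by
      rw [hA, padRows, padRows]
      simp only [Matrix.transpose_mul, Matrix.transpose_transpose, Matrix.mul_assoc]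
      rfl
    rw [e1, hcol, ← Matrix.mul_assoc, h.transpose_mul_mul, Matrix.mul_assoc, hdiag,
      Matrix.mul_assoc]
  have hpad : padRows J (columns V S * Matrix.diagonal fun a => σ (S.orderEmbOfFin rfl a) ^ 2)
      = padRows J (columns V S) * Matrix.diagonal fun a => σ (S.orderEmbOfFin rfl a) ^ 2 := by
    rw [padRows, padRows, Matrix.mul_assoc]
  rw [key, hpad, subspaceState_mul_diagonal]
  congr 2
  rw [Finset.prod_pow]
  congr 1
  rw [← Finset.prod_coe_sort S σ]
  exact (S.orderIsoOfFin rfl).toEquiv.prod_comp (fun i : S => σ i)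

end SubspaceSVE

end

noncomputable section

namespace SubspaceSVE

/-! ### Squared norms of finite complex vectors -/

/-- The squared Euclidean norm. -/
def nsq {X : Type*} [Fintype X] (v : X → ℂ) : ℝ := ∑ x, ‖v x‖ ^ 2

theorem nsq_nonneg {X : Type*} [Fintype X] (v : X → ℂ) : 0 ≤ nsq v :=
  Finset.sum_nonneg fun _ _ => sq_nonneg _

theorem ofReal_nsq {X : Type*} [Fintype X] (v : X → ℂ) : (nsq v : ℂ) = star v ⬝ᵥ v := by
  rw [nsq, dotProduct, Complex.ofReal_sum]
  refine Finset.sum_congr rfl fun x _ => ?_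
  rw [Pi.star_apply, Complex.star_def, mul_comm, Complex.mul_conj, Complex.normSq_eq_norm_sq]

theorem nsq_smul {X : Type*} [Fintype X] (c : ℂ) (v : X → ℂ) : nsq (c • v) = ‖c‖ ^ 2 * nsq v := by
  simp [nsq, Finset.mul_sum, mul_pow]

theorem nsq_add_le {X : Type*} [Fintype X] (v w : X → ℂ) :
    nsq (v + w) ≤ 2 * (nsq v + nsq w) := by
  rw [nsq, nsq, nsq, ← Finset.sum_add_distrib, Finset.mul_sum]
  refine Finset.sum_le_sum fun x _ => ?_
  have h := norm_add_le (v x) (w x)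
  have h0 := norm_nonneg (v x + w x)
  rw [Pi.add_apply]
  nlinarith [sq_nonneg (‖v x‖ - ‖w x‖)]

theorem nsq_eq_zero {X : Type*} [Fintype X] {v : X → ℂ} (h : nsq v = 0) : v = 0 := by
  rw [nsq, Finset.sum_eq_zero_iff_of_nonneg fun _ _ => sq_nonneg _] at h
  ext x
  simpa using h x (Finset.mem_univ x)

theorem star_mulVec_dotProduct {X : Type*} [Fintype X] (M : Matrix X X ℂ) (v w : X → ℂ) :
    star (M *ᵥ v) ⬝ᵥ w = star v ⬝ᵥ (Mᴴ *ᵥ w) := by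
  rw [Matrix.star_mulVec, Matrix.dotProduct_mulVec]

theorem nsq_mulVec {X : Type*} [Fintype X] [DecidableEq X] {M : Matrix X X ℂ} (hM : Mᴴ * M = 1)
    (v : X → ℂ) : nsq (M *ᵥ v) = nsq v := by
  have : (nsq (M *ᵥ v) : ℂ) = nsq v := by
    rw [ofReal_nsq, ofReal_nsq, star_mulVec_dotProduct, Matrix.mulVec_mulVec, hM,
      Matrix.one_mulVec]
  exact_mod_cast this

/-- Pythagoras. -/
theorem nsq_sum_smul {X ι : Type*} [Fintype X] (s : Finset ι) (γ : ι → ℂ) (ξ : ι → X → ℂ)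
    (h : ∀ i ∈ s, ∀ j ∈ s, i ≠ j → star (ξ i) ⬝ᵥ ξ j = 0) :
    nsq (∑ i ∈ s, γ i • ξ i) = ∑ i ∈ s, ‖γ i‖ ^ 2 * nsq (ξ i) := by
  have : (nsq (∑ i ∈ s, γ i • ξ i) : ℂ) = ∑ i ∈ s, ((‖γ i‖ ^ 2 * nsq (ξ i) : ℝ) : ℂ) := by
    rw [ofReal_nsq, star_sum, sum_dotProduct]
    refine Finset.sum_congr rfl fun i hi => ?_
    rw [dotProduct_sum, Finset.sum_eq_single i]
    · rw [← nsq_smul, ofReal_nsq]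
    · intro j hj hij
      rw [star_smul, smul_dotProduct, dotProduct_smul, h i hi j hj hij.symm]
      simp
    · exact fun hn => absurd hi hn
  rw [← Complex.ofReal_sum] at this
  exact_mod_cast this

/-! ### Two projections and the walk operator -/

/-- The matrix of the projection on the strings that vanish outside the range of `J`. -/
def projMat {N n : ℕ} (J : Fin n ↪o Fin N) : Matrix (Fin N → Bool) (Fin N → Bool) ℂ :=
  open scoped Classical in
  Matrix.diagonal fun x => if ∀ i, (¬ ∃ j, J j = i) → x i = false then 1 else 0

theorem projMat_mulVec {N n : ℕ} (J : Fin n ↪o Fin N) (ψ : (Fin N → Bool) → ℂ) :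
    projMat J *ᵥ ψ = proj J ψ := by
  ext x
  simp [projMat, Matrix.mulVec_diagonal, proj]

theorem projMat_mul_self {N n : ℕ} (J : Fin n ↪o Fin N) : projMat J * projMat J = projMat J := by
  rw [projMat, Matrix.diagonal_mul_diagonal]
  congr 1
  ext x
  split_ifs <;> simp

theorem projMat_conjTranspose {N n : ℕ} (J : Fin n ↪o Fin N) : (projMat J)ᴴ = projMat J := by
  rw [projMat, Matrix.diagonal_conjTranspose]
  congr 1
  ext x
  rw [Pi.star_apply]
  split_ifs <;> simp

/-- The walk operator `(2B - 1)(2A - 1)` of two projections. -/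
def walk {X : Type*} [Fintype X] [DecidableEq X] (A B : Matrix X X ℂ) : Matrix X X ℂ :=
  (2 • B - 1) * (2 • A - 1)

/-- The span of `v` and `B v` is invariant: `2A - 1` fixes `v` and sends `B v` to `2q v - B v`,
while `2B - 1` fixes `B v` and sends `v` to `2 B v - v`. -/
theorem walk_mulVec_combination {X : Type*} [Fintype X] [DecidableEq X] {A B : Matrix X X ℂ}
    {v : X → ℂ} {q : ℂ} (hA : A *ᵥ v = v) (hAB : A *ᵥ (B *ᵥ v) = q • v)
    (hB : B * B = B) (a b : ℂ) :
    walk A B *ᵥ (a • v + b • (B *ᵥ v))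
      = (-a - 2 * q * b) • v + (2 * a + (4 * q - 1) * b) • (B *ᵥ v) := by
  have e1 : (2 • A - 1) *ᵥ (a • v + b • (B *ᵥ v)) = (a + 2 * b * q) • v - b • (B *ᵥ v) := by
    rw [Matrix.sub_mulVec, two_smul, Matrix.add_mulVec, Matrix.one_mulVec, Matrix.mulVec_add,
      Matrix.mulVec_smul, Matrix.mulVec_smul, hA, hAB]
    module
  rw [walk, ← Matrix.mulVec_mulVec, e1, Matrix.sub_mulVec, two_smul, Matrix.add_mulVec,
    Matrix.one_mulVec, Matrix.mulVec_sub, Matrix.mulVec_smul, Matrix.mulVec_smul,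
    Matrix.mulVec_mulVec, hB]
  module

/-- The vector `v` is the sum of two eigenvectors of the walk operator, with phases
`± 2 arccos p`, in the span of `v` and `B v`. -/
theorem exists_walk_eigenvectors {X : Type*} [Fintype X] [DecidableEq X] {A B : Matrix X X ℂ}
    {v : X → ℂ} {p : ℝ} (hp : 0 ≤ p) (hv : star v ⬝ᵥ v = 1) (hA : A *ᵥ v = v) (hAh : Aᴴ = A)
    (hAB : A *ᵥ (B *ᵥ v) = ((p ^ 2 : ℝ) : ℂ) • v) (hB : B * B = B) (hBh : Bᴴ = B) :
    p ≤ 1 ∧ ∃ a b a' b' : ℂ, (a • v + b • (B *ᵥ v)) + (a' • v + b' • (B *ᵥ v)) = v ∧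
      walk A B *ᵥ (a • v + b • (B *ᵥ v)) =
        Complex.exp (2 * Real.arccos p * Complex.I) • (a • v + b • (B *ᵥ v)) ∧
      walk A B *ᵥ (a' • v + b' • (B *ᵥ v)) =
        Complex.exp (-(2 * Real.arccos p * Complex.I)) • (a' • v + b' • (B *ᵥ v)) ∧
      nsq (a • v + b • (B *ᵥ v)) ≤ 1 ∧ nsq (a' • v + b' • (B *ᵥ v)) ≤ 1 := by
  -- The Gram matrix of `v` and `B v` depends on `p²` only, since `v = A v` and `A B v = p² v`.
  have huv : star (B *ᵥ v) ⬝ᵥ v = ((p ^ 2 : ℝ) : ℂ) := by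
    rw [star_mulVec_dotProduct, hBh]
    nth_rewrite 1 [← hA]
    rw [star_mulVec_dotProduct, hAh, hAB, dotProduct_smul, hv]
    simp
  have hvu : star v ⬝ᵥ (B *ᵥ v) = ((p ^ 2 : ℝ) : ℂ) := by
    rw [← huv, star_mulVec_dotProduct, hBh]
  have huu : star (B *ᵥ v) ⬝ᵥ (B *ᵥ v) = ((p ^ 2 : ℝ) : ℂ) := by
    rw [star_mulVec_dotProduct, hBh, Matrix.mulVec_mulVec, hB, hvu]
  have hn : ∀ a b : ℂ, (nsq (a • v + b • (B *ᵥ v)) : ℂ) = star a * a +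
      (star a * b + star b * a + star b * b) * ((p ^ 2 : ℝ) : ℂ) := by
    intro a b
    rw [ofReal_nsq, star_add, star_smul, star_smul]
    simp only [add_dotProduct, dotProduct_add, smul_dotProduct, dotProduct_smul, hv, huv, hvu, huu,
      smul_eq_mul]
    ring
  -- The vector `v - B v` has squared norm `1 - p²`; this yields `p ≤ 1` and settles the case `p =
  -- 1`.
  have hd : nsq ((1 : ℂ) • v + (-1 : ℂ) • (B *ᵥ v)) = 1 - p ^ 2 := by
    have := hn 1 (-1)
    have h2 : (nsq ((1 : ℂ) • v + (-1 : ℂ) • (B *ᵥ v)) : ℂ) = ((1 - p ^ 2 : ℝ) : ℂ) := by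
      rw [this]; push_cast; simp; ring
    exact_mod_cast h2
  have hp1 : p ≤ 1 := by
    have := nsq_nonneg ((1 : ℂ) • v + (-1 : ℂ) • (B *ᵥ v))
    rw [hd] at this
    nlinarith
  refine ⟨hp1, ?_⟩
  have hnv : nsq v = 1 := by
    have := ofReal_nsq v
    rw [hv] at this
    exact_mod_cast this
  have hz : nsq (0 : X → ℂ) = 0 := by simp [nsq]
  -- For `p = 1` and `p = 0` the span is a line, `sin (2 arccos p) = 0`, and `v` itself is an
  -- eigenvector (eigenvalue `1`, respectively `-1`); the second summand is then zero.
  rcases eq_or_lt_of_le hp1 with rfl | hlt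
  · have hBv : B *ᵥ v = v := by
      have := nsq_eq_zero (hd.trans (by norm_num))
      rw [one_smul, neg_smul, one_smul, add_neg_eq_zero] at this
      exact this.symm
    have hw := walk_mulVec_combination hA hAB hB 1 0
    refine ⟨1, 0, 0, 0, ?_, ?_, ?_, ?_, ?_⟩
    · simp
    · rw [hw, hBv]; simp; module
    · simp
    · simp [hnv]
    · simp [hz]
  rcases eq_or_lt_of_le hp with rfl | hpos
  · have hBv : B *ᵥ v = 0 := by
      apply nsq_eq_zero
      have := ofReal_nsq (B *ᵥ v)
      rw [huu] at this
      have h2 := Complex.ofReal_injective this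
      rw [h2]; norm_num
    have hw := walk_mulVec_combination hA hAB hB 1 0
    refine ⟨1, 0, 0, 0, ?_, ?_, ?_, ?_, ?_⟩
    · simp
    · have : Complex.exp (2 * (Real.arccos 0 : ℝ) * Complex.I) = -1 := by
        rw [Real.arccos_zero, ← Complex.exp_pi_mul_I]
        congr 1
        push_cast
        ring
      rw [hw, hBv, this]; simp
    · simp
    · simp [hnv]
    · simp [hz]
  set s : ℝ := Real.sin (2 * Real.arccos p) with hs
  have hcos : Real.cos (2 * Real.arccos p) = 2 * p ^ 2 - 1 := by
    rw [Real.cos_two_mul, Real.cos_arccos (by linarith) hp1]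
  have hs2 : s ^ 2 = 4 * p ^ 2 * (1 - p ^ 2) := by
    have := Real.sin_sq_add_cos_sq (2 * Real.arccos p)
    rw [hcos] at this
    rw [hs]
    linear_combination this
  have hs0 : s ≠ 0 := by
    intro h
    rw [h] at hs2
    have : 0 < 4 * p ^ 2 * (1 - p ^ 2) := by
      have : p ^ 2 < 1 := by nlinarith
      have : 0 < p ^ 2 := by positivity
      apply mul_pos <;> linarith
    linarith
  have hsC : (s : ℂ) ≠ 0 := by exact_mod_cast hs0
  have hs2C : (s : ℂ) ^ 2 = 4 * p ^ 2 * (1 - p ^ 2) := by exact_mod_cast hs2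
  have hexp : Complex.exp (2 * Real.arccos p * Complex.I) = (2 * p ^ 2 - 1) + s * Complex.I := by
    have : (2 * Real.arccos p * Complex.I : ℂ) = ((2 * Real.arccos p : ℝ) : ℂ) * Complex.I := by
      push_cast; ring
    rw [this, Complex.exp_mul_I, ← Complex.ofReal_cos, ← Complex.ofReal_sin, hcos, ← hs]
    push_cast
    ring
  have hexp' : Complex.exp (-(2 * Real.arccos p * Complex.I))
      = (2 * p ^ 2 - 1) - s * Complex.I := by
    have : (-(2 * Real.arccos p * Complex.I) : ℂ) = ((-(2 * Real.arccos p) : ℝ) : ℂ) * Complex.I := by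
      push_cast; ring
    rw [this, Complex.exp_mul_I, ← Complex.ofReal_cos, ← Complex.ofReal_sin, Real.cos_neg,
      Real.sin_neg, hcos, ← hs]
    push_cast
    ring
  have hI : Complex.I ^ 2 = -1 := Complex.I_sq
  -- The sign `e = ± 1` treats both eigenvectors at once; in the generic case each has squared norm
  -- exactly `1/2`.
  have hnorm : ∀ e : ℂ, e ^ 2 = 1 → star e = e →
      nsq ((1 / 2 + e * Complex.I * p ^ 2 / s) • v + (-(e * Complex.I) / s) • (B *ᵥ v)) ≤ 1 := by
    intro e he hes
    have h1 : (nsq ((1 / 2 + e * Complex.I * p ^ 2 / s) • v +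
        (-(e * Complex.I) / s) • (B *ᵥ v)) : ℂ) = ((1 / 2 : ℝ) : ℂ) := by
      rw [hn]
      simp only [star_add, star_mul', star_div₀, star_neg, star_pow, star_one, hes,
        Complex.star_def, Complex.conj_I, Complex.conj_ofReal]
      rw [map_ofNat]
      push_cast
      field_simp
      linear_combination -hs2C + (4 * p ^ 4 - 4 * p ^ 2) * (e ^ 2 * hI - he)
    have := Complex.ofReal_injective h1
    rw [this]; norm_num
  -- The eigenvectors of the two-by-two matrix, scaled so that they sum to `v`: the coefficients of
  -- `v` are `1/2 ± i p²/s`, those of `B v` are `∓ i/s`.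
  refine ⟨1 / 2 + 1 * Complex.I * p ^ 2 / s, -(1 * Complex.I) / s,
    1 / 2 + -1 * Complex.I * p ^ 2 / s, -(-1 * Complex.I) / s, ?_, ?_, ?_,
    hnorm 1 (by norm_num) (by simp), hnorm (-1) (by norm_num) (by simp)⟩
  · module
  · rw [walk_mulVec_combination hA hAB hB, hexp, smul_add, smul_smul, smul_smul]
    congr 2
    · push_cast
      field_simp
      linear_combination -Complex.I * hs2C - 2 * p ^ 2 * s * hI
    · push_cast
      field_simp
      ring_nf
      rw [hI]
      ring
  · rw [walk_mulVec_combination hA hAB hB, hexp', smul_add, smul_smul, smul_smul]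
    congr 2
    · push_cast
      field_simp
      linear_combination Complex.I * hs2C - 2 * p ^ 2 * s * hI
    · push_cast
      field_simp
      ring_nf
      rw [hI]
      ring

end SubspaceSVE

end

noncomputable section

namespace SubspaceSVE

/-! ### Binary numbers -/

theorem ofBits_eq_sum {T : ℕ} (y : Fin T → Bool) :
    Nat.ofBits y = ∑ i : Fin T, if y i = true then 2 ^ (i : ℕ) else 0 := by
  induction T with
  | zero => simp
  | succ T ih =>
    rw [Nat.ofBits_succ, ih, Fin.sum_univ_succ, Finset.mul_sum, add_comm]
    congr 1
    · cases y 0 <;> simp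
    · refine Finset.sum_congr rfl fun i _ => ?_
      simp only [Function.comp, Fin.val_succ, pow_succ]
      split_ifs <;> ring

theorem ofBits_injective {T : ℕ} {y y' : Fin T → Bool} (h : Nat.ofBits y = Nat.ofBits y') :
    y = y' := by
  funext i
  rw [← Nat.testBit_ofBits_lt y i i.2, h, Nat.testBit_ofBits_lt y' i i.2]

theorem registerAngle_testBit {t B : ℕ} (hB : B < 2 ^ t) :
    registerAngle (fun i : Fin t => B.testBit i) = Real.pi * B / 2 ^ t := by
  have h := ofBits_eq_sum (fun i : Fin t => B.testBit i)
  rw [Nat.ofBits_testBit, Nat.mod_eq_of_lt hB] at h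
  rw [registerAngle]
  congr 2
  conv_rhs => rw [h]
  push_cast
  rfl

/-- Complement all bits if the top bit is set. -/
def fold {T : ℕ} (top : Fin T) (y : Fin T → Bool) : Fin T → Bool := fun i => xor (y i) (y top)

theorem ofBits_fold {T : ℕ} (top : Fin T) (y : Fin T → Bool) :
    Nat.ofBits (fold top y)
      = if y top = true then 2 ^ T - (Nat.ofBits y + 1) else Nat.ofBits y := by
  split_ifs with h
  · apply Nat.eq_of_testBit_eq
    intro i
    rw [Nat.testBit_two_pow_sub_succ (Nat.ofBits_lt_two_pow y)]
    by_cases hi : i < T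
    · rw [Nat.testBit_ofBits_lt _ i hi, Nat.testBit_ofBits_lt _ i hi]
      simp [fold, h, hi]
    · rw [Nat.testBit_ofBits_ge _ i (by omega)]
      simp [hi]
  · congr 1
    ext i
    simp [fold, h]

theorem ofBits_lt_of_top {T : ℕ} {y : Fin (T + 1) → Bool} (h : y (Fin.last T) = false) :
    Nat.ofBits y < 2 ^ T := by
  apply Nat.lt_pow_two_of_testBit
  intro i hi
  rcases eq_or_lt_of_le hi with rfl | hlt
  · rw [Nat.testBit_ofBits_lt _ _ (Nat.lt_succ_self _)]
    exact h
  · exact Nat.testBit_ofBits_ge _ _ hlt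

theorem le_ofBits_of_top {T : ℕ} {y : Fin (T + 1) → Bool} (h : y (Fin.last T) = true) :
    2 ^ T ≤ Nat.ofBits y := by
  apply Nat.ge_two_pow_of_testBit
  rw [Nat.testBit_ofBits_lt _ _ (Nat.lt_succ_self _)]
  exact h

/-- On a circle of length `2H`, the points of `[0, H]` represent the orbits of `x ↦ -x`, and `|A -
B|` is the distance between the orbits of `A` and `B`. -/
theorem abs_sub_le_circle_dist {H A B : ℝ} (hA : 0 ≤ A) (hA' : A ≤ H) (hB : 0 ≤ B) (hB' : B ≤ H)
    (q : ℤ) : |A - B| ≤ |A - B - 2 * H * q| ∧ |A - B| ≤ |A + B - 2 * H * q| := by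
  have hH : 0 ≤ H := hA.trans hA'
  rcases lt_trichotomy q 0 with h | h | h
  · have h1 : (q : ℝ) ≤ -1 := by exact_mod_cast Int.le_sub_one_of_lt h
    have h2 : 2 * H * q ≤ - (2 * H) := by nlinarith
    constructor
    · rw [abs_of_nonneg (by linarith : 0 ≤ A - B - 2 * H * q), abs_le]
      constructor <;> linarith
    · rw [abs_of_nonneg (by linarith : 0 ≤ A + B - 2 * H * q), abs_le]
      constructor <;> linarith
  · subst h
    constructor
    · simp
    · simp only [Int.cast_zero, mul_zero, sub_zero]
      rw [abs_of_nonneg (by linarith : 0 ≤ A + B), abs_le]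
      constructor <;> linarith
  · have h1 : (1 : ℝ) ≤ q := by exact_mod_cast h
    have h2 : 2 * H ≤ 2 * H * q := by nlinarith
    constructor
    · rw [abs_of_nonpos (by linarith : A - B - 2 * H * q ≤ 0), abs_le]
      constructor <;> linarith
    · rw [abs_of_nonpos (by linarith : A + B - 2 * H * q ≤ 0), abs_le]
      constructor <;> linarith

/-- Folding maps a number close to `± Z` modulo `2 ^ (T + 1)` to a number close to `Z`. -/
theorem abs_fold_sub_le {T : ℕ} (y : Fin (T + 1) → Bool) {Z : ℝ} (h0 : 0 ≤ Z) (h1 : Z ≤ 2 ^ T)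
    (q : ℤ) :
    |(Nat.ofBits (fold (Fin.last T) y) : ℝ) - ⌊Z⌋₊| ≤ |Nat.ofBits y - Z - 2 ^ (T + 1) * q| + 2 ∧
    |(Nat.ofBits (fold (Fin.last T) y) : ℝ) - ⌊Z⌋₊| ≤ |Nat.ofBits y + Z - 2 ^ (T + 1) * q| + 2 := by
  have hfl := Nat.floor_le h0
  have hfl' := Nat.lt_floor_add_one Z
  have hZ : |Z - ⌊Z⌋₊| ≤ 1 := by rw [abs_le]; constructor <;> linarith
  rw [ofBits_fold, pow_succ' (2 : ℝ)]
  cases h : y (Fin.last T) with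
  | false =>
    have hlt : (Nat.ofBits y : ℝ) ≤ 2 ^ T := by exact_mod_cast (ofBits_lt_of_top h).le
    obtain ⟨a, b⟩ := abs_sub_le_circle_dist (Nat.cast_nonneg (Nat.ofBits y)) hlt h0 h1 q
    have := abs_add_le ((Nat.ofBits y : ℝ) - Z) (Z - ⌊Z⌋₊)
    rw [sub_add_sub_cancel] at this
    simp only [Bool.false_eq_true, if_false]
    constructor <;> linarith
  | true =>
    have hle : (2 : ℝ) ^ T ≤ Nat.ofBits y := by exact_mod_cast le_ofBits_of_top h
    have hlt := Nat.ofBits_lt_two_pow y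
    have hlt' : (Nat.ofBits y : ℝ) ≤ 2 * 2 ^ T := by
      rw [← pow_succ']; exact_mod_cast hlt.le
    -- With the top bit set, `2^(T+1) - y` is the reflected point, so the roles of `Z` and `-Z` are
    -- exchanged and the winding number becomes `1 - q`. Complementing the bits gives one less; this
    -- unit and the fractional part of `Z` fit into the slack `2`.
    obtain ⟨a, b⟩ := abs_sub_le_circle_dist (H := 2 ^ T) (A := 2 * 2 ^ T - Nat.ofBits y)
      (by linarith) (by linarith) h0 h1 (1 - q)
    have e1 : |2 * 2 ^ T - (Nat.ofBits y : ℝ) - Z - 2 * 2 ^ T * ((1 - q : ℤ) : ℝ)|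
        = |Nat.ofBits y + Z - 2 * 2 ^ T * q| := by
      rw [← abs_neg]; congr 1; push_cast; ring
    have e2 : |2 * 2 ^ T - (Nat.ofBits y : ℝ) + Z - 2 * 2 ^ T * ((1 - q : ℤ) : ℝ)|
        = |Nat.ofBits y - Z - 2 * 2 ^ T * q| := by
      rw [← abs_neg]; congr 1; push_cast; ring
    rw [e1] at a
    rw [e2] at b
    have e3 : ((2 ^ (T + 1) - (Nat.ofBits y + 1) : ℕ) : ℝ) = 2 * 2 ^ T - Nat.ofBits y - 1 := by
      rw [Nat.cast_sub (by omega)]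
      push_cast
      ring
    rw [if_pos rfl, e3]
    have e4 : (2 * 2 ^ T - Nat.ofBits y - 1 : ℝ) - ⌊Z⌋₊
        = (2 * 2 ^ T - Nat.ofBits y - Z) + ((Z - ⌊Z⌋₊) - 1) := by ring
    have := abs_add_le (2 * 2 ^ T - Nat.ofBits y - Z : ℝ) ((Z - ⌊Z⌋₊) - 1)
    have h3 : |(Z - ⌊Z⌋₊) - 1| ≤ 1 := by rw [abs_le]; constructor <;> linarith
    rw [e4]
    constructor <;> linarith

/-! ### Rounding with a random shift -/

/-- Passing from `z` to `z + 1` shifts the window of quotients: `z / L` is replaced by `(z + L) / L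
= z / L + 1`. -/
theorem sum_add_div {L : ℕ} (hL : 0 < L) (z : ℕ) : ∑ r ∈ Finset.range L, (z + r) / L = z := by
  induction z with
  | zero =>
    apply Finset.sum_eq_zero
    intro r hr
    rw [zero_add]
    exact Nat.div_eq_of_lt (Finset.mem_range.1 hr)
  | succ z ih =>
    have h1 := Finset.sum_range_succ (fun r => (z + r) / L) L
    have h2 := Finset.sum_range_succ' (fun r => (z + r) / L) L
    rw [ih, Nat.add_div_right z hL] at h1
    have : ∀ r, z + 1 + r = z + (r + 1) := fun r => by ring
    simp only [this]
    rw [h1, add_zero] at h2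
    omega

/-- Each separating shift adds at least one to the difference of the two sums in `sum_add_div`, and
this difference is `b - a`. -/
theorem card_shift_ne_le_aux {L : ℕ} (hL : 0 < L) {a b : ℕ} (hab : a ≤ b) :
    ((Finset.range L).filter fun r => (a + r) / L ≠ (b + r) / L).card ≤ b - a := by
  have h := sum_add_div hL a
  have h' := sum_add_div hL b
  have : ∑ r ∈ Finset.range L, (a + r) / L +
      ((Finset.range L).filter fun r => (a + r) / L ≠ (b + r) / L).card
      ≤ ∑ r ∈ Finset.range L, (b + r) / L := by
    rw [Finset.card_filter, ← Finset.sum_add_distrib]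
    refine Finset.sum_le_sum fun r _ => ?_
    have : (a + r) / L ≤ (b + r) / L := Nat.div_le_div_right (by omega)
    split_ifs <;> omega
  omega

theorem card_shift_ne_le {L : ℕ} (hL : 0 < L) (a b : ℕ) :
    (((Finset.range L).filter fun r => (a + r) / L ≠ (b + r) / L).card : ℝ) ≤ |(a : ℝ) - b| := by
  rcases le_total a b with h | h
  · rw [abs_sub_comm, abs_of_nonneg (by simpa using h), ← Nat.cast_sub h]
    exact_mod_cast card_shift_ne_le_aux hL h
  · rw [abs_of_nonneg (by simpa using h), ← Nat.cast_sub h]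
    rw [Finset.filter_congr fun r _ => ne_comm]
    exact_mod_cast card_shift_ne_le_aux hL h

/-! ### The amplitudes of phase estimation -/

/-- The amplitude factor of the bit `l`: the phase `lam ^ 2 ^ (T - 1 - l)` is corrected by the bits
below `l` and compared with the bit `l`. -/
def ampFactor {T : ℕ} (lam : ℂ) (l : Fin T) (y : Fin T → Bool) : ℂ :=
  (1 + (if y l = true then -1 else 1) *
    ((∏ i : Fin T, if i < l ∧ y i = true then
        Complex.exp (-(2 * Real.pi * Complex.I * (2 ^ (i : ℕ) / 2 ^ ((l : ℕ) + 1)))) else 1) *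
      lam ^ 2 ^ (T - 1 - (l : ℕ)))) / 2

/-- The amplitude of the outcome `y` of phase estimation for the eigenvalue `lam`. -/
def amp {T : ℕ} (lam : ℂ) (y : Fin T → Bool) : ℂ := ∏ l : Fin T, ampFactor lam l y

/-- The corrections may run over all bits: `i = l` contributes `exp(-π i) = -1`, which is the sign
of the bit `l`, and the bits above `l` contribute full turns. Hence all factors are powers of the
single number `exp(2π i (φ - y / 2^T))`. -/
theorem ampFactor_eq {T : ℕ} (φ : ℝ) (l : Fin T) (y : Fin T → Bool) :
    ampFactor (Complex.exp (2 * Real.pi * Complex.I * φ)) l y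
      = (1 + Complex.exp (2 * Real.pi * Complex.I * (φ - Nat.ofBits y / 2 ^ T)) ^
        2 ^ (T - 1 - (l : ℕ))) / 2 := by
  have hT : (2 : ℂ) ^ T = 2 ^ (T - 1 - (l : ℕ)) * 2 ^ ((l : ℕ) + 1) := by
    rw [← pow_add]; congr 1; have := l.2; omega
  have hsplit : Complex.exp (2 * Real.pi * Complex.I * (φ - Nat.ofBits y / 2 ^ T)) ^
        2 ^ (T - 1 - (l : ℕ)) = (∏ i : Fin T, if y i = true then
        Complex.exp (-(2 * Real.pi * Complex.I * (2 ^ (i : ℕ) / 2 ^ ((l : ℕ) + 1)))) else 1) *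
      Complex.exp (2 * Real.pi * Complex.I * φ) ^ 2 ^ (T - 1 - (l : ℕ)) := by
    have e : (∏ i : Fin T, if y i = true then
        Complex.exp (-(2 * Real.pi * Complex.I * (2 ^ (i : ℕ) / 2 ^ ((l : ℕ) + 1)))) else 1)
        = ∏ i : Fin T, Complex.exp (-(2 * Real.pi * Complex.I *
          ((if y i = true then 2 ^ (i : ℕ) else 0) / 2 ^ ((l : ℕ) + 1)))) := by
      refine Finset.prod_congr rfl fun i _ => ?_
      split_ifs <;> simp
    rw [e, ← Complex.exp_sum, ← Complex.exp_nat_mul, ← Complex.exp_nat_mul, ← Complex.exp_add]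
    congr 1
    rw [Finset.sum_neg_distrib, ← Finset.mul_sum, ← Finset.sum_div, hT]
    have hsum : (Nat.ofBits y : ℂ) = ∑ i : Fin T, if y i = true then (2 : ℂ) ^ (i : ℕ) else 0 := by
      rw [ofBits_eq_sum]; push_cast; rfl
    rw [← hsum]
    have h2 : (2 : ℂ) ^ (T - 1 - (l : ℕ)) ≠ 0 := pow_ne_zero _ two_ne_zero
    push_cast
    field_simp
    ring
  rw [hsplit, ampFactor, ← mul_assoc]
  congr 4
  have hl : (if y l = true then (-1 : ℂ) else 1) = ∏ i : Fin T, if i = l then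
      (if y i = true then -1 else 1) else 1 := by
    rw [Finset.prod_ite_eq' Finset.univ l]; simp
  rw [hl, ← Finset.prod_mul_distrib]
  refine Finset.prod_congr rfl fun i _ => ?_
  rcases lt_trichotomy i l with h | h | h
  · rw [if_neg h.ne, one_mul]; simp [h]
  · subst h
    rw [if_pos rfl, if_neg (c := i < i ∧ y i = true) (fun hh => lt_irrefl _ hh.1), mul_one]
    split_ifs
    · have : (2 : ℂ) ^ (i : ℕ) / 2 ^ ((i : ℕ) + 1) = 1 / 2 := by
        rw [pow_succ]
        have h2 : (2 : ℂ) ^ (i : ℕ) ≠ 0 := pow_ne_zero _ two_ne_zero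
        field_simp
      rw [this, ← Complex.exp_neg_pi_mul_I]
      congr 1
      ring
    · rfl
  · rw [if_neg h.ne', one_mul, if_neg (fun hh => absurd hh.1 h.not_gt)]
    split_ifs
    · obtain ⟨d, hd⟩ := Nat.exists_eq_add_of_lt h
      symm
      have : (2 : ℂ) ^ (i : ℕ) / 2 ^ ((l : ℕ) + 1) = ((2 ^ d : ℕ) : ℂ) := by
        rw [hd]
        push_cast
        have h2 : (2 : ℂ) ^ (l : ℕ) ≠ 0 := pow_ne_zero _ two_ne_zero
        field_simp
        ring
      rw [this, Complex.exp_neg, inv_eq_one, Complex.exp_eq_one_iff]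
      exact ⟨((2 ^ d : ℕ) : ℤ), by push_cast; ring⟩
    · rfl

/-- Telescoping by `(u - 1)(1 + u) = u² - 1`. It makes the amplitude the normalized geometric sum
`(w^(2^T) - 1) / (2^T (w - 1))`. -/
theorem sub_one_mul_prod (w : ℂ) (T : ℕ) :
    (w - 1) * ∏ j ∈ Finset.range T, (1 + w ^ 2 ^ j) = w ^ 2 ^ T - 1 := by
  induction T with
  | zero => simp
  | succ T ih =>
    rw [Finset.prod_range_succ, ← mul_assoc, ih, pow_succ, pow_mul]
    ring

theorem amp_eq {T : ℕ} (φ : ℝ) (y : Fin T → Bool) :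
    amp (Complex.exp (2 * Real.pi * Complex.I * φ)) y = ∏ j ∈ Finset.range T,
      (1 + Complex.exp (2 * Real.pi * Complex.I * (φ - Nat.ofBits y / 2 ^ T)) ^ 2 ^ j) / 2 := by
  rw [amp, ← Finset.prod_range_reflect, Finset.prod_range]
  exact Finset.prod_congr rfl fun l _ => ampFactor_eq φ l y

theorem norm_exp_two_pi (x : ℝ) : ‖Complex.exp (2 * Real.pi * Complex.I * x)‖ = 1 := by
  have : (2 * Real.pi * Complex.I * x : ℂ) = ((2 * Real.pi * x : ℝ) : ℂ) * Complex.I := by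
    push_cast; ring
  rw [this, Complex.norm_exp_ofReal_mul_I]

theorem norm_amp_le_one {T : ℕ} (φ : ℝ) (y : Fin T → Bool) :
    ‖amp (Complex.exp (2 * Real.pi * Complex.I * φ)) y‖ ≤ 1 := by
  rw [amp_eq, norm_prod]
  apply Finset.prod_le_one
  · intros; exact norm_nonneg _
  · intro j _
    have := norm_exp_two_pi (φ - Nat.ofBits y / 2 ^ T)
    push_cast at this
    rw [norm_div, Complex.norm_ofNat]
    have h := norm_add_le (1 : ℂ)
      (Complex.exp (2 * Real.pi * Complex.I * (φ - Nat.ofBits y / 2 ^ T)) ^ 2 ^ j)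
    rw [norm_pow, this, one_pow, norm_one] at h
    linarith

/-- The amplitude decays with the distance to the phase. -/
theorem norm_amp_mul_le {T : ℕ} (φ : ℝ) (y : Fin T → Bool) {q : ℤ} {u : ℝ}
    (hu : u = Nat.ofBits y / 2 ^ T - φ - q) (hu2 : |u| ≤ 1 / 2) :
    ‖amp (Complex.exp (2 * Real.pi * Complex.I * φ)) y‖ * (2 ^ T * |u|) ≤ 1 / 2 := by
  set w := Complex.exp (2 * Real.pi * Complex.I * (φ - Nat.ofBits y / 2 ^ T)) with hw
  have hwu : w = Complex.exp (Complex.I * ((-(2 * Real.pi * u) : ℝ) : ℂ)) := by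
    rw [hw, Complex.exp_eq_exp_iff_exists_int]
    exact ⟨-q, by rw [hu]; push_cast; ring⟩
  have hw1 : ‖w‖ = 1 := by
    have := norm_exp_two_pi (φ - Nat.ofBits y / 2 ^ T)
    push_cast at this
    exact this
  -- `|w - 1| = 2 |sin (π u)| ≥ 4 |u|` by Jordan's inequality, which needs `|u| ≤ 1/2`.
  have hlow : 4 * |u| ≤ ‖w - 1‖ := by
    rw [hwu, Complex.norm_exp_I_mul_ofReal_sub_one, norm_mul, Real.norm_eq_abs, Real.norm_eq_abs,
      abs_two]
    have e : -(2 * Real.pi * u) / 2 = -(Real.pi * u) := by ring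
    rw [e, Real.sin_neg, abs_neg]
    have hpi := Real.pi_pos
    have h := Real.mul_abs_le_abs_sin (x := Real.pi * u)
      (by rw [abs_mul, abs_of_pos hpi]; nlinarith)
    rw [abs_mul, abs_of_pos hpi] at h
    have e2 : 2 / Real.pi * (Real.pi * |u|) = 2 * |u| := by field_simp
    linarith
  have hprod : ‖w - 1‖ * (‖amp (Complex.exp (2 * Real.pi * Complex.I * φ)) y‖ * 2 ^ T) ≤ 2 := by
    have h1 : (w - 1) * (amp (Complex.exp (2 * Real.pi * Complex.I * φ)) y * 2 ^ T)
        = w ^ 2 ^ T - 1 := by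
      rw [← sub_one_mul_prod, amp_eq, Finset.prod_div_distrib]
      simp [hw]
    have h2 := norm_sub_le (w ^ 2 ^ T) 1
    rw [← h1, norm_pow, hw1, one_pow, norm_one, norm_mul, norm_mul, norm_pow,
      Complex.norm_ofNat] at h2
    linarith
  have hn : 0 ≤ ‖amp (Complex.exp (2 * Real.pi * Complex.I * φ)) y‖ * 2 ^ T := by positivity
  nlinarith

/-- The outcomes far from the phase have small weight, uniformly in the precision. -/
theorem exists_weighted_outcomes_le {γ : ℝ} (hγ : 0 < γ) :
    ∃ s : ℕ, ∀ (T : ℕ) (φ : ℝ) (c : (Fin T → Bool) → ℝ), (∀ y, 0 ≤ c y) → (∀ y, c y ≤ 1) →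
      (∀ y (q : ℤ), c y ≤ (|Nat.ofBits y - 2 ^ T * φ - 2 ^ T * q| + 2) / 2 ^ s) →
      ∑ y, ‖amp (Complex.exp (2 * Real.pi * Complex.I * φ)) y‖ ^ 2 * c y ≤ γ := by
  -- An outcome at a nonzero integer offset `k` from the phase has weight at most `1/k²`. The
  -- offsets outside a finite set then contribute at most `γ/2` for every `T`; on the finite set `c`
  -- is of order `1 / 2^s`.
  have hsum : Summable fun k : ℤ => 1 / (k : ℝ) ^ 2 :=
    Real.summable_one_div_int_pow.2 (by norm_num)
  obtain ⟨F, hF⟩ := summable_iff_vanishing_norm.1 hsum (γ / 2) (by positivity)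
  -- Adding `0` to `F` keeps the tail at nonzero offsets. The `3` covers the `2` in the bound for
  -- `c` and the rounding error `1/2`; `s ≤ 2^s` turns the bound on `s` into one on `2^s`.
  obtain ⟨s, hs⟩ := exists_nat_gt (((insert 0 F).card * ((∑ k ∈ insert 0 F, |(k : ℝ)|) + 3)) /
    (γ / 2))
  refine ⟨s, fun T φ c hc0 hc1 hc => ?_⟩
  have hs2 : (s : ℝ) ≤ 2 ^ s := by exact_mod_cast Nat.lt_two_pow_self.le
  have hM : (0 : ℝ) < 2 ^ T := by positivity
  set F' := insert 0 F with hF'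
  -- `q y` is the winding number that brings `y / 2^T` closest to `φ`, `u y` the signed distance on
  -- the circle, and `k y` an integer within `1/2` of `2^T u y`.
  set q : (Fin T → Bool) → ℤ := fun y => round (Nat.ofBits y / 2 ^ T - φ) with hq
  set u : (Fin T → Bool) → ℝ := fun y => Nat.ofBits y / 2 ^ T - φ - q y with hu
  set k : (Fin T → Bool) → ℤ := fun y => Nat.ofBits y - 2 ^ T * q y - round (2 ^ T * φ) with hk
  have hu2 : ∀ y, |u y| ≤ 1 / 2 := fun y => abs_sub_round _
  have hd : ∀ y, 2 ^ T * u y = Nat.ofBits y - 2 ^ T * φ - 2 ^ T * q y := fun y => by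
    simp only [hu]; field_simp
  have hkd : ∀ y, |(k y : ℝ) - 2 ^ T * u y| ≤ 1 / 2 := fun y => by
    have := abs_sub_round (2 ^ T * φ)
    have e : (k y : ℝ) - 2 ^ T * u y = 2 ^ T * φ - round (2 ^ T * φ) := by
      rw [hd]
      simp only [hk]
      push_cast
      ring
    rw [e]
    exact this
  -- The offset determines `y` modulo `2^T`, hence `y`.
  have hkinj : Function.Injective k := by
    intro y y' hyy
    apply ofBits_injective
    have h1 := Nat.ofBits_lt_two_pow y
    have h2 := Nat.ofBits_lt_two_pow y'
    have h3 : ((Nat.ofBits y : ℤ) - Nat.ofBits y') = 2 ^ T * (q y - q y') := by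
      simp only [hk] at hyy
      linear_combination hyy
    have h4 : ((Nat.ofBits y : ℤ)) ≡ Nat.ofBits y' [ZMOD ((2 ^ T : ℕ) : ℤ)] := by
      rw [Int.modEq_comm, Int.modEq_iff_dvd]
      exact ⟨q y - q y', by push_cast; exact h3⟩
    rw [Int.natCast_modEq_iff] at h4
    exact Nat.ModEq.eq_of_lt_of_lt h4 h1 h2
  have hamp1 := norm_amp_le_one φ (T := T)
  rw [← Finset.sum_filter_add_sum_filter_not Finset.univ (fun y => k y ∈ F')]
  have hA : ∑ y ∈ Finset.univ.filter (fun y => k y ∈ F'),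
      ‖amp (Complex.exp (2 * Real.pi * Complex.I * φ)) y‖ ^ 2 * c y ≤ γ / 2 := by
    have hb : ∀ y ∈ Finset.univ.filter (fun y => k y ∈ F'),
        ‖amp (Complex.exp (2 * Real.pi * Complex.I * φ)) y‖ ^ 2 * c y
          ≤ ((∑ k ∈ F', |(k : ℝ)|) + 3) / 2 ^ s := by
      intro y hy
      have hy' : k y ∈ F' := (Finset.mem_filter.1 hy).2
      have h1 : ‖amp (Complex.exp (2 * Real.pi * Complex.I * φ)) y‖ ^ 2 ≤ 1 :=
        pow_le_one₀ (norm_nonneg _) (hamp1 y)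
      have h2 := hc y (q y)
      rw [← hd] at h2
      have h3 : |(k y : ℝ)| ≤ ∑ k ∈ F', |(k : ℝ)| :=
        Finset.single_le_sum (f := fun k : ℤ => |(k : ℝ)|) (fun _ _ => abs_nonneg _) hy'
      have h4 : |2 ^ T * u y| ≤ |(k y : ℝ)| + 1 / 2 := by
        have := abs_sub_abs_le_abs_sub (2 ^ T * u y) (k y : ℝ)
        rw [abs_sub_comm] at this
        linarith [hkd y]
      calc _ ≤ 1 * c y := mul_le_mul_of_nonneg_right h1 (hc0 y)
        _ ≤ (|2 ^ T * u y| + 2) / 2 ^ s := by rw [one_mul]; exact h2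
        _ ≤ _ := div_le_div_of_nonneg_right (by linarith) (by positivity)
    refine (Finset.sum_le_card_nsmul _ _ _ hb).trans ?_
    have hcard : (Finset.univ.filter (fun y => k y ∈ F')).card ≤ F'.card :=
      Finset.card_le_card_of_injOn k (fun y hy => (Finset.mem_filter.1 hy).2) hkinj.injOn
    have hcard' : ((Finset.univ.filter (fun y => k y ∈ F')).card : ℝ) ≤ F'.card := by
      exact_mod_cast hcard
    have hpos : 0 ≤ (∑ k ∈ F', |(k : ℝ)|) + 3 := by positivity
    rw [nsmul_eq_mul, ← mul_div_assoc, div_le_iff₀ (by positivity)]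
    rw [div_lt_iff₀ (by positivity)] at hs
    calc _ ≤ F'.card * ((∑ k ∈ F', |(k : ℝ)|) + 3) := by gcongr
      _ ≤ s * (γ / 2) := hs.le
      _ ≤ _ := by rw [mul_comm]; gcongr
  have hB : ∑ y ∈ Finset.univ.filter (fun y => ¬ k y ∈ F'),
      ‖amp (Complex.exp (2 * Real.pi * Complex.I * φ)) y‖ ^ 2 * c y ≤ γ / 2 := by
    have hb : ∀ y ∈ Finset.univ.filter (fun y => ¬ k y ∈ F'),
        ‖amp (Complex.exp (2 * Real.pi * Complex.I * φ)) y‖ ^ 2 * c y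
          ≤ 1 / (k y : ℝ) ^ 2 := by
      intro y hy
      have hy' : k y ∉ F' := (Finset.mem_filter.1 hy).2
      have hk0 : k y ≠ 0 := fun e => hy' (by rw [e, hF']; exact Finset.mem_insert_self _ _)
      have hk1 : (1 : ℝ) ≤ |(k y : ℝ)| := by exact_mod_cast Int.one_le_abs hk0
      -- As `|k| ≥ 1`, the rounding error `1/2` is at most `|k| / 2`.
      have h4 : |(k y : ℝ)| / 2 ≤ 2 ^ T * |u y| := by
        have := abs_sub_abs_le_abs_sub (k y : ℝ) (2 ^ T * u y)
        rw [abs_mul, abs_of_pos hM] at this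
        linarith [hkd y]
      have h5 := norm_amp_mul_le φ y (q := q y) (u := u y) rfl (hu2 y)
      have h6 : ‖amp (Complex.exp (2 * Real.pi * Complex.I * φ)) y‖ * |(k y : ℝ)| ≤ 1 := by
        have := mul_le_mul_of_nonneg_left h4
          (norm_nonneg (amp (Complex.exp (2 * Real.pi * Complex.I * φ)) y))
        linarith
      rw [le_div_iff₀ (by rw [← sq_abs]; positivity), ← sq_abs (k y : ℝ)]
      have h7 : (‖amp (Complex.exp (2 * Real.pi * Complex.I * φ)) y‖ * |(k y : ℝ)|) ^ 2 ≤ 1 :=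
        pow_le_one₀ (by positivity) h6
      calc _ = (‖amp (Complex.exp (2 * Real.pi * Complex.I * φ)) y‖ * |(k y : ℝ)|) ^ 2 * c y := by
            ring
        _ ≤ 1 * 1 := mul_le_mul h7 (hc1 y) (hc0 y) zero_le_one
        _ = 1 := one_mul 1
    refine (Finset.sum_le_sum hb).trans ?_
    have h := hF ((Finset.univ.filter (fun y => ¬ k y ∈ F')).image k) (by
      rw [Finset.disjoint_left]
      intro j hj hjF
      obtain ⟨y, hy, rfl⟩ := Finset.mem_image.1 hj
      exact (Finset.mem_filter.1 hy).2 (Finset.mem_insert_of_mem hjF))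
    rw [Finset.sum_image hkinj.injOn] at h
    exact (le_abs_self _).trans h.le
  linarith

end SubspaceSVE

end

noncomputable section

namespace SubspaceSVE

/-! ### Unitarity of gates -/

theorem ElementaryGate.op_eq {ω : Type} [Fintype ω] [DecidableEq ω] (g : ElementaryGate ω) :
    g.op = (Matrix.kronecker g.mat
      (1 : Matrix ({w // w ∉ g.wires} → Bool) ({w // w ∉ g.wires} → Bool) ℂ)).submatrix
      (Equiv.piEquivPiSubtypeProd (· ∈ g.wires) fun _ => Bool)
      (Equiv.piEquivPiSubtypeProd (· ∈ g.wires) fun _ => Bool) := by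
  ext x y
  simp only [ElementaryGate.op, Matrix.of_apply, Matrix.submatrix_apply, Matrix.kronecker,
    Matrix.kroneckerMap_apply, Matrix.one_apply, Equiv.piEquivPiSubtypeProd_apply]
  by_cases h : ∀ w, w ∉ g.wires → x w = y w
  · rw [if_pos h, if_pos (by ext w; exact h w w.2), mul_one]
  · rw [if_neg h, if_neg, mul_zero]
    intro e
    exact h fun w hw => congrFun e ⟨w, hw⟩

/-- The inverse of an elementary gate. -/
def ElementaryGate.inv {ω : Type} [DecidableEq ω] (g : ElementaryGate ω) : ElementaryGate ω where
  wires := g.wires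
  card_le := g.card_le
  mat := g.matᴴ
  mat_mem := by simpa using g.mat_mem.symm

theorem ElementaryGate.op_inv {ω : Type} [Fintype ω] [DecidableEq ω] (g : ElementaryGate ω) :
    g.inv.op = g.opᴴ := by
  ext x y
  rw [Matrix.conjTranspose_apply]
  by_cases h : ∀ w, w ∉ g.wires → x w = y w
  · exact (if_pos h).trans (congrArg star (if_pos fun w hw => (h w hw).symm).symm)
  · exact (if_neg h).trans ((star_zero ℂ).symm.trans
      (congrArg star (if_neg fun h' => h fun w hw => (h' w hw).symm).symm))

theorem ElementaryGate.conjTranspose_op_mul {ω : Type} [Fintype ω] [DecidableEq ω]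
    (g : ElementaryGate ω) : g.opᴴ * g.op = 1 := by
  rw [g.op_eq, Matrix.conjTranspose_submatrix, Matrix.submatrix_mul_equiv, Matrix.kronecker,
    Matrix.conjTranspose_kronecker, ← Matrix.mul_kronecker_mul, g.mat_mem.2,
    Matrix.conjTranspose_one, Matrix.mul_one, Matrix.one_kronecker_one, Matrix.submatrix_one_equiv]

/-- An operator on the system qubits as an operator on all wires. -/
def sysOp {N t a : ℕ} (M : Matrix (Fin N → Bool) (Fin N → Bool) ℂ) :
    Matrix (Wire N t a → Bool) (Wire N t a → Bool) ℂ :=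
  Matrix.of fun x y => if x ∘ Sum.inr = y ∘ Sum.inr then M (x ∘ Sum.inl) (y ∘ Sum.inl) else 0

theorem sysOp_eq {N t a : ℕ} (M : Matrix (Fin N → Bool) (Fin N → Bool) ℂ) :
    (sysOp M : Matrix (Wire N t a → Bool) (Wire N t a → Bool) ℂ) = (Matrix.kronecker M
      (1 : Matrix (Fin t ⊕ Fin a → Bool) (Fin t ⊕ Fin a → Bool) ℂ)).submatrix
      (Equiv.sumArrowEquivProdArrow _ _ _) (Equiv.sumArrowEquivProdArrow _ _ _) := by
  ext x y
  simp only [sysOp, Matrix.of_apply, Matrix.submatrix_apply, Matrix.kronecker,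
    Matrix.kroneckerMap_apply, Matrix.one_apply]
  by_cases h : x ∘ Sum.inr = y ∘ Sum.inr
  · rw [if_pos h, if_pos (by exact h), mul_one]; rfl
  · rw [if_neg h, if_neg (by exact h), mul_zero]

theorem sysOp_mul {N t a : ℕ} (M M' : Matrix (Fin N → Bool) (Fin N → Bool) ℂ) :
    (sysOp (M * M') : Matrix (Wire N t a → Bool) (Wire N t a → Bool) ℂ) = sysOp M * sysOp M' := by
  rw [sysOp_eq, sysOp_eq, sysOp_eq, Matrix.submatrix_mul_equiv, Matrix.kronecker,
    ← Matrix.mul_kronecker_mul, Matrix.mul_one]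

theorem sysOp_one {N t a : ℕ} :
    (sysOp 1 : Matrix (Wire N t a → Bool) (Wire N t a → Bool) ℂ) = 1 := by
  rw [sysOp_eq, Matrix.kronecker, Matrix.one_kronecker_one, Matrix.submatrix_one_equiv]

theorem sysOp_conjTranspose {N t a : ℕ} (M : Matrix (Fin N → Bool) (Fin N → Bool) ℂ) :
    (sysOp Mᴴ : Matrix (Wire N t a → Bool) (Wire N t a → Bool) ℂ) = (sysOp M)ᴴ := by
  rw [sysOp_eq, sysOp_eq, Matrix.conjTranspose_submatrix, Matrix.kronecker,
    Matrix.conjTranspose_kronecker, Matrix.conjTranspose_one]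

theorem sysOp_mulVec {N t a : ℕ} (M : Matrix (Fin N → Bool) (Fin N → Bool) ℂ)
    (ψ : (Wire N t a → Bool) → ℂ) (x : Wire N t a → Bool) :
    (sysOp M *ᵥ ψ) x = (M *ᵥ fun s => ψ (Sum.elim s (x ∘ Sum.inr))) (x ∘ Sum.inl) := by
  rw [Matrix.mulVec, Matrix.mulVec, dotProduct, dotProduct]
  symm
  refine Finset.sum_of_injOn (fun s => Sum.elim s (x ∘ Sum.inr)) ?_ ?_ ?_ ?_
  · intro s _ s' _ h
    funext i
    exact congrFun h (Sum.inl i)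
  · intro s _; simp
  · intro y _ hy
    have : ¬ x ∘ Sum.inr = y ∘ Sum.inr := by
      intro e
      apply hy
      refine ⟨y ∘ Sum.inl, by simp, ?_⟩
      dsimp only
      rw [e]
      exact Sum.elim_comp_inl_inr y
    simp [sysOp, this]
  · intro s _
    have : x ∘ Sum.inr = Sum.elim s (x ∘ Sum.inr) ∘ Sum.inr := by
      funext i; rfl
    simp only [sysOp, Matrix.of_apply]
    rw [if_pos this]
    rfl

/-! ### Programs as operators -/

/-- The operator of an instruction. -/
def Instruction.op {N t a : ℕ} (G : GivensCircuit N) :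
    Instruction N t a → Matrix (Wire N t a → Bool) (Wire N t a → Bool) ℂ
  | .elementary g => g.op
  | .givens => sysOp (GivensCircuit.fbsOp G)
  | .givensInverse => sysOp (GivensCircuit.fbsOp G)ᴴ

theorem prod_map_fbs_op {N t a : ℕ} (G : GivensCircuit N) :
    ((G.map Gate.fbs).map (Gate.op (t := t) (a := a))).prod = sysOp (GivensCircuit.fbsOp G) := by
  induction G with
  | nil => simp [GivensCircuit.fbsOp, sysOp_one]
  | cons g G ih =>
    have e1 : GivensCircuit.fbsOp (g :: G) = g.fbs * GivensCircuit.fbsOp G := by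
      simp [GivensCircuit.fbsOp]
    rw [List.map_cons, List.map_cons, List.prod_cons, ih, e1, sysOp_mul]
    rfl

theorem Instruction.prod_gates {N t a : ℕ} (G : GivensCircuit N) (i : Instruction N t a) :
    ((i.gates G).map Gate.op).prod = i.op G := by
  cases i with
  | elementary g => simp [Instruction.gates, Instruction.op, Gate.op]
  | givens => exact prod_map_fbs_op G
  | givensInverse =>
    rw [Instruction.op, ← fbsOp_inverse]
    exact prod_map_fbs_op _

@[simp] theorem Program.op_nil {N t a : ℕ} (G : GivensCircuit N) :
    Program.op ([] : Program N t a) G = 1 := by simp [Program.op, Program.circuit]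

theorem Program.op_cons {N t a : ℕ} (G : GivensCircuit N) (i : Instruction N t a)
    (P : Program N t a) : Program.op (i :: P) G = i.op G * Program.op P G := by
  simp only [Program.op, Program.circuit, List.flatMap_cons, List.map_append, List.prod_append,
    Instruction.prod_gates]

theorem Program.op_append {N t a : ℕ} (G : GivensCircuit N) (P Q : Program N t a) :
    Program.op (P ++ Q) G = Program.op P G * Program.op Q G := by
  simp only [Program.op, Program.circuit, List.flatMap_append, List.map_append, List.prod_append]

@[simp] theorem Program.op_singleton {N t a : ℕ} (G : GivensCircuit N) (i : Instruction N t a) :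
    Program.op [i] G = i.op G := by
  rw [Program.op_cons, Program.op_nil, Matrix.mul_one]

/-- The inverse of an instruction. -/
def Instruction.inv {N t a : ℕ} : Instruction N t a → Instruction N t a
  | .elementary g => .elementary g.inv
  | .givens => .givensInverse
  | .givensInverse => .givens

/-- The inverse of a program. -/
def Program.inv {N t a : ℕ} (P : Program N t a) : Program N t a :=
  (P.map Instruction.inv).reverse

theorem Instruction.op_inv {N t a : ℕ} (G : GivensCircuit N) (i : Instruction N t a) :
    i.inv.op G = (i.op G)ᴴ := by
  cases i with
  | elementary g => exact g.op_inv
  | givens => exact sysOp_conjTranspose _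
  | givensInverse =>
    simp only [Instruction.inv, Instruction.op, ← sysOp_conjTranspose,
      Matrix.conjTranspose_conjTranspose]

theorem Instruction.conjTranspose_op_mul {N t a : ℕ} (G : GivensCircuit N)
    (i : Instruction N t a) : (i.op G)ᴴ * i.op G = 1 := by
  have h := conjTranspose_fbsOp_mul G
  cases i with
  | elementary g => exact g.conjTranspose_op_mul
  | givens => rw [Instruction.op, ← sysOp_conjTranspose, ← sysOp_mul, h, sysOp_one]
  | givensInverse =>
    rw [Instruction.op, ← sysOp_conjTranspose, ← sysOp_mul, Matrix.conjTranspose_conjTranspose,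
      mul_eq_one_comm.1 h, sysOp_one]

theorem Program.op_inv {N t a : ℕ} (G : GivensCircuit N) (P : Program N t a) :
    Program.op (Program.inv P) G = (Program.op P G)ᴴ := by
  induction P with
  | nil => simp [Program.inv]
  | cons i P ih =>
    rw [Program.op_cons, Matrix.conjTranspose_mul, ← ih, ← Instruction.op_inv,
      ← Program.op_singleton, ← Program.op_append, Program.inv, List.map_cons, List.reverse_cons]
    rfl

theorem Program.conjTranspose_op_mul {N t a : ℕ} (G : GivensCircuit N) (P : Program N t a) :
    (Program.op P G)ᴴ * Program.op P G = 1 := by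
  induction P with
  | nil => simp
  | cons i P ih =>
    rw [Program.op_cons, Matrix.conjTranspose_mul, Matrix.mul_assoc,
      ← Matrix.mul_assoc _ (i.op G), Instruction.conjTranspose_op_mul, Matrix.one_mul, ih]

/-! ### Costs -/

theorem Program.cost_append {N t a : ℕ} (G : GivensCircuit N) (P Q : Program N t a) :
    Program.cost (P ++ Q) G = Program.cost P G + Program.cost Q G := by
  simp [Program.cost, Program.circuit]

theorem Program.cost_cons {N t a : ℕ} (G : GivensCircuit N) (i : Instruction N t a)
    (P : Program N t a) :
    Program.cost (i :: P) G = (i.gates G).length + Program.cost P G := by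
  simp [Program.cost, Program.circuit]

theorem Program.cost_map_elementary {N t a : ℕ} {ι : Type*} (G : GivensCircuit N) (L : List ι)
    (f : ι → ElementaryGate (Wire N t a)) :
    Program.cost (L.map fun i => Instruction.elementary (f i)) G = L.length := by
  induction L with
  | nil => simp [Program.cost, Program.circuit]
  | cons i L ih =>
    rw [List.map_cons, Program.cost_cons, ih]
    simp [Instruction.gates, add_comm]

theorem Program.cost_inv {N t a : ℕ} (G : GivensCircuit N) (P : Program N t a) :
    Program.cost (Program.inv P) G = Program.cost P G := by
  have h : ∀ i : Instruction N t a, (i.inv.gates G).length = (i.gates G).length := by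
    intro i
    cases i <;> simp [Instruction.inv, Instruction.gates, GivensCircuit.inverse]
  induction P with
  | nil => rfl
  | cons i P ih =>
    have : Program.inv (i :: P) = Program.inv P ++ [i.inv] := by
      rw [Program.inv, List.map_cons, List.reverse_cons]; rfl
    rw [this, Program.cost_append, ih, Program.cost_cons, Program.cost_cons, h]
    simp [Program.cost, Program.circuit, add_comm]

/-! ### Elementary gates -/

/-- A diagonal gate on two wires. -/
def phaseGate {ω : Type} [DecidableEq ω] (u v : ω) (d : Bool → Bool → ℂ)
    (hd : ∀ p q, ‖d p q‖ = 1) : ElementaryGate ω where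
  wires := {u, v}
  card_le := Finset.card_le_two.trans (by norm_num)
  mat := Matrix.diagonal fun c => d (c ⟨u, by simp⟩) (c ⟨v, by simp⟩)
  mat_mem := by
    have h : ∀ z : ℂ, ‖z‖ = 1 → star z * z = 1 ∧ z * star z = 1 := fun z hz => by
      have : star z * z = 1 := by
        rw [Complex.star_def, mul_comm, Complex.mul_conj, Complex.normSq_eq_norm_sq, hz]; simp
      exact ⟨this, by rw [mul_comm]; exact this⟩
    constructor <;>
      rw [Matrix.diagonal_conjTranspose, Matrix.diagonal_mul_diagonal, ← Matrix.diagonal_one] <;>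
      congr 1 <;> ext c <;> rw [Pi.star_apply]
    · exact (h _ (hd _ _)).2
    · exact (h _ (hd _ _)).1

theorem phaseGate_mulVec {ω : Type} [Fintype ω] [DecidableEq ω] (u v : ω) (d : Bool → Bool → ℂ)
    (hd : ∀ p q, ‖d p q‖ = 1) (ψ : (ω → Bool) → ℂ) (x : ω → Bool) :
    ((phaseGate u v d hd).op *ᵥ ψ) x = d (x u) (x v) * ψ x := by
  rw [Matrix.mulVec, dotProduct, Finset.sum_eq_single x]
  · simp [ElementaryGate.op, phaseGate]
  · intro y _ hy
    simp only [ElementaryGate.op, Matrix.of_apply]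
    split_ifs with h
    · have hne : (fun w : (phaseGate u v d hd).wires => x w) ≠ fun w : (phaseGate u v d hd).wires => y w := by
        intro e
        apply hy
        funext w
        by_cases hw : w ∈ (phaseGate u v d hd).wires
        · exact (congrFun e ⟨w, hw⟩).symm
        · exact (h w hw).symm
      have : (phaseGate u v d hd).mat (fun w => x w) (fun w => y w) = 0 :=
        Matrix.diagonal_apply_ne _ hne
      rw [this, zero_mul]
    · rw [zero_mul]
  · simp

/-- The data of a gate that adds a Boolean function of two wires to a third one. -/
structure Xor (ω : Type) where
  tgt : ω
  src₁ : ω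
  src₂ : ω
  ne₁ : src₁ ≠ tgt
  ne₂ : src₂ ≠ tgt
  f : Bool → Bool → Bool

/-- The action of a `Xor` gate on bit strings. -/
def Xor.step {ω : Type} [DecidableEq ω] (g : Xor ω) (x : ω → Bool) : ω → Bool :=
  Function.update x g.tgt (xor (x g.tgt) (g.f (x g.src₁) (x g.src₂)))

theorem Xor.step_step {ω : Type} [DecidableEq ω] (g : Xor ω) (x : ω → Bool) :
    g.step (g.step x) = x := by
  funext w
  by_cases hw : w = g.tgt
  · subst hw
    simp [Xor.step, Function.update_of_ne g.ne₁, Function.update_of_ne g.ne₂]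
  · simp [Xor.step, Function.update_of_ne hw]

/-- A `Xor` gate as an elementary gate. -/
def Xor.gate {ω : Type} [DecidableEq ω] (g : Xor ω) : ElementaryGate ω where
  wires := {g.tgt, g.src₁, g.src₂}
  card_le := Finset.card_le_three
  mat := Matrix.of fun x y => if y = Xor.step ⟨⟨g.tgt, by simp⟩, ⟨g.src₁, by simp⟩,
    ⟨g.src₂, by simp⟩, fun e => g.ne₁ (congrArg Subtype.val e),
    fun e => g.ne₂ (congrArg Subtype.val e), g.f⟩ x then 1 else 0
  mat_mem := by
    rw [mul_eq_one_comm, and_self]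
    ext x y
    have hinv : ∀ (h : Xor ({g.tgt, g.src₁, g.src₂} : Finset ω)) z z', z = h.step z' ↔ h.step z = z' :=
      fun h z z' => ⟨fun e => by rw [e, h.step_step], fun e => by rw [← e, h.step_step]⟩
    simp only [Matrix.mul_apply, Matrix.conjTranspose_apply, Matrix.of_apply, apply_ite star,
      star_one, star_zero, Matrix.one_apply]
    simp only [hinv, mul_ite, mul_one, mul_zero, Finset.sum_ite_eq, Finset.mem_univ, if_true]
    simp only [Xor.step_step]

/-- The step is an involution, so the amplitudes are pulled back along the step itself and no
inverse appears. -/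
theorem Xor.gate_mulVec {ω : Type} [Fintype ω] [DecidableEq ω] (g : Xor ω) (ψ : (ω → Bool) → ℂ)
    (x : ω → Bool) : (g.gate.op *ᵥ ψ) x = ψ (g.step x) := by
  have hr : ∀ y : ω → Bool, ((∀ w, w ∉ g.gate.wires → x w = y w) ∧
      (fun w : g.gate.wires => y w) = Xor.step ⟨⟨g.tgt, by simp [Xor.gate]⟩,
        ⟨g.src₁, by simp [Xor.gate]⟩, ⟨g.src₂, by simp [Xor.gate]⟩,
        fun e => g.ne₁ (congrArg Subtype.val e), fun e => g.ne₂ (congrArg Subtype.val e), g.f⟩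
        (fun w : g.gate.wires => x w)) ↔ y = g.step x := by
    intro y
    constructor
    · rintro ⟨h1, h2⟩
      funext w
      by_cases hw : w ∈ g.gate.wires
      · have := congrFun h2 ⟨w, hw⟩
        dsimp only at this
        rw [this]
        simp only [Xor.step, Function.update_apply]
        exact if_congr Subtype.ext_iff rfl rfl
      · rw [← h1 w hw, Xor.step, Function.update_of_ne]
        rintro rfl
        exact hw (by simp [Xor.gate])
    · rintro rfl
      constructor
      · intro w hw
        rw [Xor.step, Function.update_of_ne]
        rintro rfl
        exact hw (by simp [Xor.gate])
      · funext w
        simp only [Xor.step, Function.update_apply, Subtype.ext_iff]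
  rw [Matrix.mulVec, dotProduct, Finset.sum_eq_single (g.step x)]
  · have h := (hr (g.step x)).2 rfl
    simp only [ElementaryGate.op, Matrix.of_apply]
    rw [if_pos h.1]
    have : g.gate.mat (fun w => x w) (fun w => g.step x w) = 1 := if_pos h.2
    rw [this, one_mul]
  · intro y _ hy
    simp only [ElementaryGate.op, Matrix.of_apply]
    split_ifs with h
    · have : g.gate.mat (fun w => x w) (fun w => y w) = 0 :=
        if_neg fun e => hy ((hr y).1 ⟨h, e⟩)
      rw [this, zero_mul]
    · rw [zero_mul]
  · simp

/-- The matrix of the Hadamard gate. -/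
def hadamardMatrix : Matrix Bool Bool ℂ :=
  Matrix.of fun p q => (if p = true ∧ q = true then -1 else 1) / (Real.sqrt 2 : ℂ)

theorem hadamardMatrix_mul : hadamardMatrix * hadamardMatrixᴴ = 1 := by
  have h2 : (Real.sqrt 2 : ℂ) * Real.sqrt 2 = 2 := by
    exact_mod_cast Real.mul_self_sqrt (by norm_num : (0 : ℝ) ≤ 2)
  have h0 : (Real.sqrt 2 : ℂ) ≠ 0 := by
    intro e; rw [e] at h2; norm_num at h2
  ext p q
  rw [Matrix.mul_apply, Fintype.sum_bool]
  simp only [hadamardMatrix, Matrix.conjTranspose_apply, Matrix.of_apply, star_div₀,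
    Complex.star_def, Complex.conj_ofReal]
  cases p <;> cases q <;> simp <;> field_simp <;> first | ring1 | linear_combination -h2

/-- The Hadamard gate. -/
def hadamard {ω : Type} [DecidableEq ω] (w : ω) : ElementaryGate ω where
  wires := {w}
  card_le := by simp
  mat := hadamardMatrix.submatrix (fun c => c ⟨w, by simp⟩) (fun c => c ⟨w, by simp⟩)
  mat_mem := by
    rw [mul_eq_one_comm, and_self, mul_eq_one_comm]
    let e : (({w} : Finset ω) → Bool) ≃ Bool :=
      { toFun := fun c => c ⟨w, by simp⟩
        invFun := fun b _ => b
        left_inv := fun c => by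
          funext i
          exact congrArg c (Subtype.ext (Finset.mem_singleton.1 i.2).symm)
        right_inv := fun b => rfl }
    change hadamardMatrix.submatrix e e * (hadamardMatrix.submatrix e e)ᴴ = 1
    rw [Matrix.conjTranspose_submatrix, Matrix.submatrix_mul_equiv, hadamardMatrix_mul,
      Matrix.submatrix_one_equiv]

theorem hadamard_mulVec {ω : Type} [Fintype ω] [DecidableEq ω] (w : ω) (ψ : (ω → Bool) → ℂ)
    (x : ω → Bool) : ((hadamard w).op *ᵥ ψ) x = (ψ (Function.update x w false) +
      (if x w = true then -1 else 1) * ψ (Function.update x w true)) / (Real.sqrt 2 : ℂ) := by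
  have hne : Function.update x w false ≠ Function.update x w true := fun e => by
    have := congrFun e w
    simp at this
  have hent : ∀ b, (hadamard w).op x (Function.update x w b)
      = (if x w = true ∧ b = true then -1 else 1) / (Real.sqrt 2 : ℂ) := by
    intro b
    simp only [ElementaryGate.op, Matrix.of_apply]
    rw [if_pos]
    · simp [hadamard, hadamardMatrix]
    · intro v hv
      rw [Function.update_of_ne]
      rintro rfl
      exact hv (by simp [hadamard])
  rw [Matrix.mulVec, dotProduct, ← Finset.sum_subset (Finset.subset_univ
    {Function.update x w false, Function.update x w true})]
  · rw [Finset.sum_pair hne, hent, hent]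
    simp only [Bool.false_eq_true, and_false, if_false, and_true]
    ring
  · intro y _ hy
    simp only [ElementaryGate.op, Matrix.of_apply]
    rw [if_neg, zero_mul]
    intro h
    apply hy
    have : y = Function.update x w (y w) := by
      funext v
      by_cases hv : v = w
      · subst hv; simp
      · rw [Function.update_of_ne hv, h v (by simpa [hadamard] using hv)]
    rw [this]
    cases y w <;> simp

/-! ### Lists of `Xor` gates -/

/-- The action of a list of `Xor` gates on bit strings; the first gate acts first. -/
def runXor {ω : Type} [DecidableEq ω] (L : List (Xor ω)) (x : ω → Bool) : ω → Bool :=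
  L.foldl (fun x g => g.step x) x

theorem runXor_append {ω : Type} [DecidableEq ω] (L L' : List (Xor ω)) (x : ω → Bool) :
    runXor (L ++ L') x = runXor L' (runXor L x) := by simp [runXor]

theorem runXor_reverse {ω : Type} [DecidableEq ω] (L : List (Xor ω)) (x : ω → Bool) :
    runXor L.reverse (runXor L x) = x := by
  induction L generalizing x with
  | nil => rfl
  | cons g L ih =>
    rw [List.reverse_cons, runXor_append]
    change g.step (runXor L.reverse (runXor L (g.step x))) = x
    rw [ih, g.step_step]

/-- The condition that the wires that a gate uses are not changed later. -/
def Xor.Before {ω : Type} (g h : Xor ω) : Prop :=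
  g.tgt ≠ h.tgt ∧ g.src₁ ≠ h.tgt ∧ g.src₂ ≠ h.tgt

theorem runXor_of_ne {ω : Type} [DecidableEq ω] {L : List (Xor ω)} {x : ω → Bool} {w : ω}
    (h : ∀ g ∈ L, w ≠ g.tgt) : runXor L x w = x w := by
  induction L generalizing x with
  | nil => rfl
  | cons g L ih =>
    change runXor L (g.step x) w = x w
    rw [ih fun h' hh => h h' (List.mem_cons_of_mem _ hh), Xor.step,
      Function.update_of_ne (h g List.mem_cons_self)]

/-- The final values satisfy the equations of the gates. -/
theorem runXor_tgt {ω : Type} [DecidableEq ω] {L : List (Xor ω)} (hL : L.Pairwise Xor.Before)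
    (x : ω → Bool) {g : Xor ω} (hg : g ∈ L) :
    runXor L x g.tgt = xor (x g.tgt) (g.f (runXor L x g.src₁) (runXor L x g.src₂)) := by
  induction L generalizing x with
  | nil => simp at hg
  | cons h L ih =>
    rw [List.pairwise_cons] at hL
    change runXor L (h.step x) g.tgt
      = xor (x g.tgt) (g.f (runXor L (h.step x) g.src₁) (runXor L (h.step x) g.src₂))
    rcases List.mem_cons.1 hg with rfl | hg
    · rw [runXor_of_ne fun g' hg' => (hL.1 g' hg').1, runXor_of_ne fun g' hg' => (hL.1 g' hg').2.1,
        runXor_of_ne fun g' hg' => (hL.1 g' hg').2.2]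
      simp [Xor.step, Function.update_of_ne g.ne₁, Function.update_of_ne g.ne₂]
    · rw [ih hL.2 _ hg]
      congr 1
      rw [Xor.step, Function.update_of_ne (hL.1 g hg).1.symm]

/-- A list of `Xor` gates as a program. -/
def xorProgram {N t a : ℕ} (L : List (Xor (Wire N t a))) : Program N t a :=
  L.map fun g => Instruction.elementary g.gate

/-- Pull-back reverses composition: the head of the list is the last operator to act on the state
but the first step applied to the string. -/
theorem xorProgram_mulVec {N t a : ℕ} (G : GivensCircuit N) (L : List (Xor (Wire N t a)))
    (ψ : (Wire N t a → Bool) → ℂ) (x : Wire N t a → Bool) :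
    (Program.op (xorProgram L) G *ᵥ ψ) x = ψ (runXor L x) := by
  induction L generalizing x with
  | nil => simp [xorProgram, runXor]
  | cons g L ih =>
    have : xorProgram (g :: L) = Instruction.elementary g.gate :: xorProgram L := rfl
    rw [this, Program.op_cons, ← Matrix.mulVec_mulVec]
    change (g.gate.op *ᵥ _) x = _
    rw [Xor.gate_mulVec, ih]
    rfl

end SubspaceSVE

end

noncomputable section

namespace SubspaceSVE

/-! ### The wires of the algorithm -/

/-- The work qubits: the phase register, the chain that computes a disjunction, the folded phase
and the carries. -/
abbrev Aux (N T : ℕ) := Fin T ⊕ (Fin (N + 1) ⊕ (Fin T ⊕ Fin (T + 1)))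

section Wires

variable {N t T a : ℕ} (e : Aux N T ≃ Fin a)

/-- A qubit of the phase register. -/
def phaseWire (l : Fin T) : Wire N t a := Sum.inr (Sum.inr (e (Sum.inl l)))

/-- A work qubit outside the phase register. -/
def ancWire (k : Fin (N + 1) ⊕ (Fin T ⊕ Fin (T + 1))) : Wire N t a :=
  Sum.inr (Sum.inr (e (Sum.inr k)))

theorem phaseWire_inj {l l' : Fin T} : (phaseWire e l : Wire N t a) = phaseWire e l' ↔ l = l' := by
  simp [phaseWire]

theorem ancWire_inj {k k' : Fin (N + 1) ⊕ (Fin T ⊕ Fin (T + 1))} :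
    (ancWire e k : Wire N t a) = ancWire e k' ↔ k = k' := by
  simp [ancWire]

theorem phaseWire_ne_ancWire (l : Fin T) (k : Fin (N + 1) ⊕ (Fin T ⊕ Fin (T + 1))) :
    (phaseWire e l : Wire N t a) ≠ ancWire e k := by
  simp [phaseWire, ancWire]

theorem inl_ne_phaseWire (i : Fin N) (l : Fin T) : (Sum.inl i : Wire N t a) ≠ phaseWire e l := by
  simp [phaseWire]

theorem inl_ne_ancWire (i : Fin N) (k : Fin (N + 1) ⊕ (Fin T ⊕ Fin (T + 1))) :
    (Sum.inl i : Wire N t a) ≠ ancWire e k := by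
  simp [ancWire]

theorem out_ne_phaseWire (i : Fin t) (l : Fin T) :
    (Sum.inr (Sum.inl i) : Wire N t a) ≠ phaseWire e l := by
  simp [phaseWire]

theorem out_ne_ancWire (i : Fin t) (k : Fin (N + 1) ⊕ (Fin T ⊕ Fin (T + 1))) :
    (Sum.inr (Sum.inl i) : Wire N t a) ≠ ancWire e k := by
  simp [ancWire]

/-- A family of system states, indexed by the contents of the phase register and of the output
register, as a state of all wires; the other wires are `0`. -/
def emb (Φ : (Fin T → Bool) → (Fin t → Bool) → (Fin N → Bool) → ℂ) : (Wire N t a → Bool) → ℂ :=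
  fun x => if ∀ k, x (ancWire e k) = false then
    Φ (fun l => x (phaseWire e l)) (fun i => x (Sum.inr (Sum.inl i))) (fun i => x (Sum.inl i))
  else 0

theorem emb_update (Φ : (Fin T → Bool) → (Fin t → Bool) → (Fin N → Bool) → ℂ)
    (x : Wire N t a → Bool) (l : Fin T) (p : Bool) :
    emb e Φ (Function.update x (phaseWire e l) p)
      = emb e (fun y => Φ (Function.update y l p)) x := by
  have h1 : ∀ k, Function.update x (phaseWire e l) p (ancWire e k) = x (ancWire e k) := fun k =>
    Function.update_of_ne (phaseWire_ne_ancWire e l k).symm _ _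
  have h2 : ∀ i, Function.update x (phaseWire e l) p (Sum.inl i) = x (Sum.inl i) := fun i =>
    Function.update_of_ne (inl_ne_phaseWire e i l) _ _
  have h3 : ∀ i, Function.update x (phaseWire e l) p (Sum.inr (Sum.inl i))
      = x (Sum.inr (Sum.inl i)) := fun i =>
    Function.update_of_ne (out_ne_phaseWire e i l) _ _
  have h4 : (fun l' => Function.update x (phaseWire e l) p (phaseWire e l'))
      = Function.update (fun l' => x (phaseWire e l')) l p := by
    funext l'
    simp only [Function.update_apply, phaseWire_inj]
  simp only [emb, h1, h2, h3, h4]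

theorem hadamard_mulVec_emb (Φ : (Fin T → Bool) → (Fin t → Bool) → (Fin N → Bool) → ℂ)
    (l : Fin T) : (hadamard (phaseWire e l : Wire N t a)).op *ᵥ emb e Φ
      = emb e fun y b => (Real.sqrt 2 : ℂ)⁻¹ • (Φ (Function.update y l false) b +
        (if y l = true then -1 else 1 : ℂ) • Φ (Function.update y l true) b) := by
  ext x
  rw [hadamard_mulVec, emb_update, emb_update]
  simp only [emb]
  split_ifs
  · simp only [Pi.smul_apply, Pi.add_apply, smul_eq_mul]; ring
  · simp only [Pi.smul_apply, Pi.add_apply, smul_eq_mul]; ring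
  · simp
  · simp

theorem phaseGate_mulVec_emb (Φ : (Fin T → Bool) → (Fin t → Bool) → (Fin N → Bool) → ℂ)
    (i l : Fin T) (d : Bool → Bool → ℂ) (hd : ∀ p q, ‖d p q‖ = 1) :
    (phaseGate (phaseWire e i : Wire N t a) (phaseWire e l) d hd).op *ᵥ emb e Φ
      = emb e fun y b => d (y i) (y l) • Φ y b := by
  ext x
  rw [phaseGate_mulVec]
  simp only [emb]
  split_ifs <;> simp

theorem sysOp_mulVec_emb (Φ : (Fin T → Bool) → (Fin t → Bool) → (Fin N → Bool) → ℂ)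
    (M : Matrix (Fin N → Bool) (Fin N → Bool) ℂ) :
    (sysOp M : Matrix (Wire N t a → Bool) (Wire N t a → Bool) ℂ) *ᵥ emb e Φ
      = emb e fun y b => M *ᵥ Φ y b := by
  ext x
  rw [sysOp_mulVec]
  by_cases h : ∀ k, x (ancWire e k) = false
  · have : (fun s => emb e Φ (Sum.elim s (x ∘ Sum.inr)))
        = Φ (fun l => x (phaseWire e l)) (fun i => x (Sum.inr (Sum.inl i))) := by
      funext s
      rw [emb, if_pos (by exact h)]
      rfl
    rw [this, emb, if_pos h]
    rfl
  · have : (fun s => emb e Φ (Sum.elim s (x ∘ Sum.inr))) = 0 := by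
      funext s
      rw [emb, if_neg (by exact h)]
      rfl
    rw [this, Matrix.mulVec_zero, emb, if_neg h]
    rfl

/-! ### Controlled reflections -/

/-- The gates that compute whether some qubit outside the range of `J` is `1`. -/
def orGates {n : ℕ} (J : Fin n ↪o Fin N) : List (Xor (Wire N t a)) :=
  open scoped Classical in
  (List.finRange N).map fun i =>
    { tgt := ancWire e (Sum.inl i.succ)
      src₁ := Sum.inl i
      src₂ := ancWire e (Sum.inl i.castSucc)
      ne₁ := inl_ne_ancWire e _ _
      ne₂ := by rw [Ne, ancWire_inj]; simp [Fin.ext_iff]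
      f := fun p q => if ∃ j, J j = i then q else p || q }

theorem orGates_pairwise {n : ℕ} (J : Fin n ↪o Fin N) :
    (orGates e J : List (Xor (Wire N t a))).Pairwise Xor.Before := by
  rw [orGates, List.pairwise_map]
  refine (List.pairwise_lt_finRange N).imp fun {i j} hij => ⟨?_, ?_, ?_⟩
  · simp only [Ne, ancWire_inj]
    simpa using hij.ne
  · exact inl_ne_ancWire e _ _
  · simp only [Ne, ancWire_inj, Sum.inl.injEq, Fin.ext_iff, Fin.val_castSucc, Fin.val_succ]
    have : (i : ℕ) < j := hij
    omega

/-- The chain accumulates the disjunction of prefixes. No gate changes a wire used earlier, so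
`runXor_tgt` reads off the recursion from the final string. -/
theorem runXor_orGates {n : ℕ} (J : Fin n ↪o Fin N) {x : Wire N t a → Bool}
    (hx : ∀ k, x (ancWire e k) = false) (k : Fin (N + 1)) :
    runXor (orGates e J) x (ancWire e (Sum.inl k)) = true ↔
      ∃ i : Fin N, (i : ℕ) < k ∧ (¬ ∃ j, J j = i) ∧ x (Sum.inl i) = true := by
  classical
  induction k using Fin.induction with
  | zero =>
    rw [runXor_of_ne, hx]
    · simp
    · intro g hg
      obtain ⟨i, _, rfl⟩ := List.mem_map.1 hg
      simp only [Ne, ancWire_inj, Sum.inl.injEq]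
      exact (Fin.succ_ne_zero i).symm
  | succ i ih =>
    have hmem := List.mem_map_of_mem (f := fun i : Fin N => ({
      tgt := ancWire e (Sum.inl i.succ)
      src₁ := Sum.inl i
      src₂ := ancWire e (Sum.inl i.castSucc)
      ne₁ := inl_ne_ancWire e _ _
      ne₂ := by rw [Ne, ancWire_inj]; simp [Fin.ext_iff]
      f := fun p q => if ∃ j, J j = i then q else p || q } : Xor (Wire N t a)))
      (List.mem_finRange i)
    have h := runXor_tgt (orGates_pairwise e J) x
      (g := ⟨ancWire e (Sum.inl i.succ), Sum.inl i, ancWire e (Sum.inl i.castSucc),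
        inl_ne_ancWire e _ _, by rw [Ne, ancWire_inj]; simp [Fin.ext_iff],
        fun p q => if ∃ j, J j = i then q else p || q⟩)
      (by rw [orGates]; convert hmem)
    have hsys : runXor (orGates e J) x (Sum.inl i) = x (Sum.inl i) := by
      apply runXor_of_ne
      intro g hg
      obtain ⟨j, _, rfl⟩ := List.mem_map.1 hg
      exact inl_ne_ancWire e _ _
    simp only [hx, hsys, Bool.false_xor] at h
    rw [h]
    have hsplit : (∃ i' : Fin N, (i' : ℕ) < (i.succ : Fin (N + 1)) ∧ (¬ ∃ j, J j = i') ∧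
        x (Sum.inl i') = true) ↔ ((¬ ∃ j, J j = i) ∧ x (Sum.inl i) = true) ∨
        ∃ i' : Fin N, (i' : ℕ) < (i.castSucc : Fin (N + 1)) ∧ (¬ ∃ j, J j = i') ∧
        x (Sum.inl i') = true := by
      constructor
      · rintro ⟨i', h1, h2⟩
        by_cases hi : i' = i
        · subst hi; exact Or.inl h2
        · refine Or.inr ⟨i', ?_, h2⟩
          have : (i' : ℕ) ≠ i := fun h => hi (Fin.ext h)
          rw [Fin.val_succ] at h1
          rw [Fin.val_castSucc]
          omega
      · rintro (h | ⟨i', h1, h2⟩)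
        · exact ⟨i, by simp, h⟩
        · exact ⟨i', by rw [Fin.val_castSucc] at h1; rw [Fin.val_succ]; omega, h2⟩
    rw [hsplit, ← ih]
    split_ifs with hJ
    · simp [hJ]
    · simp [hJ]

/-- The reflection about the strings that vanish outside the range of `J`, controlled by a qubit of
the phase register. -/
def reflProgram {n : ℕ} (J : Fin n ↪o Fin N) (l : Fin T) : Program N t a :=
  xorProgram (orGates e J) ++ (Instruction.elementary (phaseGate (phaseWire e l)
    (ancWire e (Sum.inl (Fin.last N))) (fun p q => if p = true ∧ q = true then -1 else 1)
    (fun p q => by split_ifs <;> simp)) :: xorProgram (orGates e J).reverse)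

/-- Compute the disjunction, apply a controlled sign, uncompute. The sign is `-1` exactly on the
complement of the projection, which is the reflection `2Π - 1`. -/
theorem reflProgram_mulVec_emb {n : ℕ} (G : GivensCircuit N) (J : Fin n ↪o Fin N) (l : Fin T)
    (Φ : (Fin T → Bool) → (Fin t → Bool) → (Fin N → Bool) → ℂ) :
    Program.op (reflProgram e J l : Program N t a) G *ᵥ emb e Φ
      = emb e fun y b => if y l = true then (2 • projMat J - 1) *ᵥ Φ y b else Φ y b := by
  ext x
  rw [reflProgram, Program.op_append, Program.op_cons, ← Matrix.mulVec_mulVec, xorProgram_mulVec,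
    ← Matrix.mulVec_mulVec, Instruction.op, phaseGate_mulVec, xorProgram_mulVec, runXor_reverse]
  by_cases hx : ∀ k, x (ancWire e k) = false
  · have hph : runXor (orGates e J) x (phaseWire e l) = x (phaseWire e l) := by
      apply runXor_of_ne
      intro g hg
      obtain ⟨i, _, rfl⟩ := List.mem_map.1 hg
      exact phaseWire_ne_ancWire e _ _
    have hor := runXor_orGates e J hx (Fin.last N)
    rw [hph, emb, emb, if_pos hx, if_pos hx]
    by_cases hl : x (phaseWire e l) = true
    · rw [if_pos hl, Matrix.sub_mulVec, two_smul, Matrix.add_mulVec, Matrix.one_mulVec,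
        projMat_mulVec]
      simp only [Pi.sub_apply, Pi.add_apply, proj]
      by_cases hz : ∀ i : Fin N, (¬ ∃ j, J j = i) → x (Sum.inl i) = false
      · rw [if_pos hz, if_neg]
        · ring
        · rintro ⟨_, h2⟩
          obtain ⟨i, _, h3, h4⟩ := hor.1 h2
          rw [hz i h3] at h4
          exact absurd h4 (by simp)
      · rw [if_neg hz, if_pos]
        · ring
        · refine ⟨hl, hor.2 ?_⟩
          push Not at hz
          obtain ⟨i, h3, h4⟩ := hz
          exact ⟨i, by simp, fun ⟨j, hj⟩ => h3 j hj, by simpa using h4⟩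
    · rw [if_neg hl, if_neg (fun h => hl h.1), one_mul]
  · simp only [emb, if_neg hx, mul_zero]

/-! ### The controlled walk -/

/-- One step of the walk, controlled by a qubit of the phase register. -/
def walkProgram {m n : ℕ} (I : Fin m ↪o Fin N) (J : Fin n ↪o Fin N) (l : Fin T) :
    Program N t a :=
  (Instruction.givensInverse :: reflProgram e I l) ++ (Instruction.givens :: reflProgram e J l)

/-- The walk operator on the system qubits. -/
def systemWalk {m n : ℕ} (G : GivensCircuit N) (I : Fin m ↪o Fin N) (J : Fin n ↪o Fin N) :
    Matrix (Fin N → Bool) (Fin N → Bool) ℂ :=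
  walk (projMat J) ((GivensCircuit.fbsOp G)ᴴ * projMat I * GivensCircuit.fbsOp G)

theorem systemWalk_eq {m n : ℕ} (G : GivensCircuit N) (I : Fin m ↪o Fin N) (J : Fin n ↪o Fin N) :
    systemWalk G I J = (GivensCircuit.fbsOp G)ᴴ * ((2 • projMat I - 1) *
      (GivensCircuit.fbsOp G * (2 • projMat J - 1))) := by
  rw [systemWalk, walk]
  simp only [← Matrix.mul_assoc]
  congr 1
  rw [Matrix.mul_sub, Matrix.sub_mul, Matrix.mul_one, conjTranspose_fbsOp_mul, two_smul, two_smul,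
    Matrix.mul_add, Matrix.add_mul]

/-- Only the reflections are controlled. If the control is `0`, the call of the circuit and that of
its inverse cancel, so no controlled Givens circuit is needed. -/
theorem walkProgram_mulVec_emb {m n : ℕ} (G : GivensCircuit N) (I : Fin m ↪o Fin N)
    (J : Fin n ↪o Fin N) (l : Fin T)
    (Φ : (Fin T → Bool) → (Fin t → Bool) → (Fin N → Bool) → ℂ) :
    Program.op (walkProgram e I J l : Program N t a) G *ᵥ emb e Φ
      = emb e fun y b => if y l = true then systemWalk G I J *ᵥ Φ y b else Φ y b := by
  rw [walkProgram, Program.op_append, Program.op_cons, Program.op_cons]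
  simp only [← Matrix.mulVec_mulVec]
  rw [reflProgram_mulVec_emb, Instruction.op, sysOp_mulVec_emb, reflProgram_mulVec_emb,
    Instruction.op, sysOp_mulVec_emb]
  congr 1
  funext y b
  split_ifs
  · rw [systemWalk_eq]
    simp only [Matrix.mulVec_mulVec]
  · rw [Matrix.mulVec_mulVec, conjTranspose_fbsOp_mul, Matrix.one_mulVec]

/-! ### Phase estimation -/

/-- The `k`-fold repetition of a program. -/
def Program.repeat (P : Program N t a) : ℕ → Program N t a
  | 0 => []
  | k + 1 => P ++ Program.repeat P k

/-- The phase corrections of the qubit `l` by the lower bits. -/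
def correctionProgram (l : Fin T) (L : List (Fin T)) : Program N t a :=
  L.map fun i => Instruction.elementary (phaseGate (phaseWire e i) (phaseWire e l)
    -- For `i ≥ l` the gate is the identity; this allows one uniform list over all bits.
    (fun p q => if (i < l ∧ p = true) ∧ q = true then
      Complex.exp (-(2 * Real.pi * Complex.I * (2 ^ (i : ℕ) / 2 ^ ((l : ℕ) + 1)))) else 1)
    (fun p q => by
      split_ifs
      · have := norm_exp_two_pi (-(2 ^ (i : ℕ) / 2 ^ ((l : ℕ) + 1)))
        push_cast at this
        rwa [mul_neg] at this
      · simp))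

/-- The part of phase estimation that determines the bit `l`. -/
def stageProgram {m n : ℕ} (I : Fin m ↪o Fin N) (J : Fin n ↪o Fin N) (l : Fin T) :
    Program N t a :=
  (Instruction.elementary (hadamard (phaseWire e l)) :: correctionProgram e l (List.finRange T)) ++
    (Program.repeat (walkProgram e I J l) (2 ^ (T - 1 - (l : ℕ))) ++
      [Instruction.elementary (hadamard (phaseWire e l))])

/-- The first `j` stages of phase estimation. -/
def estimationProgram {m n : ℕ} (I : Fin m ↪o Fin N) (J : Fin n ↪o Fin N) : ℕ → Program N t a
  | 0 => []
  | j + 1 => (if h : j < T then stageProgram e I J ⟨j, h⟩ else []) ++ estimationProgram I J j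

theorem correctionProgram_mulVec_emb (G : GivensCircuit N) (l : Fin T) (L : List (Fin T))
    (Φ : (Fin T → Bool) → (Fin t → Bool) → (Fin N → Bool) → ℂ) :
    Program.op (correctionProgram e l L : Program N t a) G *ᵥ emb e Φ
      = emb e fun y b => (L.map fun i => if (i < l ∧ y i = true) ∧ y l = true then
        Complex.exp (-(2 * Real.pi * Complex.I * (2 ^ (i : ℕ) / 2 ^ ((l : ℕ) + 1)))) else 1).prod •
          Φ y b := by
  induction L with
  | nil => simp [correctionProgram]
  | cons i L ih =>
    rw [correctionProgram, List.map_cons, Program.op_cons, ← Matrix.mulVec_mulVec]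
    rw [correctionProgram] at ih
    rw [ih, Instruction.op, phaseGate_mulVec_emb]
    congr 1
    funext y b
    rw [List.map_cons, List.prod_cons, smul_smul]

theorem repeat_walkProgram_mulVec_emb {m n : ℕ} (G : GivensCircuit N) (I : Fin m ↪o Fin N)
    (J : Fin n ↪o Fin N) (l : Fin T) (k : ℕ) {w : (Fin N → Bool) → ℂ} {lam : ℂ}
    (hw : systemWalk G I J *ᵥ w = lam • w) (A : (Fin T → Bool) → (Fin t → Bool) → ℂ) :
    Program.op (Program.repeat (walkProgram e I J l : Program N t a) k) G *ᵥ
      emb e (fun y b => A y b • w)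
      = emb e fun y b => ((if y l = true then lam ^ k else 1) * A y b) • w := by
  induction k with
  | zero => simp [Program.repeat]
  | succ k ih =>
    rw [Program.repeat, Program.op_append, ← Matrix.mulVec_mulVec, ih, walkProgram_mulVec_emb]
    congr 1
    funext y b
    split_ifs
    · rw [Matrix.mulVec_smul, hw, smul_smul]
      congr 1
      ring
    · rfl

/-- Phase kickback: on an eigenvector the controlled powers multiply the branch with bit `l` set by
a power of `lam`. The hypothesis `hA` says that the qubit `l` is still `0`, so the first Hadamard
gate creates both branches with equal amplitude. -/
theorem stageProgram_mulVec_emb {m n : ℕ} (G : GivensCircuit N) (I : Fin m ↪o Fin N)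
    (J : Fin n ↪o Fin N) (l : Fin T) {w : (Fin N → Bool) → ℂ} {lam : ℂ}
    (hw : systemWalk G I J *ᵥ w = lam • w) (A : (Fin T → Bool) → (Fin t → Bool) → ℂ)
    (hA : ∀ y b, y l = true → A y b = 0) :
    Program.op (stageProgram e I J l : Program N t a) G *ᵥ emb e (fun y b => A y b • w)
      = emb e fun y b => (ampFactor lam l y * A (Function.update y l false) b) • w := by
  have h2 : (Real.sqrt 2 : ℂ)⁻¹ * (Real.sqrt 2 : ℂ)⁻¹ = 1 / 2 := by
    rw [← mul_inv]
    have : (Real.sqrt 2 : ℂ) * Real.sqrt 2 = 2 := by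
      exact_mod_cast Real.mul_self_sqrt (by norm_num : (0 : ℝ) ≤ 2)
    rw [this]; norm_num
  have e1 : (hadamard (phaseWire e l : Wire N t a)).op *ᵥ emb e (fun y b => A y b • w)
      = emb e fun y b => ((Real.sqrt 2 : ℂ)⁻¹ * A (Function.update y l false) b) • w := by
    rw [hadamard_mulVec_emb]
    congr 1
    funext y b
    rw [hA (Function.update y l true) b (by simp)]
    simp [smul_smul]
  rw [stageProgram, Program.op_append, Program.op_cons, Program.op_append, Program.op_singleton]
  simp only [← Matrix.mulVec_mulVec]
  rw [Instruction.op, e1, repeat_walkProgram_mulVec_emb e G I J l _ hw,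
    correctionProgram_mulVec_emb, hadamard_mulVec_emb]
  congr 1
  funext y b
  have hprod : ∀ p : Bool, ((List.finRange T).map fun i =>
      if (i < l ∧ Function.update y l p i = true) ∧ Function.update y l p l = true then
        Complex.exp (-(2 * Real.pi * Complex.I * (2 ^ (i : ℕ) / 2 ^ ((l : ℕ) + 1)))) else 1).prod
      = if p = true then ∏ i : Fin T, if i < l ∧ y i = true then
        Complex.exp (-(2 * Real.pi * Complex.I * (2 ^ (i : ℕ) / 2 ^ ((l : ℕ) + 1)))) else 1
        else 1 := by
    intro p
    rw [← Fin.prod_univ_def]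
    split_ifs with hp
    · refine Finset.prod_congr rfl fun i _ => ?_
      by_cases hi : i < l
      · simp [hi, hi.ne, hp]
      · simp [hi]
    · apply Finset.prod_eq_one
      intro i _
      simp [hp]
  rw [hprod, hprod]
  simp only [Function.update_self, Function.update_idem, Bool.false_eq_true, if_false, if_true,
    one_mul, smul_smul, ← add_smul]
  congr 1
  rw [ampFactor]
  linear_combination (A (Function.update y l false) b * (1 + (if y l = true then -1 else 1) *
    ((∏ i : Fin T, if i < l ∧ y i = true then
        Complex.exp (-(2 * Real.pi * Complex.I * (2 ^ (i : ℕ) / 2 ^ ((l : ℕ) + 1)))) else 1) *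
      lam ^ 2 ^ (T - 1 - (l : ℕ))))) * h2

theorem ampFactor_update (lam : ℂ) {l l' : Fin T} (hl : l < l') (y : Fin T → Bool) (p : Bool) :
    ampFactor lam l (Function.update y l' p) = ampFactor lam l y := by
  have h : ∀ i, (i < l ∧ Function.update y l' p i = true) ↔ (i < l ∧ y i = true) := fun i =>
    and_congr_right fun hi => by rw [Function.update_of_ne (hi.trans hl).ne]
  simp only [ampFactor, Function.update_of_ne hl.ne, h]

/-- Stages run from the lowest bit upwards. The invariant after `j` stages: each bit below `j` has
contributed its factor, the others are still `0`. -/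
theorem estimationProgram_mulVec_emb_aux {m n : ℕ} (G : GivensCircuit N) (I : Fin m ↪o Fin N)
    (J : Fin n ↪o Fin N) {w : (Fin N → Bool) → ℂ} {lam : ℂ}
    (hw : systemWalk G I J *ᵥ w = lam • w) (B : (Fin t → Bool) → ℂ) (j : ℕ) (hj : j ≤ T) :
    Program.op (estimationProgram e I J j : Program N t a) G *ᵥ
      emb e (fun y b => (if ∀ l, y l = false then B b else 0) • w)
      = emb e fun y b => ((∏ l : Fin T, if (l : ℕ) < j then ampFactor lam l y else 1) *
        if ∀ l : Fin T, j ≤ (l : ℕ) → y l = false then B b else 0) • w := by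
  induction j with
  | zero => simp [estimationProgram]
  | succ j ih =>
    have hjT : j < T := hj
    rw [estimationProgram, dif_pos hjT, Program.op_append, ← Matrix.mulVec_mulVec,
      ih hjT.le, stageProgram_mulVec_emb e G I J ⟨j, hjT⟩ hw]
    · congr 1
      funext y b
      congr 1
      rw [← mul_assoc]
      congr 1
      -- The factors of the bits below `j` ignore the bit `j`, so resetting it does not affect them.
      · have : ∀ l : Fin T, (if (l : ℕ) < j + 1 then ampFactor lam l y else 1)
            = (if l = ⟨j, hjT⟩ then ampFactor lam l y else 1) *
              if (l : ℕ) < j then ampFactor lam l (Function.update y ⟨j, hjT⟩ false) else 1 := by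
          intro l
          rcases lt_trichotomy (l : ℕ) j with h | h | h
          · rw [if_pos (by omega), if_neg (by rw [Fin.ext_iff]; exact h.ne), if_pos h,
              ampFactor_update lam (by exact h), one_mul]
          · rw [if_pos (by omega), if_pos (by rw [Fin.ext_iff]; exact h), if_neg (by omega), mul_one]
          · rw [if_neg (by omega), if_neg (by rw [Fin.ext_iff]; exact h.ne'), if_neg (by omega),
              one_mul]
        simp only [this]
        rw [Finset.prod_mul_distrib, Finset.prod_ite_eq' Finset.univ (⟨j, hjT⟩ : Fin T)]
        simp
      · refine if_congr ⟨fun h l hl => ?_, fun h l hl => ?_⟩ rfl rfl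
        · have := h l (by omega)
          rwa [Function.update_of_ne] at this
          rintro rfl
          simp at hl
        · rcases eq_or_lt_of_le hl with h' | h'
          · have : l = ⟨j, hjT⟩ := Fin.ext h'.symm
            subst this
            simp
          · rw [Function.update_of_ne]
            · exact h l h'
            · rintro rfl
              simp at h'
    · intro y b hy
      rw [if_neg, mul_zero]
      intro h
      rw [h ⟨j, hjT⟩ le_rfl] at hy
      exact absurd hy (by simp)

/-- Phase estimation on an eigenvector of the walk. -/
theorem estimationProgram_mulVec_emb {m n : ℕ} (G : GivensCircuit N) (I : Fin m ↪o Fin N)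
    (J : Fin n ↪o Fin N) {w : (Fin N → Bool) → ℂ} {lam : ℂ}
    (hw : systemWalk G I J *ᵥ w = lam • w) (B : (Fin t → Bool) → ℂ) :
    Program.op (estimationProgram e I J T : Program N t a) G *ᵥ
      emb e (fun y b => (if ∀ l, y l = false then B b else 0) • w)
      = emb e fun y b => (B b * amp lam y) • w := by
  rw [estimationProgram_mulVec_emb_aux e G I J hw B T le_rfl]
  congr 1
  funext y b
  congr 1
  rw [if_pos fun l hl => absurd l.2 (by omega), mul_comm]
  congr 1
  rw [amp]
  exact Finset.prod_congr rfl fun l _ => if_pos l.2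

/-! ### Rounding -/

/-- The gates that compute the folded phase and the carries of the addition of `r`. -/
def addGates (top : Fin T) (r : ℕ) : List (Xor (Wire N t a)) :=
  ((List.finRange T).map fun i =>
    { tgt := ancWire e (Sum.inr (Sum.inl i))
      src₁ := phaseWire e i
      src₂ := phaseWire e top
      ne₁ := phaseWire_ne_ancWire e _ _
      ne₂ := phaseWire_ne_ancWire e _ _
      f := xor }) ++
  (List.finRange T).map fun i =>
    { tgt := ancWire e (Sum.inr (Sum.inr i.succ))
      src₁ := ancWire e (Sum.inr (Sum.inl i))
      src₂ := ancWire e (Sum.inr (Sum.inr i.castSucc))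
      ne₁ := by rw [Ne, ancWire_inj]; simp
      ne₂ := by rw [Ne, ancWire_inj]; simp [Fin.ext_iff]
      f := fun p q => Bool.atLeastTwo p (r.testBit i) q }

/-- The gates that add the high bits of the sum to the output register. -/
def outGates {s : ℕ} (hT : T = t + s) (r : ℕ) : List (Xor (Wire N t a)) :=
  (List.finRange t).map fun i =>
    { tgt := Sum.inr (Sum.inl i)
      src₁ := ancWire e (Sum.inr (Sum.inl ⟨i + s, by omega⟩))
      src₂ := ancWire e (Sum.inr (Sum.inr ⟨i + s, by omega⟩))
      ne₁ := (out_ne_ancWire e _ _).symm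
      ne₂ := (out_ne_ancWire e _ _).symm
      f := fun p q => xor p (xor (r.testBit (i + s)) q) }

theorem addGates_pairwise (top : Fin T) (r : ℕ) :
    (addGates e top r : List (Xor (Wire N t a))).Pairwise Xor.Before := by
  rw [addGates, List.pairwise_append, List.pairwise_map, List.pairwise_map]
  refine ⟨(List.pairwise_lt_finRange T).imp fun {i j} hij => ⟨?_, ?_, ?_⟩,
    (List.pairwise_lt_finRange T).imp fun {i j} hij => ⟨?_, ?_, ?_⟩, ?_⟩
  · intro g hg h hh
    obtain ⟨i, _, rfl⟩ := List.mem_map.1 hg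
    obtain ⟨j, _, rfl⟩ := List.mem_map.1 hh
    refine ⟨?_, phaseWire_ne_ancWire e _ _, phaseWire_ne_ancWire e _ _⟩
    simp only [Ne, ancWire_inj]
    simp
  · simp only [Ne, ancWire_inj]
    simpa using hij.ne
  · exact phaseWire_ne_ancWire e _ _
  · exact phaseWire_ne_ancWire e _ _
  · simp only [Ne, ancWire_inj]
    simpa using hij.ne
  · simp only [Ne, ancWire_inj]
    simp
  · simp only [Ne, ancWire_inj, Sum.inr.injEq, Fin.ext_iff, Fin.val_castSucc, Fin.val_succ]
    have : (i : ℕ) < j := hij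
    omega

theorem mem_addGates {top : Fin T} {r : ℕ} {g : Xor (Wire N t a)} (hg : g ∈ addGates e top r) :
    ∃ k, g.tgt = ancWire e k := by
  rcases List.mem_append.1 hg with hg | hg <;> obtain ⟨i, _, rfl⟩ := List.mem_map.1 hg <;>
    exact ⟨_, rfl⟩

theorem runXor_addGates_fold (top : Fin T) (r : ℕ) {x : Wire N t a → Bool}
    (hx : ∀ k, x (ancWire e k) = false) (i : Fin T) :
    runXor (addGates e top r) x (ancWire e (Sum.inr (Sum.inl i)))
      = fold top (fun l => x (phaseWire e l)) i := by
  have hph : ∀ l, runXor (addGates e top r) x (phaseWire e l) = x (phaseWire e l) := by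
    intro l
    apply runXor_of_ne
    intro g hg
    obtain ⟨k, hk⟩ := mem_addGates e hg
    rw [hk]
    exact phaseWire_ne_ancWire e _ _
  have h := runXor_tgt (addGates_pairwise e top r) x
    (List.mem_append_left _ (List.mem_map_of_mem (List.mem_finRange i)))
  simp only [hx, hph, Bool.false_xor] at h
  exact h

/-- Identifies the ripple carries with those of `BitVec` addition, which supplies the bits of the
sum. -/
theorem runXor_addGates_carry (top : Fin T) (r : ℕ) {x : Wire N t a → Bool}
    (hx : ∀ k, x (ancWire e k) = false) (k : Fin (T + 1)) :
    runXor (addGates e top r) x (ancWire e (Sum.inr (Sum.inr k)))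
      = BitVec.carry k (BitVec.ofNat T (Nat.ofBits (fold top fun l => x (phaseWire e l))))
          (BitVec.ofNat T r) false := by
  induction k using Fin.induction with
  | zero =>
    rw [runXor_of_ne, hx]
    · simp
    · intro g hg
      rcases List.mem_append.1 hg with hg | hg <;> obtain ⟨i, _, rfl⟩ := List.mem_map.1 hg
      · simp only [Ne, ancWire_inj]; simp
      · simp only [Ne, ancWire_inj, Sum.inr.injEq]
        exact (Fin.succ_ne_zero i).symm
  | succ i ih =>
    have h := runXor_tgt (addGates_pairwise e top r) x
      (List.mem_append_right _ (List.mem_map_of_mem (List.mem_finRange i)))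
    simp only [hx, Bool.false_xor, runXor_addGates_fold e top r hx, ih] at h
    rw [h, Fin.val_succ, BitVec.carry_succ, BitVec.getLsbD_ofNat, BitVec.getLsbD_ofNat,
      Nat.testBit_ofBits_lt _ _ i.2]
    simp

/-- The rounded phase. -/
def rounded (top : Fin T) (s r : ℕ) (y : Fin T → Bool) (i : Fin t) : Bool :=
  (Nat.ofBits (fold top y) + r).testBit (i + s)

theorem runXor_outGates {s : ℕ} (hT : T = t + s) (r : ℕ) (x : Wire N t a → Bool) (i : Fin t) :
    runXor (outGates e hT r) x (Sum.inr (Sum.inl i)) = xor (x (Sum.inr (Sum.inl i)))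
      (xor (x (ancWire e (Sum.inr (Sum.inl ⟨i + s, by omega⟩)))) (xor (r.testBit (i + s))
        (x (ancWire e (Sum.inr (Sum.inr ⟨i + s, by omega⟩)))))) := by
  have hp : (outGates e hT r : List (Xor (Wire N t a))).Pairwise Xor.Before := by
    rw [outGates, List.pairwise_map]
    refine (List.pairwise_lt_finRange t).imp fun {i j} hij => ⟨?_, (out_ne_ancWire e _ _).symm,
      (out_ne_ancWire e _ _).symm⟩
    simpa using hij.ne
  have hk : ∀ k, runXor (outGates e hT r) x (ancWire e k) = x (ancWire e k) := by
    intro k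
    apply runXor_of_ne
    intro g hg
    obtain ⟨i, _, rfl⟩ := List.mem_map.1 hg
    exact (out_ne_ancWire e _ _).symm
  have h := runXor_tgt hp x (List.mem_map_of_mem (List.mem_finRange i))
  simp only [hk] at h
  exact h

/-- The string `x` with `c` added to the output register. -/
def flipOut (c : Fin t → Bool) (x : Wire N t a → Bool) : Wire N t a → Bool
  | Sum.inr (Sum.inl i) => xor (x (Sum.inr (Sum.inl i))) (c i)
  | w => x w

theorem step_flipOut (c : Fin t → Bool) (g : Xor (Wire N t a))
    (hg : ∀ i, Sum.inr (Sum.inl i) ≠ g.tgt ∧ Sum.inr (Sum.inl i) ≠ g.src₁ ∧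
      Sum.inr (Sum.inl i) ≠ g.src₂) (x : Wire N t a → Bool) :
    g.step (flipOut c x) = flipOut c (g.step x) := by
  have h : ∀ w : Wire N t a, (∀ i, Sum.inr (Sum.inl i) ≠ w) → ∀ z, flipOut c z w = z w := by
    intro w hw z
    rcases w with w | w | w
    · rfl
    · exact absurd rfl (hw w)
    · rfl
  funext w
  by_cases hw : w = g.tgt
  · subst hw
    rw [h _ (fun i => (hg i).1), Xor.step, Xor.step, Function.update_self, Function.update_self,
      h _ (fun i => (hg i).1), h _ (fun i => (hg i).2.1), h _ (fun i => (hg i).2.2)]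
  · rw [Xor.step, Function.update_of_ne hw]
    rcases w with w | w | w
    · simp only [flipOut]; rw [Xor.step, Function.update_of_ne hw]
    · simp only [flipOut]; rw [Xor.step, Function.update_of_ne hw]
    · simp only [flipOut]; rw [Xor.step, Function.update_of_ne hw]

/-- Gates that avoid the output register commute with changes of it; so the addition can be
uncomputed after its result has been copied. -/
theorem runXor_flipOut (c : Fin t → Bool) (L : List (Xor (Wire N t a)))
    (hL : ∀ g ∈ L, ∀ i, Sum.inr (Sum.inl i) ≠ g.tgt ∧ Sum.inr (Sum.inl i) ≠ g.src₁ ∧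
      Sum.inr (Sum.inl i) ≠ g.src₂) (x : Wire N t a → Bool) :
    runXor L (flipOut c x) = flipOut c (runXor L x) := by
  induction L generalizing x with
  | nil => rfl
  | cons g L ih =>
    change runXor L (g.step (flipOut c x)) = flipOut c (runXor L (g.step x))
    rw [step_flipOut c g (hL g List.mem_cons_self), ih fun h hh => hL h (List.mem_cons_of_mem _ hh)]

/-- The program that adds the rounded phase to the output register. -/
def roundProgram {s : ℕ} (hT : T = t + s) (top : Fin T) (r : ℕ) : Program N t a :=
  xorProgram (addGates e top r ++ (outGates e hT r ++ (addGates e top r).reverse))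

theorem roundProgram_mulVec_emb (G : GivensCircuit N) {s : ℕ} (hT : T = t + s) (top : Fin T)
    (r : ℕ) (Φ : (Fin T → Bool) → (Fin t → Bool) → (Fin N → Bool) → ℂ) :
    Program.op (roundProgram e hT top r : Program N t a) G *ᵥ emb e Φ
      = emb e fun y b => Φ y fun i => xor (b i) (rounded top s r y i) := by
  ext x
  rw [roundProgram, xorProgram_mulVec, runXor_append, runXor_append]
  set X := runXor (addGates e top r) x with hX
  set c : Fin t → Bool := fun i =>
    xor (X (ancWire e (Sum.inr (Sum.inl ⟨i + s, by omega⟩)))) (xor (r.testBit (i + s))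
        (X (ancWire e (Sum.inr (Sum.inr ⟨i + s, by omega⟩))))) with hc
  have hout : runXor (outGates e hT r) X = flipOut c X := by
    funext w
    have hw : (∀ i, w ≠ Sum.inr (Sum.inl i)) → runXor (outGates e hT r) X w = X w := by
      intro hw
      apply runXor_of_ne
      intro g hg
      obtain ⟨i, _, rfl⟩ := List.mem_map.1 hg
      exact hw i
    rcases w with w | w | w
    · exact hw (by simp)
    · exact runXor_outGates e hT r X w
    · exact hw (by simp)
  have hav : ∀ g ∈ (addGates e top r : List (Xor (Wire N t a))).reverse, ∀ i,
      Sum.inr (Sum.inl i) ≠ g.tgt ∧ Sum.inr (Sum.inl i) ≠ g.src₁ ∧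
      Sum.inr (Sum.inl i) ≠ g.src₂ := by
    intro g hg i
    rw [List.mem_reverse] at hg
    rcases List.mem_append.1 hg with hg | hg <;> obtain ⟨j, _, rfl⟩ := List.mem_map.1 hg
    · exact ⟨out_ne_ancWire e _ _, out_ne_phaseWire e _ _, out_ne_phaseWire e _ _⟩
    · exact ⟨out_ne_ancWire e _ _, out_ne_ancWire e _ _, out_ne_ancWire e _ _⟩
  rw [hout, runXor_flipOut c _ hav, hX, runXor_reverse]
  have hanc : ∀ k, flipOut c x (ancWire e k) = x (ancWire e k) := fun k => rfl
  by_cases hx : ∀ k, x (ancWire e k) = false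
  · rw [emb, if_pos (by simpa only [hanc] using hx), emb, if_pos hx]
    -- Addition of `BitVec`s is modulo `2^T`, but only bits below `T` are read, and these agree with
    -- the bits of the sum of natural numbers.
    have hcr : c = rounded top s r (fun l => x (phaseWire e l)) := by
      funext i
      have hi : (i : ℕ) + s < T := by omega
      simp only [hc, hX]
      rw [runXor_addGates_fold e top r hx, runXor_addGates_carry e top r hx, rounded]
      have h := BitVec.getLsbD_add hi
        (BitVec.ofNat T (Nat.ofBits (fold top fun l => x (phaseWire e l)))) (BitVec.ofNat T r)
      rw [← BitVec.ofNat_add, BitVec.getLsbD_ofNat, BitVec.getLsbD_ofNat, BitVec.getLsbD_ofNat,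
        Nat.testBit_ofBits_lt _ _ hi] at h
      simp only [hi, decide_true, Bool.true_and] at h
      rw [h]
    have h1 : (fun i => flipOut c x (Sum.inr (Sum.inl i)))
        = fun i => xor (x (Sum.inr (Sum.inl i))) (rounded top s r (fun l => x (phaseWire e l)) i) := by
      rw [← hcr]
      rfl
    rw [h1]
    rfl
  · rw [emb, if_neg (by simpa only [hanc] using hx), emb, if_neg hx]

end Wires

end SubspaceSVE

end

noncomputable section

namespace SubspaceSVE

/-! ### The error of the algorithm -/

section Error

variable {N t T a : ℕ} (e : Aux N T ≃ Fin a)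

theorem emb_sum {ι : Type*} (s : Finset ι)
    (Φ : ι → (Fin T → Bool) → (Fin t → Bool) → (Fin N → Bool) → ℂ) :
    ∑ i ∈ s, emb e (Φ i) = emb e fun y b => ∑ i ∈ s, Φ i y b := by
  ext x
  rw [Finset.sum_apply]
  simp only [emb]
  split_ifs
  · rw [Finset.sum_apply]
  · simp

theorem emb_smul (c : ℂ) (Φ : (Fin T → Bool) → (Fin t → Bool) → (Fin N → Bool) → ℂ) :
    c • emb e Φ = emb e fun y b => c • Φ y b := by
  ext x
  rw [Pi.smul_apply]
  simp only [emb]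
  split_ifs <;> simp

theorem emb_add (Φ Ψ : (Fin T → Bool) → (Fin t → Bool) → (Fin N → Bool) → ℂ) :
    emb e Φ + emb e Ψ = emb e fun y b => Φ y b + Ψ y b := by
  ext x
  rw [Pi.add_apply]
  simp only [emb]
  split_ifs <;> simp

theorem emb_sub (Φ Ψ : (Fin T → Bool) → (Fin t → Bool) → (Fin N → Bool) → ℂ) :
    emb e Φ - emb e Ψ = emb e fun y b => Φ y b - Ψ y b := by
  ext x
  rw [Pi.sub_apply]
  simp only [emb]
  split_ifs <;> simp

/-- A string whose remaining work qubits are `0` is determined by the phase register, the output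
register and the system, so each term on the left occurs on the right. -/
theorem nsq_emb_le (Φ : (Fin T → Bool) → (Fin t → Bool) → (Fin N → Bool) → ℂ) :
    nsq (emb e Φ : (Wire N t a → Bool) → ℂ) ≤ ∑ y, ∑ b, nsq (Φ y b) := by
  have h : ∑ y, ∑ b, nsq (Φ y b) = ∑ z : (Fin T → Bool) × (Fin t → Bool) × (Fin N → Bool),
      ‖Φ z.1 z.2.1 z.2.2‖ ^ 2 := by
    rw [Fintype.sum_prod_type]
    refine Finset.sum_congr rfl fun y _ => ?_
    rw [Fintype.sum_prod_type]
    rfl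
  rw [h, nsq, ← Finset.sum_filter_add_sum_filter_not Finset.univ
    (fun x : Wire N t a → Bool => ∀ k, x (ancWire e k) = false)]
  have h0 : ∑ x ∈ Finset.univ.filter (fun x : Wire N t a → Bool => ¬ ∀ k, x (ancWire e k) = false),
      ‖emb e Φ x‖ ^ 2 = 0 := by
    apply Finset.sum_eq_zero
    intro x hx
    rw [emb, if_neg (Finset.mem_filter.1 hx).2]
    simp
  rw [h0, add_zero]
  set κ : (Wire N t a → Bool) → (Fin T → Bool) × (Fin t → Bool) × (Fin N → Bool) := fun x =>
    (fun l => x (phaseWire e l), fun i => x (Sum.inr (Sum.inl i)), fun i => x (Sum.inl i)) with hκ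
  have hinj : Set.InjOn κ (Finset.univ.filter
      (fun x : Wire N t a → Bool => ∀ k, x (ancWire e k) = false) : Finset _) := by
    intro x hx x' hx' hxx
    have hx := (Finset.mem_filter.1 hx).2
    have hx' := (Finset.mem_filter.1 hx').2
    simp only [hκ, Prod.mk.injEq] at hxx
    obtain ⟨h1, h2, h3⟩ := hxx
    funext w
    rcases w with i | i | i
    · exact congrFun h3 i
    · exact congrFun h2 i
    · obtain ⟨z, rfl⟩ := e.surjective i
      rcases z with l | k
      · exact congrFun h1 l
      · exact (hx k).trans (hx' k).symm
  have h1 : ∑ x ∈ Finset.univ.filter (fun x : Wire N t a → Bool => ∀ k, x (ancWire e k) = false),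
      ‖emb e Φ x‖ ^ 2 = ∑ z ∈ (Finset.univ.filter
        (fun x : Wire N t a → Bool => ∀ k, x (ancWire e k) = false)).image κ,
        ‖Φ z.1 z.2.1 z.2.2‖ ^ 2 := by
    rw [Finset.sum_image hinj]
    refine Finset.sum_congr rfl fun x hx => ?_
    rw [emb, if_pos (Finset.mem_filter.1 hx).2]
  rw [h1]
  exact Finset.sum_le_sum_of_subset_of_nonneg (Finset.subset_univ _) fun _ _ _ => sq_nonneg _

theorem withRegister_eq_emb (ψ : (Fin N → Bool) → ℂ) (c : Fin t → Bool) :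
    (withRegister ψ c : (Wire N t a → Bool) → ℂ)
      = emb e fun y b => (if ∀ l, y l = false then (if b = c then 1 else 0 : ℂ) else 0) • ψ := by
  ext x
  have hw : (∀ i, x (Sum.inr (Sum.inr i)) = false) ↔
      (∀ k, x (ancWire e k) = false) ∧ ∀ l, x (phaseWire e l) = false := by
    constructor
    · exact fun h => ⟨fun k => h _, fun l => h _⟩
    · rintro ⟨h1, h2⟩ i
      obtain ⟨z, rfl⟩ := e.surjective i
      rcases z with l | k
      · exact h2 l
      · exact h1 k
  have hb : (∀ i, x (Sum.inr (Sum.inl i)) = c i) ↔ (fun i => x (Sum.inr (Sum.inl i))) = c :=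
    funext_iff.symm
  simp only [withRegister, emb, hw, hb]
  by_cases h1 : ∀ k, x (ancWire e k) = false
  · by_cases h2 : ∀ l, x (phaseWire e l) = false
    · by_cases h3 : (fun i => x (Sum.inr (Sum.inl i))) = c
      · rw [if_pos ⟨h3, h1, h2⟩, if_pos h1, if_pos h2, if_pos h3, one_smul]
      · rw [if_neg fun h => h3 h.1, if_pos h1, if_pos h2, if_neg h3, zero_smul]; rfl
    · rw [if_neg fun h => h2 h.2.2, if_pos h1, if_neg h2, zero_smul]; rfl
  · rw [if_neg fun h => h1 h.2.1, if_neg h1]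

theorem sum_norm_indicator_sub_le (f g : Fin t → Bool) :
    ∑ b : Fin t → Bool, ‖((if (fun i => xor (b i) (f i)) = (fun _ => false) then 1 else 0) -
      (if b = g then 1 else 0) : ℂ)‖ ^ 2 ≤ if f = g then 0 else 2 := by
  have hbf : ∀ b : Fin t → Bool, (fun i => xor (b i) (f i)) = (fun _ => false) ↔ b = f := by
    intro b
    simp only [funext_iff]
    refine forall_congr' fun i => ?_
    cases b i <;> cases f i <;> simp
  simp only [hbf]
  split_ifs with h
  · subst h
    simp
  · calc _ ≤ ∑ b : Fin t → Bool, ((if b = f then 1 else 0) + (if b = g then 1 else 0) : ℝ) := by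
          refine Finset.sum_le_sum fun b _ => ?_
          split_ifs <;> norm_num
      _ = 2 := by
          rw [Finset.sum_add_distrib]
          simp
          norm_num

variable {m n : ℕ} (I : Fin m ↪o Fin N) (J : Fin n ↪o Fin N) (G : GivensCircuit N)

/-- The states of phase estimation applied to the subspace states. -/
theorem exists_estimation_states {W : Matrix (Fin m) (Fin m) ℝ} {σ : Fin n → ℝ}
    {V : Matrix (Fin n) (Fin n) ℝ}
    (hSVD : IsSVD ((GivensCircuit.orthogonal G).submatrix I J) W σ V) :
    (∀ S, 0 ≤ ∏ i ∈ S, σ i ∧ ∏ i ∈ S, σ i ≤ 1) ∧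
    ∃ ξ : Finset (Fin n) → (Fin T → Bool) → (Fin N → Bool) → ℂ,
      (∀ S (B : (Fin t → Bool) → ℂ),
        Program.op (estimationProgram e I J T : Program N t a) G *ᵥ
          emb e (fun y b => (if ∀ l, y l = false then B b else 0) • colState J V S)
        = emb e fun y b => B b • ξ S y) ∧
      (∀ S S', S.card = S'.card → S ≠ S' → ∀ y, star (ξ S y) ⬝ᵥ ξ S' y = 0) ∧
      ∀ S y, nsq (ξ S y) ≤ 2 *
        (‖amp (Complex.exp (2 * Real.pi * Complex.I *
            ((Real.arccos (∏ i ∈ S, σ i) / Real.pi : ℝ) : ℂ))) y‖ ^ 2 +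
          ‖amp (Complex.exp (2 * Real.pi * Complex.I *
            ((-(Real.arccos (∏ i ∈ S, σ i) / Real.pi) : ℝ) : ℂ))) y‖ ^ 2) := by
  set U := GivensCircuit.fbsOp G with hU
  set B := Uᴴ * projMat I * U with hB
  have hUU : Uᴴ * U = 1 := conjTranspose_fbsOp_mul G
  have hUU' : U * Uᴴ = 1 := mul_eq_one_comm.1 hUU
  have hBB : B * B = B := by
    calc B * B = Uᴴ * (projMat I * (U * Uᴴ) * projMat I) * U := by
          rw [hB]; simp only [Matrix.mul_assoc]
      _ = B := by rw [hUU', Matrix.mul_one, projMat_mul_self]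
  have hBh : Bᴴ = B := by
    rw [hB, Matrix.conjTranspose_mul, Matrix.conjTranspose_mul, Matrix.conjTranspose_conjTranspose,
      projMat_conjTranspose, Matrix.mul_assoc]
  have hA : ∀ S, projMat J *ᵥ colState J V S = colState J V S := fun S => by
    rw [projMat_mulVec, proj_colState]
  have hAB : ∀ S, projMat J *ᵥ (B *ᵥ colState J V S)
      = (((∏ i ∈ S, σ i) ^ 2 : ℝ) : ℂ) • colState J V S := fun S => by
    rw [projMat_mulVec, ← proj_conj_proj_colState I J G hSVD S, hB, ← Matrix.mulVec_mulVec,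
      ← Matrix.mulVec_mulVec, projMat_mulVec]
  have hp : ∀ S, 0 ≤ ∏ i ∈ S, σ i := fun S => Finset.prod_nonneg fun i _ => hSVD.nonneg i
  have hdec := fun S => exists_walk_eigenvectors (B := B) (hp S)
    (by rw [colState_orthonormal J hSVD.right_mem rfl, if_pos rfl]) (hA S)
    (projMat_conjTranspose J) (hAB S) hBB hBh
  refine ⟨fun S => ⟨hp S, (hdec S).1⟩, ?_⟩
  choose c₁ c₂ d₁ d₂ hsum hw₁ hw₂ hn₁ hn₂ using fun S => (hdec S).2
  -- The eigenvalue `exp(2i arccos p)` is `exp(2π i φ)` with `φ = arccos p / π`.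
  have hexp : ∀ S, Complex.exp (2 * Real.pi * Complex.I *
      ((Real.arccos (∏ i ∈ S, σ i) / Real.pi : ℝ) : ℂ))
      = Complex.exp (2 * Real.arccos (∏ i ∈ S, σ i) * Complex.I) := fun S => by
    congr 1
    have : (Real.pi : ℂ) ≠ 0 := by exact_mod_cast Real.pi_ne_zero
    push_cast
    field_simp
  have hexp' : ∀ S, Complex.exp (2 * Real.pi * Complex.I *
      ((-(Real.arccos (∏ i ∈ S, σ i) / Real.pi) : ℝ) : ℂ))
      = Complex.exp (-(2 * Real.arccos (∏ i ∈ S, σ i) * Complex.I)) := fun S => by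
    congr 1
    have : (Real.pi : ℂ) ≠ 0 := by exact_mod_cast Real.pi_ne_zero
    push_cast
    field_simp
  -- The invariant planes of different sets are orthogonal: since `v_S = A v_S`, the overlap of
  -- `v_S` with `B v_S'` is that with `A B v_S'`, a multiple of `v_S'`.
  have horth : ∀ S S', S.card = S'.card → S ≠ S' → ∀ x y z w : ℂ,
      star (x • colState J V S + y • (B *ᵥ colState J V S)) ⬝ᵥ
        (z • colState J V S' + w • (B *ᵥ colState J V S')) = 0 := by
    intro S S' hc hne x y z w
    have h1 : star (colState J V S) ⬝ᵥ colState J V S' = 0 := by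
      rw [colState_orthonormal J hSVD.right_mem hc, if_neg hne]
    have h2 : star (colState J V S) ⬝ᵥ (B *ᵥ colState J V S') = 0 := by
      nth_rewrite 1 [← hA S]
      rw [star_mulVec_dotProduct, projMat_conjTranspose, hAB, dotProduct_smul, h1, smul_zero]
    have h3 : star (B *ᵥ colState J V S) ⬝ᵥ colState J V S' = 0 := by
      rw [star_mulVec_dotProduct, hBh, h2]
    have h4 : star (B *ᵥ colState J V S) ⬝ᵥ (B *ᵥ colState J V S') = 0 := by
      rw [star_mulVec_dotProduct, hBh, Matrix.mulVec_mulVec, hBB, h2]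
    simp [star_add, star_smul, add_dotProduct, dotProduct_add, smul_dotProduct, dotProduct_smul,
      h1, h2, h3, h4]
  -- The unnormalized system state attached to the outcome `y`: both eigenvectors, each with its
  -- amplitude.
  refine ⟨fun S y => amp (Complex.exp (2 * Real.pi * Complex.I *
      ((Real.arccos (∏ i ∈ S, σ i) / Real.pi : ℝ) : ℂ))) y •
        (c₁ S • colState J V S + c₂ S • (B *ᵥ colState J V S)) +
      amp (Complex.exp (2 * Real.pi * Complex.I *
      ((-(Real.arccos (∏ i ∈ S, σ i) / Real.pi) : ℝ) : ℂ))) y •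
        (d₁ S • colState J V S + d₂ S • (B *ᵥ colState J V S)), ?_, ?_, ?_⟩
  · intro S K
    have hw₁' : systemWalk G I J *ᵥ _ = _ := hw₁ S
    have hw₂' : systemWalk G I J *ᵥ _ = _ := hw₂ S
    have hv : (emb e fun y b => (if ∀ l, y l = false then K b else 0) • colState J V S :
          (Wire N t a → Bool) → ℂ)
        = emb e (fun y b => (if ∀ l, y l = false then K b else 0) •
            (c₁ S • colState J V S + c₂ S • (B *ᵥ colState J V S))) +
          emb e (fun y b => (if ∀ l, y l = false then K b else 0) •
            (d₁ S • colState J V S + d₂ S • (B *ᵥ colState J V S))) := by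
      rw [emb_add]
      congr 1
      funext y b
      rw [← smul_add, hsum S]
    rw [hv, Matrix.mulVec_add, estimationProgram_mulVec_emb e G I J hw₁',
      estimationProgram_mulVec_emb e G I J hw₂', emb_add]
    congr 1
    funext y b
    dsimp only
    rw [hexp, hexp', smul_add (K b), smul_smul (K b), smul_smul (K b)]
  · intro S S' hc hne y
    simp only [smul_add, smul_smul]
    have regroup : ∀ (x y z w : ℂ) (u v : (Fin N → Bool) → ℂ),
        x • u + y • v + (z • u + w • v) = (x + z) • u + (y + w) • v := fun x y z w u v => by
      module
    rw [regroup, regroup]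
    exact horth S S' hc hne _ _ _ _
  · intro S y
    refine (nsq_add_le _ _).trans ?_
    rw [nsq_smul, nsq_smul]
    have h1 := mul_le_mul_of_nonneg_left (hn₁ S) (sq_nonneg ‖amp (Complex.exp (2 * Real.pi *
      Complex.I * ((Real.arccos (∏ i ∈ S, σ i) / Real.pi : ℝ) : ℂ))) y‖)
    have h2 := mul_le_mul_of_nonneg_left (hn₂ S) (sq_nonneg ‖amp (Complex.exp (2 * Real.pi *
      Complex.I * ((-(Real.arccos (∏ i ∈ S, σ i) / Real.pi) : ℝ) : ℂ))) y‖)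
    linarith

/-- The algorithm: phase estimation, rounding with the shift `r`, inverse phase estimation. -/
def sveProgram {s : ℕ} (hT : T = t + s) (top : Fin T) (r : ℕ) : Program N t a :=
  Program.inv (estimationProgram e I J T) ++
    (roundProgram e hT top r ++ estimationProgram e I J T)

/-- The squared error is at most twice the weight of the outcomes that are rounded to a wrong
estimate. -/
theorem nsq_sveProgram_sub_le {s : ℕ} (hT : T = t + s) (top : Fin T) (r : ℕ)
    {V : Matrix (Fin n) (Fin n) ℝ} {ξ : Finset (Fin n) → (Fin T → Bool) → (Fin N → Bool) → ℂ}
    (hξ : ∀ S (B : (Fin t → Bool) → ℂ),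
        Program.op (estimationProgram e I J T : Program N t a) G *ᵥ
          emb e (fun y b => (if ∀ l, y l = false then B b else 0) • colState J V S)
        = emb e fun y b => B b • ξ S y)
    (horth : ∀ S S', S.card = S'.card → S ≠ S' → ∀ y, star (ξ S y) ⬝ᵥ ξ S' y = 0)
    (k : ℕ) (α : Finset (Fin n) → ℂ) (est : Finset (Fin n) → Fin t → Bool) :
    nsq (Program.op (sveProgram e I J hT top r : Program N t a) G *ᵥ inputState J V k α
        - outputState J V k α est)
      ≤ ∑ S ∈ Finset.powersetCard k Finset.univ, ‖α S‖ ^ 2 *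
          ∑ y, nsq (ξ S y) * if rounded top s r y = est S then 0 else 2 := by
  set E := Program.op (estimationProgram e I J T : Program N t a) G with hE
  have hEE : Eᴴ * E = 1 := Program.conjTranspose_op_mul G _
  have hin : E *ᵥ inputState J V k α = emb e fun y b =>
      ∑ S ∈ Finset.powersetCard k Finset.univ,
        α S • (if b = (fun _ => false) then 1 else 0 : ℂ) • ξ S y := by
    rw [inputState, Matrix.mulVec_sum, ← emb_sum]
    refine Finset.sum_congr rfl fun S _ => ?_
    rw [Matrix.mulVec_smul, withRegister_eq_emb e, hξ S, emb_smul]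
  have hout : E *ᵥ outputState J V k α est = emb e fun y b =>
      ∑ S ∈ Finset.powersetCard k Finset.univ,
        α S • (if b = est S then 1 else 0 : ℂ) • ξ S y := by
    rw [outputState, Matrix.mulVec_sum, ← emb_sum]
    refine Finset.sum_congr rfl fun S _ => ?_
    rw [Matrix.mulVec_smul, withRegister_eq_emb e, hξ S fun b => if b = est S then 1 else 0,
      emb_smul]
  -- Input and desired output are compared after applying the unitary `E`. There both have the same
  -- components `ξ S y` and differ only in the output register.
  have hdiff : Program.op (sveProgram e I J hT top r : Program N t a) G *ᵥ inputState J V k α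
        - outputState J V k α est = Eᴴ *ᵥ emb e fun y b =>
        ∑ S ∈ Finset.powersetCard k Finset.univ,
          (α S * ((if (fun i => xor (b i) (rounded top s r y i)) = (fun _ => false) then 1 else 0) -
            (if b = est S then 1 else 0))) • ξ S y := by
    have h1 : outputState J V k α est = Eᴴ *ᵥ (E *ᵥ outputState J V k α est) := by
      rw [Matrix.mulVec_mulVec, hEE, Matrix.one_mulVec]
    rw [h1, sveProgram, Program.op_append, Program.op_append, Program.op_inv, ← hE,
      ← Matrix.mulVec_mulVec, ← Matrix.mulVec_mulVec, hin, roundProgram_mulVec_emb, hout,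
      ← Matrix.mulVec_sub, emb_sub]
    congr 2
    funext y b
    rw [← Finset.sum_sub_distrib]
    refine Finset.sum_congr rfl fun S _ => ?_
    rw [smul_smul, smul_smul, ← sub_smul, mul_sub]
  have hEE' : (Eᴴ)ᴴ * Eᴴ = 1 := by
    rw [Matrix.conjTranspose_conjTranspose]; exact mul_eq_one_comm.1 hEE
  rw [hdiff, nsq_mulVec hEE']
  refine (nsq_emb_le e _).trans ?_
  -- For fixed `y` and `b` the components of different `S` are orthogonal, so no cross terms arise.
  have hpyth : ∀ y (b : Fin t → Bool), nsq (∑ S ∈ Finset.powersetCard k Finset.univ,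
      (α S * ((if (fun i => xor (b i) (rounded top s r y i)) = (fun _ => false) then 1 else 0) -
            (if b = est S then 1 else 0))) • ξ S y)
      = ∑ S ∈ Finset.powersetCard k Finset.univ, ‖α S‖ ^ 2 * (nsq (ξ S y) *
        ‖((if (fun i => xor (b i) (rounded top s r y i)) = (fun _ => false) then 1 else 0) -
            (if b = est S then 1 else 0) : ℂ)‖ ^ 2) := by
    intro y b
    rw [nsq_sum_smul]
    · refine Finset.sum_congr rfl fun S _ => ?_
      rw [norm_mul, mul_pow]
      ring
    · intro S hS S' hS' hne
      exact horth S S' (by rw [(Finset.mem_powersetCard.1 hS).2, (Finset.mem_powersetCard.1 hS').2])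
        hne y
  simp only [hpyth]
  have hswap : ∑ y : Fin T → Bool, ∑ b : Fin t → Bool, ∑ S ∈ Finset.powersetCard k Finset.univ,
      ‖α S‖ ^ 2 * (nsq (ξ S y) *
        ‖((if (fun i => xor (b i) (rounded top s r y i)) = (fun _ => false) then 1 else 0) -
            (if b = est S then 1 else 0) : ℂ)‖ ^ 2)
      = ∑ S ∈ Finset.powersetCard k Finset.univ, ‖α S‖ ^ 2 * ∑ y, nsq (ξ S y) * ∑ b : Fin t → Bool,
        ‖((if (fun i => xor (b i) (rounded top s r y i)) = (fun _ => false) then 1 else 0) -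
            (if b = est S then 1 else 0) : ℂ)‖ ^ 2 := by
    simp only [Finset.mul_sum]
    rw [Finset.sum_comm]
    simp only [Finset.sum_comm (s := Finset.univ) (t := Finset.powersetCard k Finset.univ)]
    refine Finset.sum_congr rfl fun S _ => ?_
    rw [Finset.sum_comm]
  rw [hswap]
  refine Finset.sum_le_sum fun S _ => mul_le_mul_of_nonneg_left ?_ (sq_nonneg _)
  exact Finset.sum_le_sum fun y _ =>
    mul_le_mul_of_nonneg_left (sum_norm_indicator_sub_le _ _) (nsq_nonneg _)

/-! ### The cost of the algorithm -/

theorem cost_xorProgram (L : List (Xor (Wire N t a))) :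
    Program.cost (xorProgram L) G = L.length :=
  Program.cost_map_elementary G L _

theorem cost_reflProgram (l : Fin T) :
    Program.cost (reflProgram e J l : Program N t a) G = 2 * N + 1 := by
  rw [reflProgram, Program.cost_append, Program.cost_cons, cost_xorProgram, cost_xorProgram]
  simp [orGates, Instruction.gates]
  ring

theorem cost_walkProgram (l : Fin T) :
    Program.cost (walkProgram e I J l : Program N t a) G = 2 * G.length + 4 * N + 2 := by
  rw [walkProgram, Program.cost_append, Program.cost_cons, Program.cost_cons, cost_reflProgram,
    cost_reflProgram]
  simp [Instruction.gates, GivensCircuit.inverse]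
  ring

theorem cost_repeat (P : Program N t a) (k : ℕ) :
    Program.cost (Program.repeat P k) G = k * Program.cost P G := by
  induction k with
  | zero => simp [Program.repeat, Program.cost, Program.circuit]
  | succ k ih => rw [Program.repeat, Program.cost_append, ih]; ring

theorem cost_stageProgram (l : Fin T) :
    Program.cost (stageProgram e I J l : Program N t a) G
      = 2 ^ (T - 1 - (l : ℕ)) * (2 * G.length + 4 * N + 2) + (T + 2) := by
  have h1 : Program.cost (correctionProgram e l (List.finRange T) : Program N t a) G = T := by
    rw [correctionProgram, Program.cost_map_elementary, List.length_finRange]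
  have h2 : Program.cost ([] : Program N t a) G = 0 := by simp [Program.cost, Program.circuit]
  rw [stageProgram, Program.cost_append, Program.cost_append, Program.cost_cons, Program.cost_cons,
    h1, h2, cost_repeat, cost_walkProgram]
  simp [Instruction.gates]
  ring

/-- The geometric sum of the repetition numbers `2^(T-1-l)`, in additive form to avoid subtraction
of natural numbers. -/
theorem cost_estimationProgram_aux (j : ℕ) (hj : j ≤ T) :
    Program.cost (estimationProgram e I J j : Program N t a) G +
      2 ^ (T - j) * (2 * G.length + 4 * N + 2)
      = j * (T + 2) + 2 ^ T * (2 * G.length + 4 * N + 2) := by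
  induction j with
  | zero => simp [estimationProgram, Program.cost, Program.circuit]
  | succ j ih =>
    have hjT : j < T := hj
    have hpow : 2 ^ (T - j) = 2 ^ (T - (j + 1)) + 2 ^ (T - 1 - j) := by
      rw [show T - j = T - (j + 1) + 1 by omega, show T - 1 - j = T - (j + 1) by omega, pow_succ]
      ring
    have := ih hjT.le
    rw [hpow] at this
    rw [estimationProgram, dif_pos hjT, Program.cost_append, cost_stageProgram]
    dsimp only
    linarith

theorem cost_sveProgram_le {s : ℕ} (hT : T = t + s) (top : Fin T) (r : ℕ) :
    Program.cost (sveProgram e I J hT top r : Program N t a) G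
      ≤ 2 ^ T * (2 * (2 * G.length + 4 * N + 2) + 13) := by
  have h := cost_estimationProgram_aux e I J G (t := t) T le_rfl
  have hr : Program.cost (roundProgram e hT top r : Program N t a) G = 4 * T + t := by
    rw [roundProgram, cost_xorProgram]
    simp [addGates, outGates]
    ring
  rw [sveProgram, Program.cost_append, Program.cost_append, Program.cost_inv, hr]
  have h1 : T < 2 ^ T := Nat.lt_two_pow_self
  -- Source of the `13`: the lower-order terms `2 T (T + 2) + 4 T + t` are at most `2 T² + 9 T`,
  -- hence at most `4 · 2^T + 9 · 2^T`.
  have h2 : ∀ T : ℕ, T * T ≤ 2 * 2 ^ T := by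
    intro T
    induction T with
    | zero => simp
    | succ T ih =>
      rcases Nat.lt_or_ge T 3 with h3 | h3
      · interval_cases T <;> norm_num
      · rw [pow_succ]
        nlinarith
  have h3 := h2 T
  have h4 : t ≤ T := by omega
  have h5 : Program.cost (estimationProgram e I J T : Program N t a) G
      ≤ T * (T + 2) + 2 ^ T * (2 * G.length + 4 * N + 2) := by
    rw [← h]; exact Nat.le_add_right _ _
  linarith

end Error

end SubspaceSVE

end
namespace SubspaceSVE

/-! ### The main theorem -/

/-- The number of shifts for which the outcome `y` is rounded to a wrong estimate, as a fraction. -/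
noncomputable def wrongFraction {T : ℕ} (s : ℕ) (Z : ℝ) (y : Fin (T + 1) → Bool) : ℝ :=
  ((Finset.range (2 ^ s)).filter fun r =>
    (Nat.ofBits (fold (Fin.last T) y) + r) / 2 ^ s ≠ (⌊Z⌋₊ + r) / 2 ^ s).card / 2 ^ s

theorem wrongFraction_nonneg {T : ℕ} (s : ℕ) (Z : ℝ) (y : Fin (T + 1) → Bool) :
    0 ≤ wrongFraction s Z y := by
  unfold wrongFraction; positivity

theorem wrongFraction_le_one {T : ℕ} (s : ℕ) (Z : ℝ) (y : Fin (T + 1) → Bool) :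
    wrongFraction s Z y ≤ 1 := by
  unfold wrongFraction
  rw [div_le_one (by positivity)]
  have := Finset.card_filter_le (Finset.range (2 ^ s)) fun r =>
    (Nat.ofBits (fold (Fin.last T) y) + r) / 2 ^ s ≠ (⌊Z⌋₊ + r) / 2 ^ s
  rw [Finset.card_range] at this
  exact_mod_cast this

theorem wrongFraction_le {T : ℕ} (s : ℕ) {Z : ℝ} (h0 : 0 ≤ Z) (h1 : Z ≤ 2 ^ T)
    (y : Fin (T + 1) → Bool) (q : ℤ) :
    wrongFraction s Z y ≤ (|Nat.ofBits y - Z - 2 ^ (T + 1) * q| + 2) / 2 ^ s ∧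
    wrongFraction s Z y ≤ (|Nat.ofBits y + Z - 2 ^ (T + 1) * q| + 2) / 2 ^ s := by
  have h := card_shift_ne_le (L := 2 ^ s) (by positivity)
    (Nat.ofBits (fold (Fin.last T) y)) ⌊Z⌋₊
  obtain ⟨ha, hb⟩ := abs_fold_sub_le y h0 h1 q
  unfold wrongFraction
  exact ⟨div_le_div_of_nonneg_right (h.trans ha) (by positivity),
    div_le_div_of_nonneg_right (h.trans hb) (by positivity)⟩

/-- The estimate for the angle `π Z / 2 ^ (T + 1)`. -/
noncomputable def estimate {t : ℕ} (s r : ℕ) (Z : ℝ) (i : Fin t) : Bool := ((⌊Z⌋₊ + r) / 2 ^ s).testBit i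

theorem rounded_eq_estimate {t T s r : ℕ} {Z : ℝ} {y : Fin (T + 1) → Bool}
    (h : (Nat.ofBits (fold (Fin.last T) y) + r) / 2 ^ s = (⌊Z⌋₊ + r) / 2 ^ s) :
    (rounded (Fin.last T) s r y : Fin t → Bool) = estimate s r Z := by
  funext i
  rw [rounded, estimate, ← h, Nat.testBit_div_two_pow]

theorem abs_registerAngle_estimate_sub_le {t s r : ℕ} {Z : ℝ} (h0 : 0 ≤ Z)
    (h1 : Z ≤ 2 ^ (t + s)) (hr : r < 2 ^ s) :
    |registerAngle (estimate s r Z : Fin (t + 1) → Bool) - Real.pi * Z / 2 ^ (t + 1 + s)|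
      ≤ 4 / 2 ^ (t + 1) := by
  have hfl := Nat.floor_le h0
  have hfl' := Nat.lt_floor_add_one Z
  set B := (⌊Z⌋₊ + r) / 2 ^ s with hB
  have hs : (0 : ℝ) < 2 ^ s := by positivity
  have hZ : ⌊Z⌋₊ ≤ 2 ^ (t + s) := by
    have : (⌊Z⌋₊ : ℝ) ≤ 2 ^ (t + s) := hfl.trans h1
    exact_mod_cast this
  -- The angle is at most `π/2`, so `Z` lies in the lower half of the range and adding `r < 2^s`
  -- cannot overflow the `t + 1` bits.
  have hBlt : B < 2 ^ (t + 1) := by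
    rw [hB, Nat.div_lt_iff_lt_mul (by positivity)]
    have : 2 ^ (t + 1) * 2 ^ s = 2 ^ (t + s) + 2 ^ (t + s) := by
      rw [← pow_add, show t + 1 + s = t + s + 1 by ring, pow_succ]; ring
    have h2 : 2 ^ s ≤ 2 ^ (t + s) := Nat.pow_le_pow_right (by norm_num) (by omega)
    omega
  have hdm := Nat.div_add_mod (⌊Z⌋₊ + r) (2 ^ s)
  have hml := Nat.mod_lt (⌊Z⌋₊ + r) (show 0 < 2 ^ s by positivity)
  rw [← hB] at hdm
  have hdm' : (2 : ℝ) ^ s * B + ((⌊Z⌋₊ + r) % 2 ^ s : ℕ) = ⌊Z⌋₊ + r := by exact_mod_cast hdm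
  have hml' : (((⌊Z⌋₊ + r) % 2 ^ s : ℕ) : ℝ) + 1 ≤ 2 ^ s := by exact_mod_cast hml
  have hm0 : (0 : ℝ) ≤ ((⌊Z⌋₊ + r) % 2 ^ s : ℕ) := Nat.cast_nonneg _
  have hr' : (r : ℝ) + 1 ≤ 2 ^ s := by exact_mod_cast hr
  have hr0 : (0 : ℝ) ≤ r := Nat.cast_nonneg _
  -- The shift and the discarded remainder both lie in `[0, 2^s - 1]`, and the floor costs less than
  -- one.
  have hdist : |2 ^ s * (B : ℝ) - Z| ≤ 2 ^ s := by
    rw [abs_le]; constructor <;> linarith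
  have hang : registerAngle (estimate s r Z : Fin (t + 1) → Bool) = Real.pi * B / 2 ^ (t + 1) :=
    registerAngle_testBit hBlt
  have e1 : Real.pi * B / 2 ^ (t + 1) - Real.pi * Z / 2 ^ (t + 1 + s)
      = Real.pi / 2 ^ (t + 1 + s) * (2 ^ s * B - Z) := by
    rw [pow_add _ (t + 1) s]
    field_simp
  rw [hang, e1, abs_mul, abs_of_pos (by positivity : 0 < Real.pi / 2 ^ (t + 1 + s))]
  calc _ ≤ Real.pi / 2 ^ (t + 1 + s) * 2 ^ s := by gcongr
    _ = Real.pi / 2 ^ (t + 1) := by rw [pow_add _ (t + 1) s]; field_simp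
    _ ≤ 4 / 2 ^ (t + 1) := div_le_div_of_nonneg_right Real.pi_le_four (by positivity)

/-- Equal quotients force equal estimates; the converse is not needed for an upper bound. -/
theorem card_wrong_le {t T s : ℕ} (Z : ℝ) (y : Fin (T + 1) → Bool) :
    ∑ r : Fin (2 ^ s), (if (rounded (Fin.last T) s r y : Fin t → Bool) = estimate s r Z
      then (0 : ℝ) else 2) ≤ 2 * (2 ^ s * wrongFraction s Z y) := by
  have h : ∑ r : Fin (2 ^ s), (if (rounded (Fin.last T) s r y : Fin t → Bool) = estimate s r Z
      then (0 : ℝ) else 2) ≤ ∑ r : Fin (2 ^ s), if (Nat.ofBits (fold (Fin.last T) y) + r) / 2 ^ s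
        ≠ (⌊Z⌋₊ + r) / 2 ^ s then (2 : ℝ) else 0 := by
    refine Finset.sum_le_sum fun r _ => ?_
    by_cases hr : (Nat.ofBits (fold (Fin.last T) y) + r) / 2 ^ s = (⌊Z⌋₊ + r) / 2 ^ s
    · rw [if_pos (rounded_eq_estimate hr), if_neg (not_not.2 hr)]
    · rw [if_pos hr]
      split_ifs <;> norm_num
  refine h.trans (le_of_eq ?_)
  have h2 := Finset.sum_range (n := 2 ^ s) fun r =>
    if (Nat.ofBits (fold (Fin.last T) y) + r) / 2 ^ s ≠ (⌊Z⌋₊ + r) / 2 ^ s then (2 : ℝ) else 0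
  rw [← h2, ← Finset.sum_filter, Finset.sum_const, nsmul_eq_mul, wrongFraction,
    mul_div_cancel₀ _ (by positivity)]
  ring

/-- Markov's inequality for the uniform distribution. -/
theorem card_good_ge {R : ℕ} {δ : ℝ} (hδ : 0 < δ) (f : Fin R → ℝ) (hf : ∀ r, 0 ≤ f r)
    (h : ∑ r, f r ≤ δ ^ 3 * R) {good : Set (Fin R)} (hgood : ∀ r, f r ≤ δ ^ 2 → r ∈ good) :
    (1 - δ) * (R : ℝ) ≤ (Set.ncard good : ℝ) := by
  classical
  have hbad : ((Finset.univ.filter fun r => r ∉ good).card : ℝ) * δ ^ 2 ≤ δ ^ 3 * R := by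
    calc _ = ∑ r ∈ Finset.univ.filter (fun r => r ∉ good), δ ^ 2 := by
          rw [Finset.sum_const, nsmul_eq_mul]
      _ ≤ ∑ r ∈ Finset.univ.filter (fun r => r ∉ good), f r := by
          refine Finset.sum_le_sum fun r hr => ?_
          by_contra hc
          exact (Finset.mem_filter.1 hr).2 (hgood r (not_le.1 hc).le)
      _ ≤ ∑ r, f r := Finset.sum_le_sum_of_subset_of_nonneg (Finset.subset_univ _)
          fun r _ _ => hf r
      _ ≤ _ := h
  have hbad' : ((Finset.univ.filter fun r => r ∉ good).card : ℝ) ≤ δ * R := by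
    have h2 : 0 < δ ^ 2 := by positivity
    have : ((Finset.univ.filter fun r => r ∉ good).card : ℝ) * δ ^ 2 ≤ δ * R * δ ^ 2 := by
      linarith
    exact le_of_mul_le_mul_right this h2
  have hcard : (Finset.univ.filter fun r => r ∈ good).card +
      (Finset.univ.filter fun r => r ∉ good).card = R := by
    rw [Finset.card_filter_add_card_filter_not, Finset.card_univ, Fintype.card_fin]
  have hn : Set.ncard good = (Finset.univ.filter fun r => r ∈ good).card := by
    rw [← Set.ncard_coe_finset]; simp
  have hcard' : ((Finset.univ.filter fun r => r ∈ good).card : ℝ) +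
      ((Finset.univ.filter fun r => r ∉ good).card : ℝ) = R := by exact_mod_cast hcard
  rw [hn]
  linarith

theorem norm_toLp_sq {X : Type*} [Fintype X] (v : X → ℂ) : ‖WithLp.toLp 2 v‖ ^ 2 = nsq v := by
  rw [EuclideanSpace.norm_sq_eq]
  rfl

/-- The average of the squared error over the shifts. -/
theorem sum_nsq_sveProgram_sub_le {N m n t T s a : ℕ} {γ : ℝ} (e : Aux N (T + 1) ≃ Fin a)
    (I : Fin m ↪o Fin N) (J : Fin n ↪o Fin N) (G : GivensCircuit N) (hT : T + 1 = t + s)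
    (hγ : ∀ (φ : ℝ) (c : (Fin (T + 1) → Bool) → ℝ), (∀ y, 0 ≤ c y) → (∀ y, c y ≤ 1) →
      (∀ y (q : ℤ), c y ≤ (|Nat.ofBits y - 2 ^ (T + 1) * φ - 2 ^ (T + 1) * q| + 2) / 2 ^ s) →
      ∑ y, ‖amp (Complex.exp (2 * Real.pi * Complex.I * φ)) y‖ ^ 2 * c y ≤ γ)
    {W : Matrix (Fin m) (Fin m) ℝ} {σ : Fin n → ℝ} {V : Matrix (Fin n) (Fin n) ℝ}
    (hSVD : IsSVD ((GivensCircuit.orthogonal G).submatrix I J) W σ V) (k : ℕ)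
    (α : Finset (Fin n) → ℂ) (hα : ∑ S ∈ Finset.powersetCard k Finset.univ, ‖α S‖ ^ 2 = 1) :
    ∑ r : Fin (2 ^ s), nsq (Program.op (sveProgram e I J hT (Fin.last T) r : Program N t a) G *ᵥ
        inputState J V k α - outputState J V k α fun S =>
          estimate s r (2 ^ (T + 1) * (Real.arccos (∏ i ∈ S, σ i) / Real.pi)))
      ≤ 8 * γ * (2 ^ s : ℕ) := by
  obtain ⟨hp, ξ, hξ, horth, hn⟩ := exists_estimation_states (t := t) e I J G hSVD
  have hpi := Real.pi_pos
  set φ : Finset (Fin n) → ℝ := fun S => Real.arccos (∏ i ∈ S, σ i) / Real.pi with hφ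
  have hφ0 : ∀ S, 0 ≤ φ S := fun S => div_nonneg (Real.arccos_nonneg _) hpi.le
  -- Since `p ≥ 0`, the angle is at most `π/2` and `φ ≤ 1/2`; folding requires this half of the
  -- circle.
  have hφ1 : ∀ S, 2 ^ (T + 1) * φ S ≤ 2 ^ T := fun S => by
    have h1 : φ S ≤ 1 / 2 := by
      rw [hφ, div_le_iff₀ hpi]
      have := Real.arccos_le_pi_div_two.2 (hp S).1
      linarith
    have h2 : (0 : ℝ) < 2 ^ T := by positivity
    rw [pow_succ]
    nlinarith
  have hφ2 : ∀ S, 0 ≤ 2 ^ (T + 1) * φ S := fun S => mul_nonneg (by positivity) (hφ0 S)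
  have hS : ∀ S, ∑ r : Fin (2 ^ s), ∑ y, nsq (ξ S y) *
      (if (rounded (Fin.last T) s r y : Fin t → Bool) = estimate s r (2 ^ (T + 1) * φ S)
        then (0 : ℝ) else 2) ≤ 8 * γ * (2 ^ s : ℕ) := by
    intro S
    rw [Finset.sum_comm]
    set c := wrongFraction (T := T) s (2 ^ (T + 1) * φ S) with hc
    have hc0 := wrongFraction_nonneg (T := T) s (2 ^ (T + 1) * φ S)
    have h1 := hγ (φ S) c hc0 (wrongFraction_le_one s _)
      fun y q => (wrongFraction_le s (hφ2 S) (hφ1 S) y q).1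
    have h2 := hγ (-φ S) c hc0 (wrongFraction_le_one s _)
      fun y q => by
        have := (wrongFraction_le s (hφ2 S) (hφ1 S) y q).2
        rwa [mul_neg, sub_neg_eq_add]
    -- Source of the `8`: a factor `2` from splitting into two eigenvectors, a factor `2` from the
    -- squared distance of basis states, and one `γ` for each sign of the phase.
    calc _ ≤ ∑ y, (4 * 2 ^ s : ℝ) *
          (‖amp (Complex.exp (2 * Real.pi * Complex.I * (φ S : ℂ))) y‖ ^ 2 * c y +
            ‖amp (Complex.exp (2 * Real.pi * Complex.I * ((-φ S : ℝ) : ℂ))) y‖ ^ 2 * c y) := by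
          refine Finset.sum_le_sum fun y _ => ?_
          rw [← Finset.mul_sum]
          have h3 := card_wrong_le (t := t) (s := s) (2 ^ (T + 1) * φ S) y
          have h4 := mul_le_mul (hn S y) h3
            (Finset.sum_nonneg fun r _ => by split_ifs <;> norm_num) (by positivity)
          refine h4.trans (le_of_eq ?_)
          ring
      _ = (4 * 2 ^ s : ℝ) *
          ((∑ y, ‖amp (Complex.exp (2 * Real.pi * Complex.I * (φ S : ℂ))) y‖ ^ 2 * c y) +
            ∑ y, ‖amp (Complex.exp (2 * Real.pi * Complex.I * ((-φ S : ℝ) : ℂ))) y‖ ^ 2 * c y) := by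
          rw [← Finset.mul_sum, Finset.sum_add_distrib]
      _ ≤ (4 * 2 ^ s : ℝ) * (γ + γ) := by gcongr
      _ = _ := by push_cast; ring
  calc _ ≤ ∑ r : Fin (2 ^ s), ∑ S ∈ Finset.powersetCard k Finset.univ, ‖α S‖ ^ 2 *
          ∑ y, nsq (ξ S y) * if (rounded (Fin.last T) s r y : Fin t → Bool)
            = estimate s r (2 ^ (T + 1) * φ S) then (0 : ℝ) else 2 :=
        Finset.sum_le_sum fun r _ =>
          nsq_sveProgram_sub_le e I J G hT (Fin.last T) r hξ horth k α _
    _ = ∑ S ∈ Finset.powersetCard k Finset.univ, ‖α S‖ ^ 2 * ∑ r : Fin (2 ^ s),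
          ∑ y, nsq (ξ S y) * if (rounded (Fin.last T) s r y : Fin t → Bool)
            = estimate s r (2 ^ (T + 1) * φ S) then (0 : ℝ) else 2 := by
        rw [Finset.sum_comm]
        exact Finset.sum_congr rfl fun S _ => (Finset.mul_sum _ _ _).symm
    _ ≤ ∑ S ∈ Finset.powersetCard k Finset.univ, ‖α S‖ ^ 2 * (8 * γ * (2 ^ s : ℕ)) :=
        Finset.sum_le_sum fun S _ => mul_le_mul_of_nonneg_left (hS S) (sq_nonneg _)
    _ = 8 * γ * (2 ^ s : ℕ) := by rw [← Finset.sum_mul, hα, one_mul]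

end SubspaceSVE

theorem mainTheorem2 (c δ : ℝ) (hc : 0 < c) (hδ : 0 < δ) :
    ∃ C : ℝ, 0 < C ∧
      ∀ (N m n : ℕ) (I : Fin m ↪o Fin N) (J : Fin n ↪o Fin N) (ε : ℝ), 0 < ε → ε ≤ 1 →
        -- the algorithm: it draws a seed `r` uniformly at random and runs the program `P r`
        ∃ (t a R : ℕ) (P : Fin R → SubspaceSVE.Program N t a), 0 < R ∧
          ∀ G : SubspaceSVE.GivensCircuit N, (N : ℝ) ≤ c * (G.length : ℝ) →
            (∀ r, ((P r).cost G : ℝ) ≤ C * (G.length : ℝ) / ε) ∧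
            ∀ (A : Matrix (Fin m) (Fin n) ℝ) (W : Matrix (Fin m) (Fin m) ℝ) (σ : Fin n → ℝ)
              (V : Matrix (Fin n) (Fin n) ℝ),
              A = (SubspaceSVE.GivensCircuit.orthogonal G).submatrix I J →
              SubspaceSVE.IsSVD A W σ V →
              ∃ est : Fin R → Finset (Fin n) → Fin t → Bool,
                (∀ r S, |Real.cos (SubspaceSVE.registerAngle (est r S)) - ∏ i ∈ S, σ i| ≤ ε) ∧
                ∀ (k : ℕ) (α : Finset (Fin n) → ℂ),
                  ∑ S ∈ Finset.powersetCard k Finset.univ, ‖α S‖ ^ 2 = 1 →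
                  (1 - δ) * (R : ℝ) ≤
                    (Set.ncard {r : Fin R |
                      ‖WithLp.toLp 2 ((P r).op G *ᵥ SubspaceSVE.inputState J V k α
                        - SubspaceSVE.outputState J V k α (est r))‖ ≤ δ} : ℝ) := by
  open SubspaceSVE in
  -- With this `γ` the mean squared error is at most `δ³`, so by Markov it exceeds `δ²` for at most
  -- a fraction `δ` of the shifts.
  obtain ⟨s, hs⟩ := exists_weighted_outcomes_le (γ := δ ^ 3 / 8) (by positivity)
  -- The factor `8 · 2^s / ε` bounds `2^(t+s+1)`. The other one bounds `4 T + 8 N + 17` by `(21 +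
  -- 8c) T`, using `N ≤ c T` and `T ≥ 1`, where `T` is the length of the Givens circuit.
  refine ⟨8 * 2 ^ s * (21 + 8 * c), by positivity, fun N m n I J ε hε hε1 => ?_⟩
  -- Without system qubits the circuit may be empty and the allowed cost zero. The empty program
  -- serves: the only set is `∅`, and the empty register holds the angle `0` with cosine `1`, the
  -- empty product.
  rcases Nat.eq_zero_or_pos N with rfl | hN
  · refine ⟨0, 0, 1, fun _ => [], one_pos, fun G _ => ?_⟩
    have hn : n = 0 := by
      rcases Nat.eq_zero_or_pos n with h | h
      · exact h
      · exact (J ⟨0, h⟩).elim0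
    subst hn
    refine ⟨fun r => ?_, fun A W σ V _ _ => ⟨fun _ _ => Fin.elim0, fun r S => ?_, fun k α _ => ?_⟩⟩
    · have : Program.cost ([] : Program 0 0 0) G = 0 := by simp [Program.cost, Program.circuit]
      rw [this, Nat.cast_zero]
      positivity
    · have : S = ∅ := Subsingleton.elim _ _
      subst this
      simpa [registerAngle] using hε.le
    · have h0 : ∀ r : Fin 1, Program.op ([] : Program 0 0 0) G *ᵥ inputState J V k α
          - outputState J V k α (fun _ => Fin.elim0) = 0 := by
        intro r
        rw [Program.op_nil, Matrix.one_mulVec, sub_eq_zero, inputState, outputState]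
        refine Finset.sum_congr rfl fun S _ => ?_
        congr 2
        exact Subsingleton.elim _ _
      have h1 : {r : Fin 1 | ‖WithLp.toLp 2 (Program.op ([] : Program 0 0 0) G *ᵥ
          inputState J V k α - outputState J V k α (fun _ => Fin.elim0))‖ ≤ δ} = Set.univ := by
        ext r
        simp only [h0 r, Set.mem_univ, iff_true]
        simpa using hδ.le
      rw [h1, Set.ncard_univ]
      simp [hδ.le]
  -- `2^t ≤ 4/ε < 2^(t+1)`: the left inequality bounds the cost, the right one makes the angle error
  -- `4 / 2^(t+1)` at most `ε`. Phase estimation uses `s` bits more than the `t + 1` that are kept.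
  · obtain ⟨t, ht1, ht2⟩ := exists_nat_pow_near (x := 4 / ε) (y := 2)
      (by rw [le_div_iff₀ hε]; linarith) (by norm_num)
    have hT : t + s + 1 = t + 1 + s := by ring
    have e := Fintype.equivFin (Aux N (t + s + 1))
    refine ⟨t + 1, _, 2 ^ s, fun r => sveProgram e I J hT (Fin.last (t + s)) r, by positivity,
      fun G hG => ?_⟩
    have hG1 : (1 : ℝ) ≤ G.length := by
      rcases Nat.eq_zero_or_pos G.length with h | h
      · rw [h] at hG
        have : (1 : ℝ) ≤ N := by exact_mod_cast hN
        norm_num at hG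
        omega
      · exact_mod_cast h
    refine ⟨fun r => ?_, fun A W σ V hA hSVD => ?_⟩
    · have h1 := cost_sveProgram_le e I J G hT (Fin.last (t + s)) r
      have h2 : (Program.cost (sveProgram e I J hT (Fin.last (t + s)) r : Program N (t + 1) _) G : ℝ)
          ≤ 2 ^ (t + s + 1) * (2 * (2 * G.length + 4 * N + 2) + 13) := by exact_mod_cast h1
      refine h2.trans ?_
      have h3 : (2 : ℝ) ^ (t + s + 1) ≤ 8 * 2 ^ s / ε := by
        rw [hT, pow_add, pow_succ]
        calc (2 : ℝ) ^ t * 2 * 2 ^ s ≤ 4 / ε * 2 * 2 ^ s := by gcongr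
          _ = _ := by ring
      calc (2 : ℝ) ^ (t + s + 1) * (2 * (2 * G.length + 4 * N + 2) + 13)
          ≤ 8 * 2 ^ s / ε * ((21 + 8 * c) * G.length) := by
            apply mul_le_mul h3 _ (by positivity) (by positivity)
            linarith
        _ = _ := by ring
    · subst hA
      obtain ⟨hp, -⟩ := exists_estimation_states (t := t + 1) e I J G hSVD
      have hpi := Real.pi_pos
      refine ⟨fun r S => estimate s r
        (2 ^ (t + s + 1) * (Real.arccos (∏ i ∈ S, σ i) / Real.pi)), fun r S => ?_, fun k α hα => ?_⟩
      · have hcos := Real.cos_arccos (by linarith [(hp S).1]) (hp S).2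
        have h0 := Real.arccos_nonneg (∏ i ∈ S, σ i)
        have h1 := Real.arccos_le_pi_div_two.2 (hp S).1
        have h := abs_registerAngle_estimate_sub_le (t := t) (s := s) (r := r)
          (Z := 2 ^ (t + s + 1) * (Real.arccos (∏ i ∈ S, σ i) / Real.pi)) (by positivity)
          (by
            have h2 : Real.arccos (∏ i ∈ S, σ i) / Real.pi ≤ 1 / 2 := by
              rw [div_le_iff₀ hpi]; linarith
            have h3 : (0 : ℝ) < 2 ^ (t + s) := by positivity
            rw [pow_succ]
            nlinarith) r.2
        have e1 : Real.pi * (2 ^ (t + s + 1) * (Real.arccos (∏ i ∈ S, σ i) / Real.pi)) /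
            2 ^ (t + 1 + s) = Real.arccos (∏ i ∈ S, σ i) := by
          rw [hT]; field_simp
        rw [e1] at h
        conv_lhs => rw [← hcos]
        -- The cosine is 1-Lipschitz, so the error of the angle bounds the error of the product of
        -- singular values.
        refine (Real.abs_cos_sub_cos_le _ _).trans (h.trans ?_)
        rw [div_lt_iff₀ hε] at ht2
        rw [div_le_iff₀ (by positivity)]
        linarith
      · have h := sum_nsq_sveProgram_sub_le e I J G hT (hs (t + s + 1)) hSVD k α hα
        refine card_good_ge hδ _ (fun r => nsq_nonneg _) (h.trans (le_of_eq (by ring))) ?_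
        intro r hr
        rw [← norm_toLp_sq] at hr
        exact le_of_sq_le_sq hr hδ.le
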